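/- Theorem. Computation model: a probabilistic real random-access machine, i.e. a single fixed program with arrays of natural numbers and of complex numbers, exact arithmetic and comparisons, indirect addressing and fair coin tosses, every elementary operation having unit cost. Let $G$ be a grid graph on $n\ge 1$ qubits. Let $U$ be a depth-$d$ quantum circuit on $G$: a sequence of $d$ layers, each consisting of two-qubit unitary gates acting on pairwise disjoint pairs of qubits that are adjacent in $G$. Let $O_1,\dots,O_n$ be single-qubit operators with operator norm $\|O_j\|\le 1$ (for instance observables, i.e. Hermitian operators), and put $$\mu=\langle 0^n|U^\dagger (O_1\otimes\cdots\otimes O_n)U|0^n\rangle .$$ The input consists of the side lengths of the grid, $d$, the gates of $U$ (their qubits and matrix entries, layer by layer), the matrices $O_j$, and an error tolerance $\delta>0$. (2D) There are a randomized classical algorithm and an absolute constant $C$ such that, for every two-dimensional $a\times b$ grid of $n=ab\ge 1$ qubits, every $d\ge 0$ and all $U$, $O_j$, $\delta$ as above, the algorithm always halts within $$C\,n\,\max(1,\delta^{-2})\,2^{C d^2}$$ steps and, with probability at least $2/3$, outputs a number $\tilde\mu\in\mathbb{C}$ with $|\tilde\mu-\mu|\le\delta$. In short, for $\delta\le 1$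 the running time is $n\,\delta^{-2}\,2^{O(d^2)}$. (3D) There are a randomized classical algorithm and an absolute constant $C$ such that, for every three-dimensional $m\times m\times m$ grid of $n=m^3\ge 1$ qubits, every $d\ge 1$ and all $U$, $O_j$, $\delta$ as above, the algorithm always halts within $$\max(1,\delta^{-2})\,2^{C d^2 n^{1/3}}$$ steps and, with probability at least $2/3$, outputs a number $\tilde\mu\in\mathbb{C}$ with $|\tilde\mu-\mu|\le\delta$. In short, for $\delta\le 1$ the running time is $\delta^{-2}\,2^{O(d^2 n^{1/3})}$. -/

import Mathlib

open MeasureTheory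

namespace MeanValue

/-! ### A randomized random-access machine with exact complex arithmetic

A program is a `while` program over random-access arrays of natural numbers and of complex
numbers. Arrays are named by numerals that are fixed in the program text; positions in them are
computed at run time. All elementary operations have unit cost, as on the usual real RAM: there
is no rounding, no integer division and no operation on the digits of a number. The only source
of randomness is a fair coin, and the only literals are natural numbers. -/

/-- Index expressions. `load a i` is the entry at position `i` of the integer array `a`;
`sub` is truncated subtraction. -/
inductive IExp : Type
  | lit (k : ℕ) : IExp
  | load (a : ℕ) (i : IExp) : IExp
  | add (e f : IExp) : IExp
  | sub (e f : IExp) : IExp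
  | mul (e f : IExp) : IExp

/-- Complex expressions. `load a i` is the entry at position `i` of the complex array `a`;
`cast` converts a natural number; `div` returns `0` when the divisor is `0`. -/
inductive CExp : Type
  | cast (e : IExp) : CExp
  | load (a : ℕ) (i : IExp) : CExp
  | add (e f : CExp) : CExp
  | sub (e f : CExp) : CExp
  | mul (e f : CExp) : CExp
  | div (e f : CExp) : CExp
  | conj (e : CExp) : CExp

/-- Tests: comparison of natural numbers, comparison of real parts, and Boolean connectives. -/
inductive BExp : Type
  | ile (e f : IExp) : BExp
  | cle (e f : CExp) : BExp
  | not (b : BExp) : BExp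
  | and (b c : BExp) : BExp

/-- Programs. `flip a i` tosses a fair coin and stores the result (`0` or `1`) at position `i`
of the integer array `a`. -/
inductive Cmd : Type
  | skip : Cmd
  | istore (a : ℕ) (i : IExp) (e : IExp) : Cmd
  | cstore (a : ℕ) (i : IExp) (e : CExp) : Cmd
  | flip (a : ℕ) (i : IExp) : Cmd
  | seq (p q : Cmd) : Cmd
  | ite (b : BExp) (p q : Cmd) : Cmd
  | loop (b : BExp) (p : Cmd) : Cmd

/-- A machine state: the integer arrays, the complex arrays, and the coin tosses that are still
to come. -/
structure State where
  imem : ℕ → ℕ → ℕ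
  cmem : ℕ → ℕ → ℂ
  coins : ℕ → Bool

/-- The value of an index expression. -/
def IExp.eval (s : State) : IExp → ℕ
  | .lit k => k
  | .load a i => s.imem a (i.eval s)
  | .add e f => e.eval s + f.eval s
  | .sub e f => e.eval s - f.eval s
  | .mul e f => e.eval s * f.eval s

/-- The value of a complex expression. -/
noncomputable def CExp.eval (s : State) : CExp → ℂ
  | .cast e => (e.eval s : ℂ)
  | .load a i => s.cmem a (i.eval s)
  | .add e f => e.eval s + f.eval s
  | .sub e f => e.eval s - f.eval s
  | .mul e f => e.eval s * f.eval s
  | .div e f => e.eval s / f.eval s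
  | .conj e => (starRingEnd ℂ) (e.eval s)

/-- The truth of a test. -/
def BExp.eval (s : State) : BExp → Prop
  | .ile e f => e.eval s ≤ f.eval s
  | .cle e f => (e.eval s).re ≤ (f.eval s).re
  | .not b => ¬ b.eval s
  | .and b c => b.eval s ∧ c.eval s

/-- The number of elementary operations in an index expression. -/
def IExp.cost : IExp → ℕ
  | .lit _ => 1
  | .load _ i => i.cost + 1
  | .add e f => e.cost + f.cost + 1
  | .sub e f => e.cost + f.cost + 1
  | .mul e f => e.cost + f.cost + 1

/-- The number of elementary operations in a complex expression. -/
def CExp.cost : CExp → ℕ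
  | .cast e => e.cost + 1
  | .load _ i => i.cost + 1
  | .add e f => e.cost + f.cost + 1
  | .sub e f => e.cost + f.cost + 1
  | .mul e f => e.cost + f.cost + 1
  | .div e f => e.cost + f.cost + 1
  | .conj e => e.cost + 1

/-- The number of elementary operations in a test. -/
def BExp.cost : BExp → ℕ
  | .ile e f => e.cost + f.cost + 1
  | .cle e f => e.cost + f.cost + 1
  | .not b => b.cost + 1
  | .and b c => b.cost + c.cost + 1

/-- Overwrite the entry at position `i` of the integer array `a`. -/
def State.setI (s : State) (a i k : ℕ) : State :=
  { s with imem := Function.update s.imem a (Function.update (s.imem a) i k) }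

/-- Overwrite the entry at position `i` of the complex array `a`. -/
def State.setC (s : State) (a i : ℕ) (z : ℂ) : State :=
  { s with cmem := Function.update s.cmem a (Function.update (s.cmem a) i z) }

/-- Consume one coin toss. -/
def State.dropCoin (s : State) : State :=
  { s with coins := fun k => s.coins (k + 1) }

/-- `Exec p s s' t`: the program `p`, started in the state `s`, halts in the state `s'` after
exactly `t` steps. -/
inductive Exec : Cmd → State → State → ℕ → Prop
  | skip (s : State) : Exec .skip s s 1
  | istore (s : State) (a : ℕ) (i e : IExp) :
      Exec (.istore a i e) s (s.setI a (i.eval s) (e.eval s)) (i.cost + e.cost + 1)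
  | cstore (s : State) (a : ℕ) (i : IExp) (e : CExp) :
      Exec (.cstore a i e) s (s.setC a (i.eval s) (e.eval s)) (i.cost + e.cost + 1)
  | flip (s : State) (a : ℕ) (i : IExp) :
      Exec (.flip a i) s (s.dropCoin.setI a (i.eval s) (s.coins 0).toNat) (i.cost + 1)
  | seq {p q : Cmd} {s s' s'' : State} {t t' : ℕ} (hp : Exec p s s' t) (hq : Exec q s' s'' t') :
      Exec (.seq p q) s s'' (t + t')
  | ite_true {b : BExp} {p q : Cmd} {s s' : State} {t : ℕ} (hb : b.eval s)
      (hp : Exec p s s' t) : Exec (.ite b p q) s s' (b.cost + t)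
  | ite_false {b : BExp} {p q : Cmd} {s s' : State} {t : ℕ} (hb : ¬ b.eval s)
      (hq : Exec q s s' t) : Exec (.ite b p q) s s' (b.cost + t)
  | loop_done {b : BExp} {p : Cmd} {s : State} (hb : ¬ b.eval s) :
      Exec (.loop b p) s s b.cost
  | loop_step {b : BExp} {p : Cmd} {s s' s'' : State} {t t' : ℕ} (hb : b.eval s)
      (hp : Exec p s s' t) (hl : Exec (.loop b p) s' s'' t') :
      Exec (.loop b p) s s'' (b.cost + t + t')

/-- The coin tosses determine the final state and the number of steps. -/
theorem Exec.deterministic {p : Cmd} {s s₁ : State} {t₁ : ℕ} (h : Exec p s s₁ t₁) :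
    ∀ {s₂ : State} {t₂ : ℕ}, Exec p s s₂ t₂ → s₁ = s₂ ∧ t₁ = t₂ := by
  induction h with
  | skip | istore | cstore | flip => intro s₂ t₂ h₂; cases h₂; exact ⟨rfl, rfl⟩
  | seq _ _ ih₁ ih₂ =>
    intro s₂ t₂ h₂
    cases h₂ with
    | seq g₁ g₂ =>
      obtain ⟨rfl, rfl⟩ := ih₁ g₁
      obtain ⟨rfl, rfl⟩ := ih₂ g₂
      exact ⟨rfl, rfl⟩
  | ite_true hb _ ih =>
    intro s₂ t₂ h₂
    cases h₂ with
    | ite_true _ g => obtain ⟨rfl, rfl⟩ := ih g; exact ⟨rfl, rfl⟩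
    | ite_false hb' _ => exact absurd hb hb'
  | ite_false hb _ ih =>
    intro s₂ t₂ h₂
    cases h₂ with
    | ite_true hb' _ => exact absurd hb' hb
    | ite_false _ g => obtain ⟨rfl, rfl⟩ := ih g; exact ⟨rfl, rfl⟩
  | loop_done hb =>
    intro s₂ t₂ h₂
    cases h₂ with
    | loop_done _ => exact ⟨rfl, rfl⟩
    | loop_step hb' _ _ => exact absurd hb' hb
  | loop_step hb _ _ ih₁ ih₂ =>
    intro s₂ t₂ h₂
    cases h₂ with
    | loop_done hb' => exact absurd hb hb'
    | loop_step _ g₁ g₂ =>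
      obtain ⟨rfl, rfl⟩ := ih₁ g₁
      obtain ⟨rfl, rfl⟩ := ih₂ g₂
      exact ⟨rfl, rfl⟩

/-- The law of an infinite sequence of independent fair coin tosses. -/
noncomputable def coinMeasure : Measure (ℕ → Bool) :=
  Measure.infinitePi fun _ => (PMF.uniformOfFintype Bool).toMeasure

/-- The program `p`, started in the state `init ω` where `ω` is the sequence of its coin tosses,
halts after at most `T` steps whatever the coin tosses are, and with probability at least `2/3`
the value that it leaves at position `0` of the complex array `3` is within `δ` of `μ`. -/
def EstimatesInTime (p : Cmd) (init : (ℕ → Bool) → State) (μ : ℂ) (δ T : ℝ) : Prop :=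
  (∀ ω, ∃ s t, Exec p (init ω) s t ∧ (t : ℝ) ≤ T) ∧
    2 / 3 ≤ coinMeasure.real {ω | ∃ s t, Exec p (init ω) s t ∧ ‖s.cmem 3 0 - μ‖ ≤ δ}

/-! ### Quantum circuits

The qubits are the vertices of a finite graph `G`, the computational basis is indexed by
`V → Fin 2`, and operators are matrices in this basis. -/

section Circuits

variable {V : Type} [Fintype V] [DecidableEq V] {G : SimpleGraph V}

/-- A two-qubit gate on an ordered pair of neighbouring qubits. -/
structure Gate (G : SimpleGraph V) where
  fst : V
  snd : V
  adj : G.Adj fst snd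
  mat : Matrix.unitaryGroup (Fin 2 × Fin 2) ℂ

/-- The action of a gate on all the qubits. -/
def Gate.op (g : Gate G) : Matrix (V → Fin 2) (V → Fin 2) ℂ :=
  Matrix.of fun x y =>
    if ∀ v, v ≠ g.fst → v ≠ g.snd → x v = y v then
      (g.mat : Matrix (Fin 2 × Fin 2) (Fin 2 × Fin 2) ℂ) (x g.fst, x g.snd) (y g.fst, y g.snd)
    else 0

/-- A layer of a circuit: gates that act on pairwise disjoint pairs of qubits. -/
structure Layer (G : SimpleGraph V) where
  gates : List (Gate G)
  disjoint : gates.Pairwise fun g h =>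
    g.fst ≠ h.fst ∧ g.fst ≠ h.snd ∧ g.snd ≠ h.fst ∧ g.snd ≠ h.snd

/-- The unitary of a layer (its gates commute, so their order does not matter). -/
def Layer.op (l : Layer G) : Matrix (V → Fin 2) (V → Fin 2) ℂ :=
  (l.gates.map Gate.op).prod

/-- A circuit of depth `d`: a sequence of `d` layers (some of which may be empty). -/
abbrev Circuit (G : SimpleGraph V) (d : ℕ) : Type := Fin d → Layer G

/-- The unitary of a circuit; the layer `0` acts first. -/
def Circuit.op {d : ℕ} (U : Circuit G d) : Matrix (V → Fin 2) (V → Fin 2) ℂ :=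
  (List.ofFn fun t => (U t).op).reverse.prod

/-- The tensor product of single-qubit operators. -/
def tensorOp (O : V → Matrix (Fin 2) (Fin 2) ℂ) : Matrix (V → Fin 2) (V → Fin 2) ℂ :=
  Matrix.of fun x y => ∏ v, O v (x v) (y v)

/-- The mean value `⟨0ⁿ| U† (⨂ O_v) U |0ⁿ⟩`. -/
def meanValue {d : ℕ} (U : Circuit G d) (O : V → Matrix (Fin 2) (Fin 2) ℂ) : ℂ :=
  (U.op.conjTranspose * tensorOp O * U.op) (fun _ => 0) (fun _ => 0)

/-- The gate in slot `s` of the description of a circuit on `n` qubits: the `k`-th gate of the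
layer `t` is in slot `t * n + k`. A layer has at most `n / 2` gates, so no gate is lost. -/
def Circuit.slot {d : ℕ} (n : ℕ) (U : Circuit G d) (s : ℕ) : Option (Gate G) :=
  if h : s / n < d then (U ⟨s / n, h⟩).gates[s % n]? else none

/-- The initial state of the machine. The qubits are numbered by `num`.
* Integer array `0`: the side lengths of the grid, followed by the depth `d`.
* Integer array `1`: the number of gates in each layer.
* Integer array `2`: the two qubits on which the gate in slot `s` acts, at `2 * s` and
  `2 * s + 1`.
* Complex array `0`: the error tolerance `δ`, at position `0`.
* Complex array `1`: the entry `(r, c)` of the observable of the qubit `v`, at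
  `4 * v + 2 * r + c`.
* Complex array `2`: the entry `((r, r'), (c, c'))` of the gate in slot `s`, at
  `16 * s + 8 * r + 4 * r' + 2 * c + c'`.
All other entries are `0`. -/
noncomputable def inputState {n d : ℕ} (num : V ≃ Fin n) (sides : List ℕ) (U : Circuit G d)
    (O : V → Matrix (Fin 2) (Fin 2) ℂ) (δ : ℝ) (ω : ℕ → Bool) : State where
  imem a i :=
    match a with
    | 0 => (sides ++ [d]).getD i 0
    | 1 => if h : i < d then (U ⟨i, h⟩).gates.length else 0
    | 2 =>
      match U.slot n (i / 2) with
      | some g => if i % 2 = 0 then (num g.fst : ℕ) else (num g.snd : ℕ)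
      | none => 0
    | _ => 0
  cmem a i :=
    match a with
    | 0 => if i = 0 then (δ : ℂ) else 0
    | 1 =>
      if h : i / 4 < n then O (num.symm ⟨i / 4, h⟩) (Fin.ofNat 2 (i / 2)) (Fin.ofNat 2 i) else 0
    | 2 =>
      match U.slot n (i / 16) with
      | some g =>
        (g.mat : Matrix (Fin 2 × Fin 2) (Fin 2 × Fin 2) ℂ)
          (Fin.ofNat 2 (i / 8), Fin.ofNat 2 (i / 4)) (Fin.ofNat 2 (i / 2), Fin.ofNat 2 i)
      | none => 0
    | _ => 0
  coins := ω

end Circuits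

/-! ### Grids -/

/-- The `a × b` grid. -/
def grid2 (a b : ℕ) : SimpleGraph (Fin a × Fin b) :=
  (SimpleGraph.pathGraph a).boxProd (SimpleGraph.pathGraph b)

/-- Row-major numbering: `(i, j)` has the number `j + b * i`. -/
def num2 (a b : ℕ) : Fin a × Fin b ≃ Fin (a * b) := finProdFinEquiv

/-- The `m × m × m` grid. -/
def grid3 (m : ℕ) : SimpleGraph ((Fin m × Fin m) × Fin m) :=
  (grid2 m m).boxProd (SimpleGraph.pathGraph m)

/-- Lexicographic numbering: `((i, j), k)` has the number `k + m * (j + m * i)`. -/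
def num3 (m : ℕ) : (Fin m × Fin m) × Fin m ≃ Fin (m * m * m) :=
  ((num2 m m).prodCongr (Equiv.refl (Fin m))).trans finProdFinEquiv

end MeanValue

/-! Cut the rows of the grid into strips of `4 * d + 2` rows, once with shift `0` and once with
shift `2 * d + 1`. The middle `2 * d + 1` rows of the strips form a core, and the cores of the two
partitions are complementary (`layout_core_compl`). So the observable is a product of two core
observables `A` and `B`, and the mean value is the inner product of `α = U† A† U |0⟩` and `β = U† B
U |0⟩` (`meanValue_eq_sum`). A core is more than `d` rows away from the top row of each strip. By
the light cone argument `conj_keep_eq`, the gates that meet these top rows may be deleted without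
changing `U† A U`. The strips then decouple and can be laid end to end as one long
quasi-one-dimensional strip.

An amplitude of `α` or `β` is computed by a sweep along this strip. The operators in `U† A U` are
processed in the order of position plus twice time, which is legitimate because operators that
change places have disjoint supports (`runOp_schedule_eq_runOp_timeOrder`). A qubit is projected and
reset to `0` as soon as nothing acts on it any more. At every stage the active qubits lie in `4 * d
+ 4` consecutive columns (`Tidy.mem_window`), so a vector with `2 ^ w` entries suffices, where `w =
(4 * d + 4) * (4 * d + 2) * c` and `c` is the third side length (`1` in the plane). This is the
source of the exponents `d ^ 2` and `d ^ 2 * m`.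

The inner product is estimated by Monte Carlo. During the sweep for `α`, the outcome at each qubit
is drawn with the squared norm of the projected vector as its weight. The operators between two
measurements may shrink the vector, since the observables are only contractions; the lost weight
goes to a dead branch of value `0`. A live leaf with weight `N` and outcomes `x` gets the value
`conj (α x) * β x / N`. The weights cancel in the expectation (`sum_weight_mul_value`), and `|α x|²
≤ N` bounds the second moment by `‖β‖² ≤ 1` (`sum_weight_mul_normSq_value_le`). Chebyshev's
inequality then asks for about `4 / δ ^ 2` samples. All samples are drawn from one random binary
fraction, whose residue is rescaled after each draw; with `2 * n * S + 4` coins for `S` samples the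
discretization costs at most `1 / 16` in probability (`le_coinMeasure_total`).

The rest realizes this on the machine. The relation `Rel` ties a machine state to a state of the
sampler, and `stepCmd_runs`, `sampleCmd_runs` and `averageCmd_runs` carry it through a step, a
sample and the whole average. Since the machine has no integer division, the quotients, remainders
and bits come from tables filled by recurrences. -/

set_option linter.unusedSectionVars false

namespace MeanValue

open Matrix

/-! ### Operators on a register of qubits -/

section Operators

variable {V : Type} [Fintype V] [DecidableEq V]

/-- A single-qubit operator acting on the qubit `v`. -/
def site (v : V) (M : Matrix (Fin 2) (Fin 2) ℂ) : Matrix (V → Fin 2) (V → Fin 2) ℂ :=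
  Matrix.of fun x y => if ∀ u, u ≠ v → x u = y u then M (x v) (y v) else 0

/-- A two-qubit operator acting on the qubits `u` and `v`. -/
def pair (u v : V) (M : Matrix (Fin 2 × Fin 2) (Fin 2 × Fin 2) ℂ) :
    Matrix (V → Fin 2) (V → Fin 2) ℂ :=
  Matrix.of fun x y =>
    if ∀ w, w ≠ u → w ≠ v → x w = y w then M (x u, x v) (y u, y v) else 0

theorem Gate.op_eq_pair {G : SimpleGraph V} (g : Gate G) :
    g.op = pair g.fst g.snd (g.mat : Matrix (Fin 2 × Fin 2) (Fin 2 × Fin 2) ℂ) := rfl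

theorem site_mulVec (v : V) (M : Matrix (Fin 2) (Fin 2) ℂ) (Ψ : (V → Fin 2) → ℂ)
    (x : V → Fin 2) :
    (site v M *ᵥ Ψ) x = ∑ b, M (x v) b * Ψ (Function.update x v b) := by
  symm
  refine Fintype.sum_of_injective (fun b => Function.update x v b)
    (Function.update_injective x v) _ _ ?_ ?_
  · intro y hy
    have : ¬ ∀ u, u ≠ v → x u = y u := by
      intro h
      refine hy ⟨y v, ?_⟩
      ext u
      by_cases hu : u = v
      · subst hu; simp
      · simp [Function.update_of_ne hu, h u hu]
    simp [site, this]
  · intro b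
    have : ∀ u, u ≠ v → x u = Function.update x v b u := fun u hu => by
      simp [Function.update_of_ne hu]
    simp only [site, Matrix.of_apply, if_pos this, Function.update_self]

theorem pair_mulVec {u v : V} (huv : u ≠ v) (M : Matrix (Fin 2 × Fin 2) (Fin 2 × Fin 2) ℂ)
    (Ψ : (V → Fin 2) → ℂ) (x : V → Fin 2) :
    (pair u v M *ᵥ Ψ) x =
      ∑ b, M (x u, x v) b * Ψ (Function.update (Function.update x u b.1) v b.2) := by
  symm
  have h1 : ∀ b : Fin 2 × Fin 2, Function.update (Function.update x u b.1) v b.2 u = b.1 :=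
    fun b => by rw [Function.update_of_ne huv, Function.update_self]
  refine Fintype.sum_of_injective
    (fun b : Fin 2 × Fin 2 => Function.update (Function.update x u b.1) v b.2) ?_ _ _ ?_ ?_
  · intro b b' h
    have e1 := congrFun h u
    have e2 := congrFun h v
    simp only [h1, Function.update_self] at e1 e2
    exact Prod.ext e1 e2
  · intro y hy
    have : ¬ ∀ w, w ≠ u → w ≠ v → x w = y w := by
      intro h
      refine hy ⟨(y u, y v), ?_⟩
      ext w
      by_cases hv : w = v
      · subst hv; simp
      · by_cases hu : w = u
        · subst hu; simp [Function.update_of_ne hv]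
        · simp [Function.update_of_ne hu, Function.update_of_ne hv, h w hu hv]
    simp only [pair, Matrix.of_apply, if_neg this, zero_mul]
  · intro b
    have : ∀ w, w ≠ u → w ≠ v →
        x w = Function.update (Function.update x u b.1) v b.2 w := fun w hu hv => by
      simp [Function.update_of_ne hu, Function.update_of_ne hv]
    simp only [pair, Matrix.of_apply, if_pos this, Function.update_self, h1]

theorem ext_mulVec {A B : Matrix (V → Fin 2) (V → Fin 2) ℂ}
    (h : ∀ Ψ x, (A *ᵥ Ψ) x = (B *ᵥ Ψ) x) : A = B :=
  Matrix.mulVec_injective (funext fun Ψ => funext fun x => h Ψ x)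

theorem site_one (v : V) : site v 1 = 1 := by
  refine ext_mulVec fun Ψ x => ?_
  rw [site_mulVec, Matrix.one_mulVec, Finset.sum_eq_single (x v)]
  · simp
  · intro b _ hb; simp [Matrix.one_apply_ne hb.symm]
  · simp

theorem site_commute {u v : V} (h : u ≠ v) (M N : Matrix (Fin 2) (Fin 2) ℂ) :
    Commute (site u M) (site v N) := by
  refine ext_mulVec fun Ψ x => ?_
  rw [← Matrix.mulVec_mulVec, ← Matrix.mulVec_mulVec]
  simp only [site_mulVec, Finset.mul_sum, Function.update_of_ne h, Function.update_of_ne h.symm]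
  rw [Finset.sum_comm]
  refine Finset.sum_congr rfl fun b _ => Finset.sum_congr rfl fun c _ => ?_
  rw [Function.update_comm h]
  ring

theorem pair_one {u v : V} (h : u ≠ v) : pair u v 1 = 1 := by
  refine ext_mulVec fun Ψ x => ?_
  rw [pair_mulVec h, Matrix.one_mulVec, Finset.sum_eq_single (x u, x v)]
  · simp
  · intro b _ hb; simp [Matrix.one_apply_ne hb.symm]
  · simp

theorem pair_mul {u v : V} (h : u ≠ v) (M N : Matrix (Fin 2 × Fin 2) (Fin 2 × Fin 2) ℂ) :
    pair u v M * pair u v N = pair u v (M * N) := by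
  refine ext_mulVec fun Ψ x => ?_
  rw [← Matrix.mulVec_mulVec]
  have h3 : ∀ b b' : Fin 2 × Fin 2,
      Function.update (Function.update (Function.update (Function.update x u b.1) v b.2) u b'.1)
        v b'.2 = Function.update (Function.update x u b'.1) v b'.2 := fun b b' => by
    rw [Function.update_comm h.symm, Function.update_idem, Function.update_idem]
  simp only [pair_mulVec h, Function.update_self, Function.update_of_ne h, h3,
    Matrix.mul_apply, Finset.mul_sum, Finset.sum_mul]
  rw [Finset.sum_comm]
  simp only [mul_assoc]

theorem pair_conjTranspose (u v : V) (M : Matrix (Fin 2 × Fin 2) (Fin 2 × Fin 2) ℂ) :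
    (pair u v M)ᴴ = pair u v Mᴴ := by
  ext x y
  have : (∀ w, w ≠ u → w ≠ v → y w = x w) ↔ (∀ w, w ≠ u → w ≠ v → x w = y w) :=
    ⟨fun h w a b => (h w a b).symm, fun h w a b => (h w a b).symm⟩
  simp only [pair, Matrix.conjTranspose_apply, Matrix.of_apply, this]
  split_ifs <;> simp

theorem site_conjTranspose (v : V) (M : Matrix (Fin 2) (Fin 2) ℂ) :
    (site v M)ᴴ = site v Mᴴ := by
  ext x y
  have : (∀ w, w ≠ v → y w = x w) ↔ (∀ w, w ≠ v → x w = y w) :=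
    ⟨fun h w a => (h w a).symm, fun h w a => (h w a).symm⟩
  simp only [site, Matrix.conjTranspose_apply, Matrix.of_apply, this]
  split_ifs <;> simp

/-- Expansion in matrix units. It puts two-qubit operators into the algebra generated by
single-qubit ones, so that locality questions reduce to `site`. -/
theorem pair_eq_sum {u v : V} (h : u ≠ v) (M : Matrix (Fin 2 × Fin 2) (Fin 2 × Fin 2) ℂ) :
    pair u v M = ∑ p, ∑ q, M p q •
      (site u (Matrix.single p.1 q.1 1) * site v (Matrix.single p.2 q.2 1)) := by
  refine ext_mulVec fun Ψ x => ?_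
  simp only [Matrix.sum_mulVec, Finset.sum_apply, Matrix.smul_mulVec, Pi.smul_apply, smul_eq_mul,
    ← Matrix.mulVec_mulVec]
  rw [pair_mulVec h]
  symm
  rw [Finset.sum_eq_single (x u, x v)]
  · refine Finset.sum_congr rfl fun q _ => ?_
    simp only [site_mulVec, Matrix.single_apply, true_and, ite_mul, one_mul, zero_mul,
      Finset.sum_ite_eq, Finset.mem_univ, if_true, Function.update_of_ne h.symm]
  · intro p _ hp
    refine Finset.sum_eq_zero fun q _ => ?_
    have : ¬ (p.1 = x u ∧ p.2 = x v) := fun hh => hp (Prod.ext hh.1 hh.2)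
    simp only [site_mulVec, Matrix.single_apply, Function.update_of_ne h.symm]
    by_cases h1 : p.1 = x u
    · have h2 : p.2 ≠ x v := fun h2 => this ⟨h1, h2⟩
      simp [h2]
    · simp [h1]
  · simp

/-- The algebra of operators that act on the qubits in `T`. -/
def localAlg (T : Set V) : Subalgebra ℂ (Matrix (V → Fin 2) (V → Fin 2) ℂ) :=
  Algebra.adjoin ℂ {X | ∃ v ∈ T, ∃ M, X = site v M}

theorem localAlg_mono {S T : Set V} (h : S ⊆ T) : localAlg S ≤ localAlg T :=
  Algebra.adjoin_mono fun _ ⟨v, hv, M, e⟩ => ⟨v, h hv, M, e⟩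

theorem site_mem {T : Set V} {v : V} (h : v ∈ T) (M : Matrix (Fin 2) (Fin 2) ℂ) :
    site v M ∈ localAlg T :=
  Algebra.subset_adjoin ⟨v, h, M, rfl⟩

theorem pair_mem {T : Set V} {u v : V} (huv : u ≠ v) (hu : u ∈ T) (hv : v ∈ T)
    (M : Matrix (Fin 2 × Fin 2) (Fin 2 × Fin 2) ℂ) : pair u v M ∈ localAlg T := by
  rw [pair_eq_sum huv]
  exact Subalgebra.sum_mem _ fun p _ => Subalgebra.sum_mem _ fun q _ =>
    Subalgebra.smul_mem _ (Subalgebra.mul_mem _ (site_mem hu _) (site_mem hv _)) _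

/-- Commutation passes from generators to generated algebras, one side at a time, and generators at
different qubits commute. -/
theorem localAlg_commute {S T : Set V} (h : Disjoint S T)
    {X Y : Matrix (V → Fin 2) (V → Fin 2) ℂ} (hX : X ∈ localAlg S) (hY : Y ∈ localAlg T) :
    Commute X Y := by
  refine Algebra.commute_of_mem_adjoin_of_forall_mem_commute hY ?_
  rintro _ ⟨v, hv, M, rfl⟩
  refine (Algebra.commute_of_mem_adjoin_of_forall_mem_commute hX ?_).symm
  rintro _ ⟨u, hu, N, rfl⟩
  exact (site_commute (fun e : u = v => Set.disjoint_left.1 h hu (e ▸ hv)) N M).symm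

theorem localAlg_conjTranspose {S : Set V} {X : Matrix (V → Fin 2) (V → Fin 2) ℂ}
    (hX : X ∈ localAlg S) : Xᴴ ∈ localAlg S := by
  induction hX using Algebra.adjoin_induction with
  | mem x hx =>
    obtain ⟨v, hv, M, rfl⟩ := hx
    rw [site_conjTranspose]
    exact site_mem hv _
  | algebraMap r =>
    rw [Algebra.algebraMap_eq_smul_one, Matrix.conjTranspose_smul, Matrix.conjTranspose_one]
    exact Subalgebra.smul_mem _ (Subalgebra.one_mem _) _
  | add x y _ _ hx hy =>
    rw [Matrix.conjTranspose_add]; exact Subalgebra.add_mem _ hx hy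
  | mul x y _ _ hx hy =>
    rw [Matrix.conjTranspose_mul]; exact Subalgebra.mul_mem _ hy hx

/-! ### Norms -/

/-- The squared norm of a state vector. -/
def nsq {ι : Type*} [Fintype ι] (Ψ : ι → ℂ) : ℝ := ∑ x, Complex.normSq (Ψ x)

theorem nsq_nonneg {ι : Type*} [Fintype ι] (Ψ : ι → ℂ) : 0 ≤ nsq Ψ :=
  Finset.sum_nonneg fun _ _ => Complex.normSq_nonneg _

theorem normSq_le_nsq {ι : Type*} [Fintype ι] (Ψ : ι → ℂ) (x : ι) :
    Complex.normSq (Ψ x) ≤ nsq Ψ :=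
  Finset.single_le_sum (f := fun x => Complex.normSq (Ψ x))
    (fun _ _ => Complex.normSq_nonneg _) (Finset.mem_univ x)

theorem nsq_eq_dotProduct {ι : Type*} [Fintype ι] (Ψ : ι → ℂ) : (nsq Ψ : ℂ) = star Ψ ⬝ᵥ Ψ := by
  simp [nsq, dotProduct, Complex.normSq_eq_conj_mul_self]

/-- Operators that do not increase the norm. -/
def Contraction (X : Matrix (V → Fin 2) (V → Fin 2) ℂ) : Prop :=
  ∀ Ψ, nsq (X *ᵥ Ψ) ≤ nsq Ψ

theorem contraction_one : Contraction (1 : Matrix (V → Fin 2) (V → Fin 2) ℂ) := fun Ψ => by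
  rw [Matrix.one_mulVec]

theorem contraction_of_isometry {X : Matrix (V → Fin 2) (V → Fin 2) ℂ} (h : Xᴴ * X = 1) :
    Contraction X := fun Ψ => by
  have : (nsq (X *ᵥ Ψ) : ℂ) = nsq Ψ := by
    rw [nsq_eq_dotProduct, nsq_eq_dotProduct, Matrix.star_mulVec, ← Matrix.dotProduct_mulVec,
      Matrix.mulVec_mulVec, h, Matrix.one_mulVec]
  exact le_of_eq (by exact_mod_cast this)

/-- Fixing all the other qubits turns norm statements about an operator at `v` into statements about
vectors in `ℂ²`. This serves both the contraction bound and the splitting of the norm by a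
measurement. -/
theorem nsq_eq_sum_split (v : V) (Ψ : (V → Fin 2) → ℂ) :
    nsq Ψ = ∑ r : {u // u ≠ v} → Fin 2, ∑ b : Fin 2,
      Complex.normSq (Ψ ((Equiv.funSplitAt v (Fin 2)).symm (b, r))) := by
  rw [nsq, ← Equiv.sum_comp (Equiv.funSplitAt v (Fin 2)).symm, Fintype.sum_prod_type_right]

theorem update_funSplitAt_symm (v : V) (b c : Fin 2) (r : {u // u ≠ v} → Fin 2) :
    Function.update ((Equiv.funSplitAt v (Fin 2)).symm (b, r)) v c =
      (Equiv.funSplitAt v (Fin 2)).symm (c, r) := by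
  ext u
  by_cases h : u = v
  · subst h; simp [Equiv.funSplitAt]
  · simp [Equiv.funSplitAt, h]

theorem funSplitAt_symm_self (v : V) (b : Fin 2) (r : {u // u ≠ v} → Fin 2) :
    (Equiv.funSplitAt v (Fin 2)).symm (b, r) v = b := by
  simp [Equiv.funSplitAt]

theorem site_contraction (v : V) {M : Matrix (Fin 2) (Fin 2) ℂ}
    (hM : ‖Matrix.toEuclideanCLM (n := Fin 2) (𝕜 := ℂ) M‖ ≤ 1) : Contraction (site v M) := by
  intro Ψ
  rw [nsq_eq_sum_split v, nsq_eq_sum_split v]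
  refine Finset.sum_le_sum fun r _ => ?_
  simp only [site_mulVec, update_funSplitAt_symm, funSplitAt_symm_self]
  set φ : EuclideanSpace ℂ (Fin 2) :=
    WithLp.toLp 2 fun b => Ψ ((Equiv.funSplitAt v (Fin 2)).symm (b, r)) with hφ
  have h1 := (Matrix.toEuclideanCLM (n := Fin 2) (𝕜 := ℂ) M).le_opNorm φ
  have h2 : ‖Matrix.toEuclideanCLM (n := Fin 2) (𝕜 := ℂ) M φ‖ ≤ ‖φ‖ :=
    h1.trans (mul_le_of_le_one_left (norm_nonneg _) hM)
  have h3 : ‖Matrix.toEuclideanCLM (n := Fin 2) (𝕜 := ℂ) M φ‖ ^ 2 ≤ ‖φ‖ ^ 2 :=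
    pow_le_pow_left₀ (norm_nonneg _) h2 2
  rw [EuclideanSpace.norm_sq_eq, EuclideanSpace.norm_sq_eq] at h3
  simpa [Complex.normSq_eq_norm_sq, hφ, Matrix.mulVec, dotProduct] using h3

theorem Gate.isometry {G : SimpleGraph V} (g : Gate G) : g.opᴴ * g.op = 1 := by
  rw [g.op_eq_pair, pair_conjTranspose, pair_mul g.adj.ne,
    ← Matrix.star_eq_conjTranspose, Unitary.star_mul_self_of_mem g.mat.2, pair_one g.adj.ne]

theorem Gate.coisometry {G : SimpleGraph V} (g : Gate G) : g.op * g.opᴴ = 1 := by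
  rw [g.op_eq_pair, pair_conjTranspose, pair_mul g.adj.ne,
    ← Matrix.star_eq_conjTranspose, Unitary.mul_star_self_of_mem g.mat.2, pair_one g.adj.ne]

theorem Gate.contraction {G : SimpleGraph V} (g : Gate G) : Contraction g.op :=
  contraction_of_isometry g.isometry

theorem Gate.contraction_conjTranspose {G : SimpleGraph V} (g : Gate G) : Contraction g.opᴴ :=
  contraction_of_isometry (by rw [Matrix.conjTranspose_conjTranspose]; exact g.coisometry)

/-- Needed because the left state of the inner product is generated by the adjoint observables. -/
theorem norm_toEuclideanCLM_conjTranspose (M : Matrix (Fin 2) (Fin 2) ℂ) :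
    ‖Matrix.toEuclideanCLM (n := Fin 2) (𝕜 := ℂ) Mᴴ‖ =
      ‖Matrix.toEuclideanCLM (n := Fin 2) (𝕜 := ℂ) M‖ := by
  rw [← Matrix.star_eq_conjTranspose, map_star,
    ContinuousLinearMap.star_eq_adjoint, LinearIsometryEquiv.norm_map]

end Operators

/-! ### Products of lists of partially commuting factors -/

theorem prod_eq_mul_of_commute {α M : Type*} [Monoid M] (f : α → M) (a : α) (p q : List α)
    (h : ∀ b ∈ p, Commute (f b) (f a)) :
    ((p ++ a :: q).map f).prod = f a * ((p ++ q).map f).prod := by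
  induction p with
  | nil => simp
  | cons b p ih =>
    have hb := h b (by simp)
    have := ih fun c hc => h c (by simp [hc])
    simp only [List.cons_append, List.map_cons, List.prod_cons] at this ⊢
    rw [this, ← mul_assoc, hb.eq, mul_assoc]

/-- Two orderings of the same factors give the same product if the factors whose order differs
commute. -/
theorem prod_eq_of_perm {α M : Type*} [Monoid M] (f : α → M) {R₁ R₂ : α → α → Prop}
    (hc : ∀ a b, R₁ a b → R₂ b a → Commute (f b) (f a)) {l₁ l₂ : List α} (hp : l₁.Perm l₂)
    (h₁ : l₁.Pairwise R₁) (h₂ : l₂.Pairwise R₂) : (l₁.map f).prod = (l₂.map f).prod := by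
  induction l₁ generalizing l₂ with
  | nil => rw [List.nil_perm.1 hp]
  | cons a l ih =>
    have ha : a ∈ l₂ := hp.subset (by simp)
    obtain ⟨p, q, rfl⟩ := List.append_of_mem ha
    have hp' : l.Perm (p ++ q) := by
      have := hp.trans List.perm_middle
      exact (List.perm_cons a).1 this
    rw [List.pairwise_cons] at h₁
    have hpq : (p ++ q).Pairwise R₂ :=
      h₂.sublist (List.Sublist.append_left (List.sublist_cons_self a q) p)
    -- The head `a` of `l₁` is pulled to the front of `l₂`. Whatever stood before it in `l₂` stands
    -- after it in `l₁`, so the hypothesis `hc` lets `a` pass.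
    rw [prod_eq_mul_of_commute, List.map_cons, List.prod_cons, ih hp' h₁.2 hpq]
    intro b hb
    have hbl : b ∈ l := hp'.symm.subset (by simp [hb])
    refine hc a b (h₁.1 b hbl) ?_
    rw [List.pairwise_append] at h₂
    exact h₂.2.2 b hb a (by simp)

theorem prod_eq_of_perm_of_commute {α M : Type*} [Monoid M] (f : α → M) {l₁ l₂ : List α}
    (hc : ∀ a ∈ l₁, ∀ b ∈ l₁, Commute (f a) (f b)) (hp : l₁.Perm l₂) :
    (l₁.map f).prod = (l₂.map f).prod :=
  prod_eq_of_perm f (R₁ := fun a _ => a ∈ l₁) (R₂ := fun a _ => a ∈ l₁)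
    (fun _ _ ha hb => hc _ hb _ ha) hp
    (List.pairwise_of_forall_mem_list fun _ ha _ _ => ha)
    (List.pairwise_of_forall_mem_list fun _ ha _ _ => hp.symm.subset ha)

/-- Commuting factors may be sorted by a predicate. -/
theorem prod_filter_mul_prod_filter_not {α M : Type*} [Monoid M] (f : α → M) (P : α → Bool)
    {l : List α} (hc : ∀ a ∈ l, ∀ b ∈ l, Commute (f a) (f b)) :
    ((l.filter P).map f).prod * ((l.filter fun a => !P a).map f).prod = (l.map f).prod := by
  rw [← List.prod_append, ← List.map_append]
  exact (prod_eq_of_perm_of_commute f hc (List.filter_append_perm P l).symm).symm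

end MeanValue

namespace MeanValue

open Matrix

/-! ### Tensor products of single-qubit operators. -/

section TensorProducts

variable {V : Type} [Fintype V] [DecidableEq V]

theorem tensorOp_mul (N N' : V → Matrix (Fin 2) (Fin 2) ℂ) :
    tensorOp N * tensorOp N' = tensorOp fun v => N v * N' v := by
  ext x y
  simp only [tensorOp, Matrix.mul_apply, Matrix.of_apply, ← Finset.prod_mul_distrib]
  rw [Finset.prod_univ_sum]
  simp

theorem tensorOp_conjTranspose (N : V → Matrix (Fin 2) (Fin 2) ℂ) :
    (tensorOp N)ᴴ = tensorOp fun v => (N v)ᴴ := by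
  ext x y
  simp [tensorOp, Matrix.conjTranspose_apply, star_prod]

theorem site_eq_tensorOp (v : V) (M : Matrix (Fin 2) (Fin 2) ℂ) :
    site v M = tensorOp (Function.update (fun _ => 1) v M) := by
  ext x y
  simp only [site, tensorOp, Matrix.of_apply]
  rw [← Finset.mul_prod_erase _ _ (Finset.mem_univ v), Function.update_self]
  split_ifs with h
  · rw [Finset.prod_eq_one, mul_one]
    intro u hu
    have hu' := Finset.ne_of_mem_erase hu
    rw [Function.update_of_ne hu', h u hu', Matrix.one_apply_eq]
  · push Not at h
    obtain ⟨u, hu, hne⟩ := h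
    rw [Finset.prod_eq_zero (Finset.mem_erase.2 ⟨hu, Finset.mem_univ u⟩), mul_zero]
    rw [Function.update_of_ne hu, Matrix.one_apply_ne hne]

theorem prod_site_of_nodup (N : V → Matrix (Fin 2) (Fin 2) ℂ) {l : List V} (hl : l.Nodup) :
    (l.map fun v => site v (N v)).prod = tensorOp fun v => if v ∈ l then N v else 1 := by
  induction l with
  | nil =>
    ext x y
    simp only [List.map_nil, List.prod_nil, List.not_mem_nil, if_false, tensorOp,
      Matrix.of_apply]
    by_cases h : x = y
    · subst h; simp
    · obtain ⟨u, hu⟩ := Function.ne_iff.1 h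
      rw [Matrix.one_apply_ne h, Finset.prod_eq_zero (Finset.mem_univ u)]
      exact Matrix.one_apply_ne hu
  | cons v l ih =>
    rw [List.nodup_cons] at hl
    rw [List.map_cons, List.prod_cons, ih hl.2, site_eq_tensorOp, tensorOp_mul]
    congr 1
    ext1 u
    by_cases h : u = v
    · subst h; simp [hl.1]
    · simp [h]

theorem prod_site (N : V → Matrix (Fin 2) (Fin 2) ℂ) {l : List V} (hl : l.Nodup)
    (hm : ∀ v, v ∈ l) : (l.map fun v => site v (N v)).prod = tensorOp N := by
  rw [prod_site_of_nodup N hl]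
  simp [hm]

theorem tensorOp_mem_localAlg (N : V → Matrix (Fin 2) (Fin 2) ℂ) (T : Set V)
    (h : ∀ v, v ∉ T → N v = 1) : tensorOp N ∈ localAlg T := by
  rw [← prod_site N (Finset.nodup_toList Finset.univ) (by simp)]
  refine Subalgebra.list_prod_mem _ fun X hX => ?_
  obtain ⟨v, -, rfl⟩ := List.mem_map.1 hX
  by_cases hv : v ∈ T
  · exact site_mem hv _
  · rw [h v hv, site_one]; exact Subalgebra.one_mem _

/-- The matrix `|0⟩⟨b|`. -/
def ketbra (b : Fin 2) : Matrix (Fin 2) (Fin 2) ℂ := Matrix.single 0 b 1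

/-- Projecting every qubit onto `x v` and resetting it moves row `x` to row `0`. An amplitude can
therefore be read at the fixed address `0` after the qubits have been recycled. -/
theorem tensorOp_ketbra_mul_apply (x : V → Fin 2)
    (X : Matrix (V → Fin 2) (V → Fin 2) ℂ) (y : V → Fin 2) :
    (tensorOp (fun v => ketbra (x v)) * X) (fun _ => 0) y = X x y := by
  rw [Matrix.mul_apply, Finset.sum_eq_single x]
  · simp [tensorOp, ketbra]
  · intro z _ hz
    obtain ⟨u, hu⟩ := Function.ne_iff.1 hz
    have : tensorOp (fun v => ketbra (x v)) (fun _ => 0) z = 0 := by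
      simp only [tensorOp, Matrix.of_apply]
      refine Finset.prod_eq_zero (Finset.mem_univ u) ?_
      simp [ketbra, hu.symm]
    rw [this, zero_mul]
  · simp

end TensorProducts

/-! ### Light cones -/

section LightCone

variable {V : Type} [Fintype V] [DecidableEq V] {G : SimpleGraph V}

theorem Gate.op_mem_localAlg (g : Gate G) {T : Set V} (h₁ : g.fst ∈ T) (h₂ : g.snd ∈ T) :
    g.op ∈ localAlg T :=
  pair_mem g.adj.ne h₁ h₂ _

theorem Layer.commute (l : Layer G) : ∀ g ∈ l.gates, ∀ h ∈ l.gates, Commute g.op h.op := by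
  intro g hg h hh
  have : Std.Symm (fun g h : Gate G => Commute g.op h.op) := ⟨fun _ _ h => h.symm⟩
  refine List.Pairwise.forall_of_forall (R := fun g h : Gate G => Commute g.op h.op)
    (fun _ _ => Commute.refl _) ?_ hg hh
  refine l.disjoint.imp fun {g h} hd => ?_
  refine localAlg_commute (S := {g.fst, g.snd}) (T := {h.fst, h.snd}) ?_
    (g.op_mem_localAlg (by simp) (by simp)) (h.op_mem_localAlg (by simp) (by simp))
  simp only [Set.disjoint_insert_left, Set.disjoint_singleton_left, Set.mem_insert_iff,
    Set.mem_singleton_iff]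
  tauto

theorem Layer.eq_of_fst_eq (l : Layer G) {g h : Gate G} (hg : g ∈ l.gates) (hh : h ∈ l.gates)
    (e : g.fst = h.fst) : g = h := by
  have hd : l.gates.Pairwise fun g h : Gate G => g.fst = h.fst → g = h :=
    l.disjoint.imp fun {g h} hd e => absurd e hd.1
  have : Std.Symm (fun g h : Gate G => g.fst = h.fst → g = h) :=
    ⟨fun _ _ h e => (h e.symm).symm⟩
  exact List.Pairwise.forall_of_forall (R := fun g h : Gate G => g.fst = h.fst → g = h)
    (fun _ _ _ => rfl) hd hg hh e

theorem Layer.nodup (l : Layer G) : (l.gates.map Gate.fst).Nodup := by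
  rw [List.Nodup, List.pairwise_map]
  exact l.disjoint.imp fun hd => hd.1

theorem isometry_prod {l : List (Gate G)} :
    ((l.map Gate.op).prod)ᴴ * (l.map Gate.op).prod = 1 := by
  induction l with
  | nil => simp
  | cons g l ih =>
    rw [List.map_cons, List.prod_cons, Matrix.conjTranspose_mul, Matrix.mul_assoc,
      ← Matrix.mul_assoc g.opᴴ, g.isometry, Matrix.one_mul, ih]

/-- The far gates are moved next to `X`, pass through it, and meet their adjoints there. -/
theorem conj_prod_eq_of_commute {l : List (Gate G)}
    (hl : ∀ g ∈ l, ∀ h ∈ l, Commute g.op h.op) (near : Gate G → Bool)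
    {X : Matrix (V → Fin 2) (V → Fin 2) ℂ}
    (hX : ∀ g ∈ l, near g = false → Commute g.op X) :
    ((l.map Gate.op).prod)ᴴ * X * (l.map Gate.op).prod =
      (((l.filter near).map Gate.op).prod)ᴴ * X * ((l.filter near).map Gate.op).prod := by
  have h := prod_filter_mul_prod_filter_not Gate.op (fun g => !near g) hl
  simp only [Bool.not_not] at h
  set A := ((l.filter fun g => !near g).map Gate.op).prod with hA
  have hAX : Commute A X := by
    rw [hA]
    refine Commute.list_prod_left _ _ fun Y hY => ?_
    obtain ⟨g, hg, rfl⟩ := List.mem_map.1 hY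
    rw [List.mem_filter] at hg
    exact hX g hg.1 (by simpa using hg.2)
  rw [← h, Matrix.conjTranspose_mul]
  simp only [Matrix.mul_assoc]
  rw [← Matrix.mul_assoc X A, ← hAX.eq, Matrix.mul_assoc A, ← Matrix.mul_assoc Aᴴ A,
    hA, isometry_prod, Matrix.one_mul]

/-- The part of a layer that consists of the gates that avoid the set `S`. -/
noncomputable def Layer.keep (l : Layer G) (S : V → Bool) : Matrix (V → Fin 2) (V → Fin 2) ℂ :=
  ((l.gates.filter fun g => !S g.fst && !S g.snd).map Gate.op).prod

/-- One layer enlarges the support by one unit of `h`. Only gates that meet `{v | h v ≤ r}` survive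
the conjugation, and these stay inside `{v | h v ≤ r + 1}`, so deleting gates that touch `S` at
height at least `r + 2` has no effect. The same `Y` serves for all such `S`. -/
theorem Layer.conj_near (l : Layer G) (h : V → ℕ) (hG : ∀ u v, G.Adj u v → h u ≤ h v + 1)
    (r : ℕ) {X : Matrix (V → Fin 2) (V → Fin 2) ℂ} (hX : X ∈ localAlg {v | h v ≤ r}) :
    ∃ Y ∈ localAlg {v | h v ≤ r + 1}, l.opᴴ * X * l.op = Y ∧
      ∀ S : V → Bool, (∀ v, S v = true → r + 2 ≤ h v) →
        (l.keep S)ᴴ * X * l.keep S = Y := by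
  set near : Gate G → Bool := fun g => decide (h g.fst ≤ r) || decide (h g.snd ≤ r) with hn
  have hfar : ∀ g : Gate G, near g = false → Commute g.op X := by
    intro g hg
    simp only [hn, Bool.or_eq_false_iff, decide_eq_false_iff_not] at hg
    refine localAlg_commute (S := {v | ¬ h v ≤ r}) ?_ (g.op_mem_localAlg hg.1 hg.2) hX
    rw [Set.disjoint_left]
    intro v hv hv'
    exact hv hv'
  refine ⟨_, ?_, conj_prod_eq_of_commute l.commute near fun g _ => hfar g, ?_⟩
  · have : ((l.gates.filter near).map Gate.op).prod ∈ localAlg {v | h v ≤ r + 1} := by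
      refine Subalgebra.list_prod_mem _ fun Y hY => ?_
      obtain ⟨g, hg, rfl⟩ := List.mem_map.1 hY
      have hg' := (List.mem_filter.1 hg).2
      simp only [hn, Bool.or_eq_true, decide_eq_true_eq] at hg'
      have h1 := hG _ _ g.adj
      have h2 := hG _ _ g.adj.symm
      exact g.op_mem_localAlg (by simp only [Set.mem_ofPred_eq]; omega)
        (by simp only [Set.mem_ofPred_eq]; omega)
    exact Subalgebra.mul_mem _ (Subalgebra.mul_mem _ (localAlg_conjTranspose this)
      (localAlg_mono (fun v hv => le_trans hv (Nat.le_succ r)) hX)) this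
  · intro S hS
    have := conj_prod_eq_of_commute
      (l := l.gates.filter fun g => !S g.fst && !S g.snd)
      (fun a ha b hb => l.commute a (List.mem_filter.1 ha).1 b (List.mem_filter.1 hb).1)
      near (X := X) fun g _ => hfar g
    rw [Layer.keep, this, List.filter_filter]
    have hl : (l.gates.filter fun g => near g && (!S g.fst && !S g.snd)) =
        l.gates.filter near := by
      refine List.filter_congr fun g _ => ?_
      by_cases hg : near g = true
      · simp only [hg, Bool.true_and]
        simp only [hn, Bool.or_eq_true, decide_eq_true_eq] at hg
        have h1 := hG _ _ g.adj
        have h2 := hG _ _ g.adj.symm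
        have a1 : S g.fst = false := by
          by_contra hc
          have := hS g.fst (by simpa using hc)
          omega
        have a2 : S g.snd = false := by
          by_contra hc
          have := hS g.snd (by simpa using hc)
          omega
        simp [a1, a2]
      · simp only [Bool.not_eq_true] at hg
        simp [hg]
    rw [hl]

/-- The product of a sequence of operators of which the first one acts first. -/
noncomputable def timeProd (K : ℕ → Matrix (V → Fin 2) (V → Fin 2) ℂ) :
    ℕ → Matrix (V → Fin 2) (V → Fin 2) ℂ
  | 0 => 1
  | k + 1 => K k * timeProd K k

theorem timeProd_eq (K : ℕ → Matrix (V → Fin 2) (V → Fin 2) ℂ) (k : ℕ) :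
    timeProd K k = ((List.range k).map K).reverse.prod := by
  induction k with
  | zero => simp [timeProd]
  | succ k ih => simp [timeProd, ih, List.range_succ]

/-- The layer `t` of a circuit, as a function of a natural number. -/
noncomputable def Circuit.layerOp {d : ℕ} (U : Circuit G d) (f : Layer G → Matrix (V → Fin 2) (V → Fin 2) ℂ)
    (t : ℕ) : Matrix (V → Fin 2) (V → Fin 2) ℂ :=
  if h : t < d then f (U ⟨t, h⟩) else 1

theorem Circuit.op_eq_timeProd {d : ℕ} (U : Circuit G d) :
    U.op = timeProd (U.layerOp Layer.op) d := by
  rw [timeProd_eq, Circuit.op]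
  congr 2
  apply List.ext_getElem
  · simp
  · intro i h1 h2
    simp only [List.length_ofFn] at h1
    simp [Circuit.layerOp, h1]

theorem timeProd_isometry {d : ℕ} (U : Circuit G d) (k : ℕ) :
    (timeProd (U.layerOp Layer.op) k)ᴴ * timeProd (U.layerOp Layer.op) k = 1 := by
  induction k with
  | zero => simp [timeProd]
  | succ k ih =>
    have : (U.layerOp Layer.op k)ᴴ * U.layerOp Layer.op k = 1 := by
      rw [Circuit.layerOp]
      split_ifs
      · exact isometry_prod
      · simp
    rw [timeProd, Matrix.conjTranspose_mul, Matrix.mul_assoc, ← Matrix.mul_assoc _ _ (timeProd _ _),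
      this, Matrix.one_mul, ih]

theorem Circuit.isometry {d : ℕ} (U : Circuit G d) : U.opᴴ * U.op = 1 := by
  rw [U.op_eq_timeProd]; exact timeProd_isometry U d

theorem Circuit.coisometry {d : ℕ} (U : Circuit G d) : U.op * U.opᴴ = 1 :=
  mul_eq_one_comm.1 U.isometry

/-- An operator evolves only under the gates in its light cone. -/
theorem conj_keep_eq {d : ℕ} (U : Circuit G d) (h : V → ℕ)
    (hG : ∀ u v, G.Adj u v → h u ≤ h v + 1) (S : V → Bool) (hS : ∀ v, S v = true → d + 1 ≤ h v)
    {X : Matrix (V → Fin 2) (V → Fin 2) ℂ} (hX : X ∈ localAlg {v | h v ≤ 0}) :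
    (timeProd (U.layerOp (Layer.keep · S)) d)ᴴ * X * timeProd (U.layerOp (Layer.keep · S)) d =
      U.opᴴ * X * U.op := by
  rw [U.op_eq_timeProd]
  -- The latest layer conjugates `X` first. The induction therefore strips layers from the end, and
  -- the radius `r` grows while the number `k` of remaining layers falls.
  have main : ∀ k ≤ d, ∀ r, r + k ≤ d → ∀ X ∈ localAlg {v | h v ≤ r},
      (timeProd (U.layerOp (Layer.keep · S)) k)ᴴ * X * timeProd (U.layerOp (Layer.keep · S)) k =
        (timeProd (U.layerOp Layer.op) k)ᴴ * X * timeProd (U.layerOp Layer.op) k := by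
    intro k
    induction k with
    | zero => intro _ r _ X _; rfl
    | succ k ih =>
      intro hk r hr X hX
      have hkd : k < d := hk
      obtain ⟨Y, hY, e1, e2⟩ := (U ⟨k, hkd⟩).conj_near h hG r hX
      have e2' := e2 S fun v hv => by have := hS v hv; omega
      have f1 : U.layerOp Layer.op k = (U ⟨k, hkd⟩).op := by simp [Circuit.layerOp, hkd]
      have f2 : U.layerOp (Layer.keep · S) k = (U ⟨k, hkd⟩).keep S := by
        simp [Circuit.layerOp, hkd]
      have g : ∀ A B : Matrix (V → Fin 2) (V → Fin 2) ℂ,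
          (A * B)ᴴ * X * (A * B) = Bᴴ * (Aᴴ * X * A) * B := fun A B => by
        rw [Matrix.conjTranspose_mul]; simp only [Matrix.mul_assoc]
      rw [timeProd, timeProd, g, g, f1, f2, e1, e2']
      exact ih (by omega) (r + 1) (by omega) Y hY
  exact main d le_rfl 0 (by omega) X hX

/-- The gate of a layer whose first qubit is `v`, if there is one and it avoids `S`. -/
noncomputable def Layer.gateAt (l : Layer G) (S : V → Bool) (v : V) :
    Matrix (V → Fin 2) (V → Fin 2) ℂ :=
  match (l.gates.filter fun g => !S g.fst && !S g.snd).find? fun g => g.fst = v with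
  | some g => g.op
  | none => 1

theorem Layer.gateAt_of_mem (l : Layer G) (S : V → Bool) {g : Gate G} (hg : g ∈ l.gates) :
    l.gateAt S g.fst = if S g.fst = false ∧ S g.snd = false then g.op else 1 := by
  rw [Layer.gateAt]
  split
  · rename_i g' h
    have h1 := List.mem_of_find?_eq_some h
    have h2 := List.find?_some h
    simp only [decide_eq_true_eq] at h2
    rw [List.mem_filter] at h1
    have := l.eq_of_fst_eq h1.1 hg h2
    subst this
    simp only [Bool.and_eq_true, Bool.not_eq_true'] at h1
    rw [if_pos h1.2]
  · rename_i h
    rw [List.find?_eq_none] at h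
    rw [if_neg]
    rintro ⟨h1, h2⟩
    exact h g (List.mem_filter.2 ⟨hg, by simp [h1, h2]⟩) (by simp)

theorem Layer.gateAt_of_forall_ne (l : Layer G) (S : V → Bool) {v : V}
    (h : ∀ g ∈ l.gates, g.fst ≠ v) : l.gateAt S v = 1 := by
  rw [Layer.gateAt]
  split
  · rename_i g' h'
    have h1 := List.mem_of_find?_eq_some h'
    have h2 := List.find?_some h'
    simp only [decide_eq_true_eq] at h2
    exact absurd h2 (h _ (List.mem_filter.1 h1).1)
  · rfl

theorem Layer.gateAt_cases (l : Layer G) (S : V → Bool) (v : V) :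
    l.gateAt S v = 1 ∨ ∃ g ∈ l.gates, g.fst = v ∧ S g.fst = false ∧ S g.snd = false ∧
      l.gateAt S v = g.op := by
  by_cases h : ∃ g ∈ l.gates, g.fst = v
  · obtain ⟨g, hg, rfl⟩ := h
    rw [l.gateAt_of_mem S hg]
    by_cases hs : S g.fst = false ∧ S g.snd = false
    · exact Or.inr ⟨g, hg, rfl, hs.1, hs.2, if_pos hs⟩
    · exact Or.inl (if_neg hs)
  · push Not at h
    exact Or.inl (l.gateAt_of_forall_ne S h)

theorem Layer.gateAt_commute (l : Layer G) (S : V → Bool) (u v : V) :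
    Commute (l.gateAt S u) (l.gateAt S v) := by
  rcases l.gateAt_cases S u with h | ⟨g, hg, -, -, -, h⟩
  · rw [h]; exact Commute.one_left _
  · rcases l.gateAt_cases S v with h' | ⟨g', hg', -, -, -, h'⟩
    · rw [h']; exact Commute.one_right _
    · rw [h, h']; exact l.commute g hg g' hg'

theorem prod_filterMap_op {l : List V} (f : V → Option (Gate G)) :
    ((l.filterMap f).map Gate.op).prod =
      (l.map fun v => match f v with | some g => g.op | none => 1).prod := by
  induction l with
  | nil => rfl
  | cons v l ih =>
    rw [List.filterMap_cons, List.map_cons, List.prod_cons, ← ih]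
    cases f v with
    | none => simp
    | some g => simp

/-- Gates of a layer are indexed by their first qubits, which are distinct. This gives the sweep
exactly one item for each pair of a time and a qubit. -/
theorem Layer.keep_eq_prod_gateAt (l : Layer G) (S : V → Bool) {vs : List V} (hn : vs.Nodup)
    (hm : ∀ v, v ∈ vs) : l.keep S = (vs.map (l.gateAt S)).prod := by
  set k := l.gates.filter fun g => !S g.fst && !S g.snd with hk
  have hkn : k.Nodup := (List.Nodup.of_map _ l.nodup).filter _
  have hf : ∀ v g, (k.find? fun g => g.fst = v) = some g ↔ g ∈ k ∧ g.fst = v := by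
    intro v g
    constructor
    · intro h
      exact ⟨List.mem_of_find?_eq_some h, by simpa using List.find?_some h⟩
    · rintro ⟨h1, h2⟩
      cases h : k.find? fun g => g.fst = v with
      | none =>
        rw [List.find?_eq_none] at h
        exact absurd h2 (by simpa using h g h1)
      | some g' =>
        have h3 := List.mem_of_find?_eq_some h
        have h4 : g'.fst = v := by simpa using List.find?_some h
        rw [l.eq_of_fst_eq (List.mem_filter.1 h3).1 (List.mem_filter.1 h1).1 (h4.trans h2.symm)]
  have hp : k.Perm (vs.filterMap fun v => k.find? fun g => g.fst = v) := by
    rw [List.perm_ext_iff_of_nodup hkn]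
    · intro g
      simp only [List.mem_filterMap, hf]
      exact ⟨fun h => ⟨g.fst, hm _, h, rfl⟩, fun ⟨_, _, h, _⟩ => h⟩
    · refine List.Nodup.filterMap ?_ hn
      intro u v g hu hv
      rw [Option.mem_def, hf] at hu hv
      exact hu.2.symm.trans hv.2
  have h1 := prod_eq_of_perm_of_commute Gate.op
    (fun a ha b hb => l.commute a (List.mem_filter.1 ha).1 b (List.mem_filter.1 hb).1) hp
  rw [prod_filterMap_op] at h1
  exact h1

end LightCone

end MeanValue

namespace MeanValue

open Matrix

/-! ### The sweep along a strip, and the order of its operators. -/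

section Sweep

variable {V : Type} [Fintype V] [DecidableEq V] {G : SimpleGraph V} {d : ℕ}

/-- A way to lay out the qubits on a strip: the qubit `v` sits at the position `pos v` along the
strip and at the height `lane v`. Once the qubits in `sep` are cut off, neighbours have nearby
positions. The set `core` is further than `d` away from `sep`. -/
structure Layout (G : SimpleGraph V) (d : ℕ) where
  pos : V → ℕ
  lane : V → ℕ
  height : ℕ
  len : ℕ
  sep : V → Bool
  core : V → Bool
  dist : V → ℕ
  lane_lt : ∀ v, lane v < height
  pos_lt : ∀ v, pos v < len
  inj : ∀ u v, pos u = pos v → lane u = lane v → u = v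
  pos_le : ∀ u v, G.Adj u v → sep u = false → sep v = false → pos u ≤ pos v + 1
  dist_le : ∀ u v, G.Adj u v → dist u ≤ dist v + 1
  dist_core : ∀ v, core v = true → dist v = 0
  dist_sep : ∀ v, sep v = true → d + 1 ≤ dist v

namespace Layout

variable (Λ : Layout G d) (U : Circuit G d) (O : V → Matrix (Fin 2) (Fin 2) ℂ)

/-- The observables on the core, and the identity elsewhere. -/
noncomputable def coreOp (v : V) : Matrix (Fin 2) (Fin 2) ℂ := if Λ.core v = true then O v else 1

/-- The amplitude of `x` in the state that the core observables generate. -/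
noncomputable def amp (x : V → Fin 2) : ℂ :=
  (U.opᴴ * tensorOp (Λ.coreOp O) * U.op) x (fun _ => 0)

/-- The operator that belongs to the qubit `v` at the time `τ ≤ 2 d`. -/
noncomputable def stepOp (τ : ℕ) (v : V) : Matrix (V → Fin 2) (V → Fin 2) ℂ :=
  if h : τ < d then (U ⟨τ, h⟩).gateAt Λ.sep v
  else if τ = d then site v (Λ.coreOp O v)
  else if h : 2 * d - τ < d then ((U ⟨2 * d - τ, h⟩).gateAt Λ.sep v)ᴴ
  else 1

/-- The operator that belongs to the qubit `v` at the time `τ ≤ 2 d + 1`; at the last time the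
qubit is projected onto `x v` and reset. -/
noncomputable def itemOp (x : V → Fin 2) (i : ℕ × V) : Matrix (V → Fin 2) (V → Fin 2) ℂ :=
  if i.1 < 2 * d + 1 then Λ.stepOp U O i.1 i.2 else site i.2 (ketbra (x i.2))

/-- The stage of the sweep in which an item is processed. -/
def key (i : ℕ × V) : ℕ := Λ.pos i.2 + 2 * i.1

/-- The number of an item in the sweep. -/
def idx (i : ℕ × V) : ℕ := (Λ.key i * (2 * d + 2) + i.1) * Λ.height + Λ.lane i.2

/-- The number of steps of the sweep. -/
def count : ℕ := (Λ.len + 4 * d + 2) * (2 * d + 2) * Λ.height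

/-- This is the only property of the observables that the sampler needs: between measurements the
squared norm can only fall below the recorded weight. -/
theorem stepOp_contraction (hO : ∀ v, ‖Matrix.toEuclideanCLM (n := Fin 2) (𝕜 := ℂ) (O v)‖ ≤ 1)
    (τ : ℕ) (v : V) : Contraction (Λ.stepOp U O τ v) := by
  unfold stepOp
  split_ifs with h1 h2 h3
  · rcases (U ⟨τ, h1⟩).gateAt_cases Λ.sep v with h | ⟨g, -, -, -, -, h⟩ <;> rw [h]
    · exact contraction_one
    · exact g.contraction
  · unfold coreOp
    split_ifs
    · exact site_contraction v (hO v)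
    · rw [site_one]; exact contraction_one
  · rcases (U ⟨2 * d - τ, h3⟩).gateAt_cases Λ.sep v with h | ⟨g, -, -, -, -, h⟩ <;> rw [h]
    · rw [Matrix.conjTranspose_one]; exact contraction_one
    · exact g.contraction_conjTranspose
  · exact contraction_one

/-- The qubits that an item may act on. -/
def touch (i : ℕ × V) : Set V :=
  if i.1 < 2 * d + 1 then {u | Λ.pos u ≤ Λ.pos i.2 + 1 ∧ Λ.pos i.2 ≤ Λ.pos u + 1} else {i.2}

theorem gateAt_mem (t : Fin d) (v : V) :
    (U t).gateAt Λ.sep v ∈ localAlg {u | Λ.pos u ≤ Λ.pos v + 1 ∧ Λ.pos v ≤ Λ.pos u + 1} := by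
  rcases (U t).gateAt_cases Λ.sep v with h | ⟨g, -, hv, h1, h2, h⟩ <;> rw [h]
  · exact Subalgebra.one_mem _
  · subst hv
    refine g.op_mem_localAlg ?_ ?_
    · simp
    · exact ⟨Λ.pos_le _ _ g.adj.symm h2 h1, Λ.pos_le _ _ g.adj h1 h2⟩

theorem itemOp_mem (x : V → Fin 2) (i : ℕ × V) : Λ.itemOp U O x i ∈ localAlg (Λ.touch i) := by
  unfold itemOp touch
  split_ifs with h
  · unfold stepOp
    split_ifs with h1 h2 h3
    · exact Λ.gateAt_mem U _ _
    · exact site_mem (by simp) _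
    · exact localAlg_conjTranspose (Λ.gateAt_mem U _ _)
    · exact Subalgebra.one_mem _
  · exact site_mem (by simp) _

theorem touch_le {i : ℕ × V} {u : V} (h : u ∈ Λ.touch i) :
    Λ.pos u ≤ Λ.pos i.2 + 1 ∧ Λ.pos i.2 ≤ Λ.pos u + 1 := by
  unfold touch at h
  split_ifs at h
  · exact h
  · rw [Set.mem_singleton_iff] at h
    subst h
    omega

theorem itemOp_commute_of_time_eq (x : V → Fin 2) (τ : ℕ) (u v : V) :
    Commute (Λ.itemOp U O x (τ, u)) (Λ.itemOp U O x (τ, v)) := by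
  by_cases huv : u = v
  · subst huv; exact Commute.refl _
  unfold itemOp
  dsimp only
  split_ifs with h
  · unfold stepOp
    split_ifs with h1 h2 h3
    · exact (U ⟨τ, h1⟩).gateAt_commute Λ.sep u v
    · exact site_commute huv _ _
    · have := (U ⟨2 * d - τ, h3⟩).gateAt_commute Λ.sep v u
      have e := congrArg Matrix.conjTranspose this.eq
      rwa [Matrix.conjTranspose_mul, Matrix.conjTranspose_mul] at e
    · exact Commute.refl _
  · exact site_commute huv _ _

theorem idx_lt_count {i : ℕ × V} (h : i.1 ≤ 2 * d + 1) : Λ.idx i < Λ.count := by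
  have h1 := Λ.lane_lt i.2
  have h2 := Λ.pos_lt i.2
  have h3 : Λ.key i * (2 * d + 2) + i.1 + 1 ≤ (Λ.len + 4 * d + 2) * (2 * d + 2) := by
    have : (Λ.key i + 1) * (2 * d + 2) ≤ (Λ.len + 4 * d + 2) * (2 * d + 2) :=
      Nat.mul_le_mul_right _ (by unfold key; omega)
    rw [add_mul] at this
    omega
  calc Λ.idx i < (Λ.key i * (2 * d + 2) + i.1) * Λ.height + Λ.height := by unfold idx; omega
    _ = (Λ.key i * (2 * d + 2) + i.1 + 1) * Λ.height := by ring
    _ ≤ _ := Nat.mul_le_mul_right _ h3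

theorem mul_add_lt_iff {L a b r s : ℕ} (hr : r < L) (hs : s < L) :
    a * L + r < b * L + s ↔ a < b ∨ a = b ∧ r < s := by
  constructor
  · intro h
    rcases lt_trichotomy a b with h' | h' | h'
    · exact Or.inl h'
    · subst h'; exact Or.inr ⟨rfl, by omega⟩
    · have : (b + 1) * L ≤ a * L := Nat.mul_le_mul_right _ h'
      rw [add_mul] at this
      omega
  · rintro (h | ⟨rfl, h⟩)
    · have : (a + 1) * L ≤ b * L := Nat.mul_le_mul_right _ h
      rw [add_mul] at this
      omega
    · omega

/-- `idx` is a mixed-radix numeral with the digits key, time and lane, so its order is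
lexicographic. The tie-break by time within a stage is essential for the reordering below. -/
theorem idx_lt_iff {i j : ℕ × V} (hi : i.1 ≤ 2 * d + 1) (hj : j.1 ≤ 2 * d + 1) :
    Λ.idx i < Λ.idx j ↔ Λ.key i < Λ.key j ∨ Λ.key i = Λ.key j ∧
      (i.1 < j.1 ∨ i.1 = j.1 ∧ Λ.lane i.2 < Λ.lane j.2) := by
  unfold idx
  rw [mul_add_lt_iff (Λ.lane_lt _) (Λ.lane_lt _), mul_add_lt_iff (by omega) (by omega)]
  constructor
  · rintro ((h | h) | ⟨h1, h2⟩)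
    · exact Or.inl h
    · exact Or.inr ⟨h.1, Or.inl h.2⟩
    · have e1 := mul_add_lt_iff (L := 2 * d + 2) (a := Λ.key i) (b := Λ.key j) (r := i.1)
        (s := j.1) (by omega) (by omega)
      have e2 := mul_add_lt_iff (L := 2 * d + 2) (a := Λ.key j) (b := Λ.key i) (r := j.1)
        (s := i.1) (by omega) (by omega)
      omega
  · rintro (h | ⟨h1, h | ⟨h2, h3⟩⟩)
    · exact Or.inl (Or.inl h)
    · exact Or.inl (Or.inr ⟨h1, h⟩)
    · exact Or.inr ⟨by rw [h1, h2], h3⟩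

theorem idx_injective {i j : ℕ × V} (hi : i.1 ≤ 2 * d + 1) (hj : j.1 ≤ 2 * d + 1)
    (h : Λ.idx i = Λ.idx j) : i = j := by
  have h1 := Λ.idx_lt_iff hi hj
  have h2 := Λ.idx_lt_iff hj hi
  have e : Λ.key i = Λ.key j ∧ i.1 = j.1 ∧ Λ.lane i.2 = Λ.lane j.2 := by omega
  refine Prod.ext e.2.1 (Λ.inj _ _ ?_ e.2.2)
  have := e.1
  unfold key at this
  omega

open Classical in
/-- The item with a given number. -/
noncomputable def item (j : ℕ) : Option (ℕ × V) :=
  if h : ∃ i : ℕ × V, i.1 ≤ 2 * d + 1 ∧ Λ.idx i = j then some h.choose else none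

theorem item_eq_some_iff {j : ℕ} {i : ℕ × V} :
    Λ.item j = some i ↔ i.1 ≤ 2 * d + 1 ∧ Λ.idx i = j := by
  unfold item
  constructor
  · intro h
    split_ifs at h with hj
    have e := hj.choose_spec
    rw [Option.some_inj] at h
    rwa [h] at e
  · rintro h
    have hj : ∃ i : ℕ × V, i.1 ≤ 2 * d + 1 ∧ Λ.idx i = j := ⟨i, h⟩
    rw [dif_pos hj, Option.some_inj]
    have e := hj.choose_spec
    exact Λ.idx_injective e.1 h.1 (e.2.trans h.2.symm)

/-- The items in the order in which they are processed. -/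
noncomputable def schedule : List (ℕ × V) := (List.range Λ.count).filterMap Λ.item

/-- The product of the operators of the items in a list; the first item acts first. -/
noncomputable def runOp (x : V → Fin 2) (l : List (ℕ × V)) :
    Matrix (V → Fin 2) (V → Fin 2) ℂ := (l.map (Λ.itemOp U O x)).reverse.prod

theorem runOp_cons (x : V → Fin 2) (i : ℕ × V) (l : List (ℕ × V)) :
    Λ.runOp U O x (i :: l) = Λ.runOp U O x l * Λ.itemOp U O x i := by
  simp [runOp]

theorem mem_schedule {i : ℕ × V} : i ∈ Λ.schedule ↔ i.1 ≤ 2 * d + 1 := by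
  unfold schedule
  rw [List.mem_filterMap]
  constructor
  · rintro ⟨j, -, h⟩
    exact (Λ.item_eq_some_iff.1 h).1
  · intro h
    exact ⟨Λ.idx i, List.mem_range.2 (Λ.idx_lt_count h), Λ.item_eq_some_iff.2 ⟨h, rfl⟩⟩

theorem schedule_pairwise : Λ.schedule.Pairwise fun a b =>
    a.1 ≤ 2 * d + 1 ∧ b.1 ≤ 2 * d + 1 ∧ Λ.idx a < Λ.idx b := by
  unfold schedule
  rw [List.pairwise_filterMap]
  refine List.pairwise_lt_range.imp fun {a b} hab i hi j hj => ?_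
  rw [Λ.item_eq_some_iff] at hi hj
  exact ⟨hi.1, hj.1, by rw [hi.2, hj.2]; exact hab⟩

theorem schedule_nodup : Λ.schedule.Nodup :=
  Λ.schedule_pairwise.imp fun {a b} h e => by subst e; exact lt_irrefl _ h.2.2

/-- The items in order of time. -/
noncomputable def timeOrder (V : Type) [Fintype V] (d : ℕ) : List (ℕ × V) :=
  (List.range (2 * d + 2)).flatMap fun τ => Finset.univ.toList.map fun v => (τ, v)

theorem mem_timeOrder {i : ℕ × V} : i ∈ timeOrder V d ↔ i.1 ≤ 2 * d + 1 := by
  simp only [timeOrder, List.mem_flatMap, List.mem_range, List.mem_map, Finset.mem_toList,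
    Finset.mem_univ, true_and]
  constructor
  · rintro ⟨τ, h, v, rfl⟩; dsimp only; omega
  · intro h; exact ⟨i.1, by omega, i.2, rfl⟩

theorem timeOrder_pairwise :
    (timeOrder V d).Pairwise fun a b => a.1 ≤ b.1 ∧ a ≠ b := by
  rw [timeOrder, List.pairwise_flatMap]
  constructor
  · intro τ _
    rw [List.pairwise_map]
    exact (Finset.nodup_toList Finset.univ).imp fun h => ⟨le_rfl, fun e => h (Prod.ext_iff.1 e).2⟩
  · refine List.pairwise_lt_range.imp fun {s t} hst a ha b hb => ?_
    obtain ⟨u, -, rfl⟩ := List.mem_map.1 ha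
    obtain ⟨v, -, rfl⟩ := List.mem_map.1 hb
    exact ⟨hst.le, fun e => hst.ne (Prod.ext_iff.1 e).1⟩

theorem timeOrder_nodup : (timeOrder V d).Nodup :=
  timeOrder_pairwise.imp fun h => h.2

/-- The sweep may run ahead in time at small positions because an item reaches only one column to
either side: the slope `2` in `key` keeps items that are processed against the order of time on
disjoint supports. -/
theorem runOp_schedule_eq_runOp_timeOrder (x : V → Fin 2) :
    Λ.runOp U O x Λ.schedule = Λ.runOp U O x (timeOrder V d) := by
  unfold runOp
  rw [← List.map_reverse, ← List.map_reverse]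
  refine prod_eq_of_perm _ (R₁ := fun a b => b.1 ≤ 2 * d + 1 ∧ a.1 ≤ 2 * d + 1 ∧
    Λ.idx b < Λ.idx a) (R₂ := fun a b => b.1 ≤ a.1) ?_ ?_ ?_ ?_
  · rintro a b ⟨hb, ha, hab⟩ h
    by_cases e : a.1 = b.1
    · obtain ⟨τ, u⟩ := a
      obtain ⟨τ', v⟩ := b
      dsimp only at e
      subst e
      exact Λ.itemOp_commute_of_time_eq U O x τ v u
    -- Here `b` is later in time but processed earlier. Equal keys are excluded by the tie-break, so
    -- the position of `a` exceeds that of `b` by more than `2`, and two supports of radius `1`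
    -- cannot meet.
    · refine localAlg_commute ?_ (Λ.itemOp_mem U O x b) (Λ.itemOp_mem U O x a)
      rw [Set.disjoint_left]
      intro u hu hu'
      have h1 := Λ.touch_le hu
      have h2 := Λ.touch_le hu'
      rw [Λ.idx_lt_iff hb ha] at hab
      unfold key at hab
      omega
  · rw [List.perm_reverse]
    refine (List.reverse_perm _).trans ?_
    rw [List.perm_ext_iff_of_nodup Λ.schedule_nodup timeOrder_nodup]
    intro i
    rw [mem_schedule, mem_timeOrder]
  · rw [List.pairwise_reverse]
    exact Λ.schedule_pairwise
  · rw [List.pairwise_reverse]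
    exact timeOrder_pairwise.imp fun h => h.1

theorem prod_reverse_of_commute {M : Type*} [Monoid M] (f : V → M)
    (h : ∀ u v, Commute (f u) (f v)) (l : List V) :
    (l.map f).reverse.prod = (l.map f).prod := by
  rw [← List.map_reverse]
  exact prod_eq_of_perm_of_commute f (fun a _ b _ => h a b) (List.reverse_perm l)

/-- In the order of time the items form the truncated circuit, the core observables, the adjoint of
the truncated circuit and the final projection. The light cone argument then restores the deleted
gates. -/
theorem runOp_timeOrder (x : V → Fin 2) :
    Λ.runOp U O x (timeOrder V d) =
      tensorOp (fun v => ketbra (x v)) * (U.opᴴ * tensorOp (Λ.coreOp O) * U.op) := by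
  set vs : List V := Finset.univ.toList with hvs
  have hn : vs.Nodup := Finset.nodup_toList _
  have hm : ∀ v, v ∈ vs := by simp [hvs]
  set P : ℕ → Matrix (V → Fin 2) (V → Fin 2) ℂ :=
    fun τ => (vs.map fun v => Λ.itemOp U O x (τ, v)).prod with hP
  set K := U.layerOp (Layer.keep · Λ.sep) with hK
  have e0 : Λ.runOp U O x (timeOrder V d) = timeProd P (2 * d + 2) := by
    rw [timeProd_eq, runOp, timeOrder]
    generalize 2 * d + 2 = k
    induction k with
    | zero => simp
    | succ k ih =>
      rw [List.range_succ, List.flatMap_append, List.map_append, List.reverse_append,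
        List.prod_append, ih, List.map_append, List.reverse_append, List.prod_append]
      congr 1
      simp only [List.flatMap_singleton, List.map_map, List.map_cons, List.map_nil,
        List.reverse_singleton, List.prod_singleton]
      exact prod_reverse_of_commute _ (fun u v => Λ.itemOp_commute_of_time_eq U O x k u v) _
  have p1 : ∀ τ < d, P τ = K τ := by
    intro τ h
    simp only [hP, hK, itemOp, stepOp, Circuit.layerOp, show τ < 2 * d + 1 by omega, if_true, h,
      dif_pos]
    rw [Layer.keep_eq_prod_gateAt _ _ hn hm]
  have p2 : P d = tensorOp (Λ.coreOp O) := by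
    simp only [hP, itemOp, stepOp, show d < 2 * d + 1 by omega, if_true, lt_irrefl, dite_false]
    exact prod_site _ hn hm
  have p3 : ∀ k < d, P (d + 1 + k) = (K (d - 1 - k))ᴴ := by
    intro k h
    have h1 : d + 1 + k < 2 * d + 1 := by omega
    have h2 : ¬ d + 1 + k < d := by omega
    have h3 : ¬ d + 1 + k = d := by omega
    have h4 : 2 * d - (d + 1 + k) = d - 1 - k := by omega
    have h5 : d - 1 - k < d := by omega
    simp only [hP, hK, itemOp, stepOp, Circuit.layerOp, h1, h2, h3, h4, h5, if_true, if_false,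
      dif_pos, dif_neg, not_false_iff]
    rw [Layer.keep_eq_prod_gateAt _ _ hn hm, Matrix.conjTranspose_list_prod, List.map_map,
      prod_reverse_of_commute]
    · rfl
    · intro u v
      have := (U ⟨d - 1 - k, h5⟩).gateAt_commute Λ.sep v u
      have e := congrArg Matrix.conjTranspose this.eq
      rwa [Matrix.conjTranspose_mul, Matrix.conjTranspose_mul] at e
  have p4 : P (2 * d + 1) = tensorOp fun v => ketbra (x v) := by
    simp only [hP, itemOp, lt_irrefl, if_false]
    exact prod_site _ hn hm
  have q1 : ∀ k ≤ d, timeProd P k = timeProd K k := by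
    intro k
    induction k with
    | zero => intro _; rfl
    | succ k ih => intro hk; rw [timeProd, timeProd, ih (by omega), p1 k (by omega)]
  -- The adjoint layers are transferred one by one from the left factor to the right one; at `k = d`
  -- the left factor is `1`.
  have q2 : ∀ k ≤ d, (timeProd K (d - k))ᴴ * timeProd P (d + 1 + k) =
      (timeProd K d)ᴴ * tensorOp (Λ.coreOp O) * timeProd K d := by
    intro k
    induction k with
    | zero =>
      intro _
      rw [Nat.sub_zero, Nat.add_zero, timeProd, p2, q1 d le_rfl, Matrix.mul_assoc]
    | succ k ih =>
      intro hk
      rw [← ih (by omega), show d + 1 + (k + 1) = d + 1 + k + 1 by ring, timeProd, p3 k (by omega),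
        show d - (k + 1) = d - 1 - k by omega, show d - k = d - 1 - k + 1 by omega, timeProd,
        Matrix.conjTranspose_mul, Matrix.mul_assoc]
  have q3 := q2 d le_rfl
  rw [Nat.sub_self, timeProd, Matrix.conjTranspose_one, Matrix.one_mul] at q3
  rw [e0, show 2 * d + 2 = 2 * d + 1 + 1 by ring, timeProd, p4,
    show 2 * d + 1 = d + 1 + d by ring, q3]
  congr 1
  -- The core observables act at distance `0`, and the separator starts at distance `d + 1`.
  refine conj_keep_eq U Λ.dist Λ.dist_le Λ.sep Λ.dist_sep (tensorOp_mem_localAlg _ _ ?_)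
  intro v hv
  rw [coreOp, if_neg]
  intro hc
  exact hv (le_of_eq (Λ.dist_core v hc))

theorem runOp_schedule_mulVec (x : V → Fin 2) :
    (Λ.runOp U O x Λ.schedule *ᵥ Pi.single (fun _ => 0) 1) (fun _ => 0) = Λ.amp U O x := by
  rw [runOp_schedule_eq_runOp_timeOrder, runOp_timeOrder, Matrix.mulVec_single_one]
  exact tensorOp_ketbra_mul_apply _ _ _

/-! ### The window of active qubits -/

/-- The vector `Ψ` is supported on configurations in which the qubit `v` is `0`. -/
def ZeroAt (v : V) (Ψ : (V → Fin 2) → ℂ) : Prop := ∀ y, y v ≠ 0 → Ψ y = 0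

/-- As a fixed-point equation for a projection at `v`, the condition is visibly preserved by every
operator that commutes with that projection. -/
theorem zeroAt_iff {v : V} {Ψ : (V → Fin 2) → ℂ} :
    ZeroAt v Ψ ↔ site v (Matrix.single 0 0 1) *ᵥ Ψ = Ψ := by
  have key : ∀ y, (site v (Matrix.single 0 0 1) *ᵥ Ψ) y = if y v = 0 then Ψ y else 0 := by
    intro y
    rw [site_mulVec]
    by_cases h : y v = 0
    · rw [if_pos h, Finset.sum_eq_single 0]
      · rw [h, Matrix.single_apply_same, one_mul, ← h, Function.update_eq_self]
      · intro b _ hb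
        simp [hb.symm]
      · simp
    · rw [if_neg h]
      refine Finset.sum_eq_zero fun b _ => ?_
      simp [Ne.symm h]
  constructor
  · intro h
    ext y
    rw [key]
    split_ifs with hy
    · rfl
    · exact (h y hy).symm
  · intro h y hy
    rw [← h, key, if_neg hy]

theorem ZeroAt.mulVec {v : V} {Ψ : (V → Fin 2) → ℂ} (h : ZeroAt v Ψ) {T : Set V} (hv : v ∉ T)
    {X : Matrix (V → Fin 2) (V → Fin 2) ℂ} (hX : X ∈ localAlg T) : ZeroAt v (X *ᵥ Ψ) := by
  rw [zeroAt_iff] at h ⊢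
  have := localAlg_commute (S := {v}) (by simpa using hv)
    (site_mem (Set.mem_singleton v) (Matrix.single 0 0 1)) hX
  rw [Matrix.mulVec_mulVec, this.eq, ← Matrix.mulVec_mulVec, h]

theorem zeroAt_ketbra (v : V) (b : Fin 2) (Ψ : (V → Fin 2) → ℂ) :
    ZeroAt v (site v (ketbra b) *ᵥ Ψ) := by
  intro y hy
  rw [site_mulVec]
  refine Finset.sum_eq_zero fun c _ => ?_
  simp [ketbra, Ne.symm hy]

/-- Before the step `j`, the qubits that have not been touched yet and those that have been
finished are in the state `0`. -/
def Tidy (j : ℕ) (Ψ : (V → Fin 2) → ℂ) : Prop :=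
  ∀ v, ((∀ i : ℕ × V, i.1 ≤ 2 * d + 1 → Λ.idx i < j → v ∉ Λ.touch i) ∨
    Λ.idx (2 * d + 1, v) < j) → ZeroAt v Ψ

theorem tidy_init : Λ.Tidy 0 (Pi.single (fun _ => 0) 1) := by
  intro v _ y hy
  rw [Pi.single_eq_of_ne]
  rintro rfl
  exact hy rfl

theorem Tidy.step_none {j : ℕ} {Ψ : (V → Fin 2) → ℂ} (h : Λ.Tidy j Ψ) (hj : Λ.item j = none) :
    Λ.Tidy (j + 1) Ψ := by
  have hne : ∀ i : ℕ × V, i.1 ≤ 2 * d + 1 → Λ.idx i ≠ j := fun i hi e => by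
    have := Λ.item_eq_some_iff.2 ⟨hi, e⟩
    rw [hj] at this
    cases this
  intro v hv
  refine h v (hv.imp (fun hv i hi hlt => hv i hi (by omega)) fun hv => ?_)
  have := hne (2 * d + 1, v) le_rfl
  omega

theorem Tidy.step {j : ℕ} {Ψ : (V → Fin 2) → ℂ} (h : Λ.Tidy j Ψ) (x : V → Fin 2) {i : ℕ × V}
    (hj : Λ.item j = some i) : Λ.Tidy (j + 1) (Λ.itemOp U O x i *ᵥ Ψ) := by
  obtain ⟨hi, rfl⟩ := Λ.item_eq_some_iff.1 hj
  intro v hv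
  by_cases ht : v ∈ Λ.touch i
  · have hv2 : Λ.idx (2 * d + 1, v) < Λ.idx i + 1 := by
      rcases hv with hv | hv
      · exact absurd ht (hv i hi (by omega))
      · exact hv
    by_cases hF : i.1 < 2 * d + 1
    -- An operator at a time `τ ≤ 2 * d` that touches `v` has key at most `pos v + 1 + 4 * d`, which
    -- is less than the key `pos v + 4 * d + 2` of the final item of `v`. So a finished qubit is
    -- never touched again.
    · exfalso
      have hp := Λ.touch_le ht
      have hlt : Λ.idx i < Λ.idx (2 * d + 1, v) := by
        rw [Λ.idx_lt_iff hi le_rfl]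
        left
        unfold key
        dsimp only
        omega
      omega
    · have hv' : v = i.2 := by
        unfold touch at ht
        rwa [if_neg hF, Set.mem_singleton_iff] at ht
      rw [itemOp, if_neg hF, hv']
      exact zeroAt_ketbra _ _ _
  -- If `v` is not touched, its status did not change in this step: its final item cannot be the
  -- current one, because that item touches `v`.
  · refine ZeroAt.mulVec (h v ?_) ht (Λ.itemOp_mem U O x i)
    refine hv.imp (fun hv k hk hlt => hv k hk (by omega)) fun hv => ?_
    rcases Nat.lt_succ_iff_lt_or_eq.1 hv with h1 | h1
    · exact h1
    · exfalso
      have := Λ.idx_injective le_rfl hi h1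
      rw [← this] at ht
      simp [touch] at ht

/-- The qubits that may be active in the stage `κ`. -/
def window (κ : ℕ) : Set V := {v | κ ≤ Λ.pos v + (4 * d + 2) ∧ Λ.pos v ≤ κ + 1}

/-- A qubit too far ahead of the current stage has not been touched, and a qubit too far behind has
been reset. In both cases it is `0` on the support of `Ψ`. -/
theorem Tidy.mem_window {j : ℕ} {Ψ : (V → Fin 2) → ℂ} (h : Λ.Tidy j Ψ) {i : ℕ × V}
    (hj : Λ.item j = some i) {y : V → Fin 2} (hy : Ψ y ≠ 0) {v : V} (hv : y v ≠ 0) :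
    v ∈ Λ.window (Λ.key i) := by
  obtain ⟨hi, rfl⟩ := Λ.item_eq_some_iff.1 hj
  by_contra hw
  refine hy (h v ?_ y hv)
  simp only [window, Set.mem_ofPred_eq, not_and_or, not_le] at hw
  rcases hw with hw | hw
  · right
    rw [Λ.idx_lt_iff le_rfl hi]
    left
    unfold key at hw ⊢
    dsimp only
    omega
  · left
    intro k hk hlt ht
    rw [Λ.idx_lt_iff hk hi] at hlt
    have := Λ.touch_le ht
    unfold key at hw hlt
    omega

theorem touch_subset_window {i : ℕ × V} (hi : i.1 ≤ 2 * d + 1) :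
    Λ.touch i ⊆ Λ.window (Λ.key i) := by
  intro u hu
  simp only [window, Set.mem_ofPred_eq, key]
  unfold touch at hu
  split_ifs at hu with h
  · simp only [Set.mem_ofPred_eq] at hu
    omega
  · rw [Set.mem_singleton_iff] at hu
    subst hu
    omega

/-- The number of columns of the window. -/
abbrev width (d : ℕ) : ℕ := 4 * d + 4

/-- The place of a qubit in the memory. -/
def slot (v : V) : ℕ := Λ.pos v % width d * Λ.height + Λ.lane v

theorem slot_lt (v : V) : Λ.slot v < width d * Λ.height := by
  have h1 := Λ.lane_lt v
  have h2 : Λ.pos v % width d + 1 ≤ width d := Nat.mod_lt _ (by unfold width; omega)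
  have h3 := Nat.mul_le_mul_right Λ.height h2
  rw [add_mul] at h3
  unfold slot
  omega

/-- The positions in the window run from `κ - (4 * d + 2)` to `κ + 1`, at most `4 * d + 4`
consecutive values, so reduction modulo `width d` separates them. Memory columns are thus reused
cyclically. -/
theorem slot_injOn (κ : ℕ) : Set.InjOn Λ.slot (Λ.window κ) := by
  intro u hu v hv h
  simp only [window, Set.mem_ofPred_eq] at hu hv
  unfold slot at h
  have h1 := mul_add_lt_iff (a := Λ.pos u % width d) (b := Λ.pos v % width d)
    (Λ.lane_lt u) (Λ.lane_lt v)
  have h2 := mul_add_lt_iff (a := Λ.pos v % width d) (b := Λ.pos u % width d)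
    (Λ.lane_lt v) (Λ.lane_lt u)
  have h3 : Λ.pos u % width d = Λ.pos v % width d := by omega
  have h4 : Λ.lane u = Λ.lane v := by omega
  refine Λ.inj u v ?_ h4
  unfold width at h3
  rcases le_total (Λ.pos u) (Λ.pos v) with hle | hle
  · have : (4 * d + 4) ∣ Λ.pos v - Λ.pos u := (Nat.modEq_iff_dvd' hle).1 h3
    have := Nat.eq_zero_of_dvd_of_lt this (by omega)
    omega
  · have : (4 * d + 4) ∣ Λ.pos u - Λ.pos v := (Nat.modEq_iff_dvd' hle).1 h3.symm
    have := Nat.eq_zero_of_dvd_of_lt this (by omega)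
    omega

end Layout

end Sweep

end MeanValue

namespace MeanValue

open Matrix

/-! ### Inverse transform sampling -/

/-- Locate `u` in the partition of an interval into consecutive intervals of the lengths `w a`,
`a ∈ l`. The second component of the result is the position in the interval that was found. -/
noncomputable def locate {α : Type*} [Inhabited α] (w : α → ℝ) : List α → ℝ → α × ℝ
  | [], u => (default, u)
  | [a], u => (a, u)
  | a :: b :: l, u => if u < w a then (a, u) else locate w (b :: l) (u - w a)

section Locate

variable {α : Type*} [Inhabited α] (w : α → ℝ)

theorem locate_cons_of_lt {a : α} {l : List α} {u : ℝ} (h : u < w a) :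
    locate w (a :: l) u = (a, u) := by
  cases l with
  | nil => rfl
  | cons b l => rw [locate, if_pos h]

theorem locate_cons_of_le {a : α} {l : List α} (hl : l ≠ []) {u : ℝ} (h : w a ≤ u) :
    locate w (a :: l) u = locate w l (u - w a) := by
  cases l with
  | nil => exact absurd rfl hl
  | cons b l => rw [locate, if_neg (not_lt.2 h)]

theorem locate_spec {l : List α} {u : ℝ} (h0 : 0 ≤ u) (h1 : u < (l.map w).sum) :
    (locate w l u).1 ∈ l ∧ 0 ≤ (locate w l u).2 ∧ (locate w l u).2 < w (locate w l u).1 := by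
  induction l generalizing u with
  | nil => simp only [List.map_nil, List.sum_nil] at h1; linarith
  | cons a l ih =>
    rw [List.map_cons, List.sum_cons] at h1
    by_cases h : u < w a
    · rw [locate_cons_of_lt w h]
      exact ⟨by simp, h0, h⟩
    · rw [not_lt] at h
      have hl : l ≠ [] := by
        rintro rfl
        simp only [List.map_nil, List.sum_nil] at h1
        linarith
      rw [locate_cons_of_le w hl h]
      obtain ⟨i1, i2⟩ := ih (u := u - w a) (by linarith) (by linarith)
      exact ⟨List.mem_cons_of_mem _ i1, i2⟩

theorem locate_append_of_lt {l l' : List α} {u : ℝ} (h1 : u < (l.map w).sum)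
    (hw : l ≠ []) : locate w (l ++ l') u = locate w l u := by
  induction l generalizing u with
  | nil => exact absurd rfl hw
  | cons a l ih =>
    rw [List.map_cons, List.sum_cons] at h1
    by_cases h : u < w a
    · rw [List.cons_append, locate_cons_of_lt w h, locate_cons_of_lt w h]
    · rw [not_lt] at h
      have hl : l ≠ [] := by
        rintro rfl
        simp only [List.map_nil, List.sum_nil] at h1
        linarith
      rw [List.cons_append, locate_cons_of_le w (by simp [hl]) h, locate_cons_of_le w hl h,
        ih (by linarith) hl]

theorem locate_append_of_le {l l' : List α} (hl' : l' ≠ []) {u : ℝ} (hw : ∀ a ∈ l, 0 ≤ w a)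
    (h1 : (l.map w).sum ≤ u) : locate w (l ++ l') u = locate w l' (u - (l.map w).sum) := by
  induction l generalizing u with
  | nil => simp
  | cons a l ih =>
    rw [List.map_cons, List.sum_cons] at h1 ⊢
    have hs : 0 ≤ (l.map w).sum := List.sum_nonneg (by
      simpa using fun a ha => hw a (List.mem_cons_of_mem _ ha))
    rw [List.cons_append, locate_cons_of_le w (by simp [hl']) (by linarith),
      ih (fun b hb => hw b (List.mem_cons_of_mem _ hb)) (by linarith)]
    congr 1
    ring

theorem sum_flatMap (f : α → List α) (l : List α) (hf : ∀ a ∈ l, ((f a).map w).sum = w a) :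
    ((l.flatMap f).map w).sum = (l.map w).sum := by
  induction l with
  | nil => rfl
  | cons a l ih =>
    rw [List.flatMap_cons, List.map_append, List.sum_append, hf a (by simp),
      ih fun b hb => hf b (List.mem_cons_of_mem _ hb), List.map_cons, List.sum_cons]

/-- Each interval is subdivided without changing its total length. Locating a point in the
refinement is the same as locating the interval first and then the residue inside it. -/
theorem locate_flatMap (f : α → List α) {l : List α} {u : ℝ} (h0 : 0 ≤ u)
    (h1 : u < (l.map w).sum) (hf : ∀ a ∈ l, ((f a).map w).sum = w a)
    (hw : ∀ a ∈ l, ∀ b ∈ f a, 0 ≤ w b) :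
    locate w (l.flatMap f) u = locate w (f (locate w l u).1) (locate w l u).2 := by
  induction l generalizing u with
  | nil => simp only [List.map_nil, List.sum_nil] at h1; linarith
  | cons a l ih =>
    rw [List.map_cons, List.sum_cons] at h1
    have hfa := hf a (by simp)
    have hl := sum_flatMap w f l fun b hb => hf b (List.mem_cons_of_mem _ hb)
    rw [List.flatMap_cons]
    by_cases h : u < w a
    · rw [locate_cons_of_lt w h, locate_append_of_lt w (by rw [hfa]; exact h)]
      intro h'
      rw [h', List.map_nil, List.sum_nil] at hfa
      linarith
    · rw [not_lt] at h
      have hne : l.flatMap f ≠ [] := by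
        intro h'
        rw [h', List.map_nil, List.sum_nil] at hl
        linarith
      have hne' : l ≠ [] := by rintro rfl; exact hne rfl
      rw [locate_cons_of_le w hne' h, locate_append_of_le w hne (hw a (by simp))
        (by rw [hfa]; exact h), hfa]
      exact ih (by linarith) (by linarith) (fun b hb => hf b (List.mem_cons_of_mem _ hb))
        fun b hb => hw b (List.mem_cons_of_mem _ hb)

end Locate

/-! ### Sampling by a sweep -/

/-- A state of the sampler: the state vector, the outcomes, the probability of the history, and
whether the sampler is still on. -/
structure Node (V : Type) where
  Ψ : (V → Fin 2) → ℂ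
  x : V → Fin 2
  N : ℝ
  on : Bool

noncomputable instance (V : Type) : Inhabited (Node V) := ⟨⟨fun _ => 0, fun _ => 0, 0, false⟩⟩

section Sampler

variable {V : Type} [Fintype V] [DecidableEq V] {G : SimpleGraph V} {d : ℕ}

theorem nsq_ketbra (v : V) (Ψ : (V → Fin 2) → ℂ) :
    nsq (site v (ketbra 0) *ᵥ Ψ) + nsq (site v (ketbra 1) *ᵥ Ψ) = nsq Ψ := by
  rw [nsq_eq_sum_split v, nsq_eq_sum_split v, nsq_eq_sum_split v, ← Finset.sum_add_distrib]
  refine Finset.sum_congr rfl fun r _ => ?_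
  simp [site_mulVec, update_funSplitAt_symm, ketbra, Matrix.single_apply]

namespace Layout

variable (Λ : Layout G d) (U : Circuit G d) (O : V → Matrix (Fin 2) (Fin 2) ℂ)

/-- What may happen to the sampler when an item is processed. -/
noncomputable def branches (i : ℕ × V) (nd : Node V) : List (Node V) :=
  if i.1 < 2 * d + 1 then [{ nd with Ψ := Λ.stepOp U O i.1 i.2 *ᵥ nd.Ψ }]
  else if nd.on = true then
    [⟨site i.2 (ketbra 0) *ᵥ nd.Ψ, Function.update nd.x i.2 0,
        nsq (site i.2 (ketbra 0) *ᵥ nd.Ψ), true⟩,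
      ⟨site i.2 (ketbra 1) *ᵥ nd.Ψ, Function.update nd.x i.2 1,
        nsq (site i.2 (ketbra 1) *ᵥ nd.Ψ), true⟩,
      ⟨site i.2 (ketbra 0) *ᵥ nd.Ψ, Function.update nd.x i.2 0,
        nd.N - nsq (site i.2 (ketbra 0) *ᵥ nd.Ψ) - nsq (site i.2 (ketbra 1) *ᵥ nd.Ψ), false⟩]
  else [{ nd with Ψ := site i.2 (ketbra (nd.x i.2)) *ᵥ nd.Ψ }]

/-- All possible results of the sampler. -/
noncomputable def leaves : List (ℕ × V) → Node V → List (Node V)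
  | [], nd => [nd]
  | i :: l, nd => (Λ.branches U O i nd).flatMap (leaves l)

/-- The sampler. -/
noncomputable def sweep : List (ℕ × V) → Node V × ℝ → Node V × ℝ
  | [], p => p
  | i :: l, p => sweep l (locate Node.N (Λ.branches U O i p.1) p.2)

/-- The weight of a node is at least the squared norm of its state vector. -/
def Consistent (nd : Node V) : Prop := 0 ≤ nd.N ∧ (nd.on = true → nsq nd.Ψ ≤ nd.N)

variable (hO : ∀ v, ‖Matrix.toEuclideanCLM (n := Fin 2) (𝕜 := ℂ) (O v)‖ ≤ 1)

-- The dead branch absorbs the difference between the old weight and the current squared norm. That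
-- difference is nonnegative because the two outcomes together carry exactly the squared norm
-- (`nsq_ketbra`).
include hO in
theorem branches_consistent (i : ℕ × V) {nd : Node V} (h : Consistent nd) :
    ∀ nd' ∈ Λ.branches U O i nd, Consistent nd' := by
  unfold branches
  split_ifs with h1 h2
  · simp only [List.mem_singleton, forall_eq]
    exact ⟨h.1, fun hon => (Λ.stepOp_contraction U O hO _ _ _).trans (h.2 hon)⟩
  · simp only [List.mem_cons, List.not_mem_nil, or_false, forall_eq_or_imp, forall_eq]
    refine ⟨⟨nsq_nonneg _, fun _ => le_rfl⟩, ⟨nsq_nonneg _, fun _ => le_rfl⟩, ?_, by simp⟩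
    have := nsq_ketbra i.2 nd.Ψ
    have := h.2 h2
    dsimp only
    linarith
  · simp only [List.mem_singleton, forall_eq]
    exact ⟨h.1, fun hon => absurd hon h2⟩

theorem branches_sum (i : ℕ × V) (nd : Node V) :
    ((Λ.branches U O i nd).map Node.N).sum = nd.N := by
  unfold branches
  split_ifs
  · simp
  · simp only [List.map_cons, List.map_nil, List.sum_cons, List.sum_nil]; ring
  · simp

include hO in
theorem leaves_consistent (l : List (ℕ × V)) {nd : Node V} (h : Consistent nd) :
    ∀ nd' ∈ Λ.leaves U O l nd, Consistent nd' := by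
  induction l generalizing nd with
  | nil => simpa [leaves] using h
  | cons i l ih =>
    intro nd' h'
    rw [leaves, List.mem_flatMap] at h'
    obtain ⟨a, ha, h'⟩ := h'
    exact ih (Λ.branches_consistent U O hO i h a ha) nd' h'

theorem leaves_sum (l : List (ℕ × V)) (nd : Node V) :
    ((Λ.leaves U O l nd).map Node.N).sum = nd.N := by
  induction l generalizing nd with
  | nil => simp [leaves]
  | cons i l ih =>
    rw [leaves, sum_flatMap Node.N _ _ fun a _ => ih a, branches_sum]

-- Sequential sampling, in which the residue of `u` is handed from step to step, is a single inverse
-- transform over the list of all histories. The analysis of the estimator can then forget the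
-- sweep.
include hO in
theorem sweep_eq_locate (l : List (ℕ × V)) {nd : Node V} (h : Consistent nd) {u : ℝ} (h0 : 0 ≤ u)
    (h1 : u < nd.N) : Λ.sweep U O l (nd, u) = locate Node.N (Λ.leaves U O l nd) u := by
  induction l generalizing nd u with
  | nil => rfl
  | cons i l ih =>
    have hs := Λ.branches_sum U O i nd
    have hb := Λ.branches_consistent U O hO i h
    obtain ⟨s1, s2, s3⟩ := locate_spec Node.N h0 (hs.symm ▸ h1)
    rw [leaves, locate_flatMap Node.N _ h0 (hs.symm ▸ h1) (fun a _ => Λ.leaves_sum U O l a)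
      fun a ha b hb' => (Λ.leaves_consistent U O hO l (hb a ha) b hb').1, sweep]
    exact ih (hb _ s1) s2 s3

/-- Only final items branch, into at most three nodes each. The number of leaves determines how many
random bits are needed. -/
theorem length_leaves_le (l : List (ℕ × V)) (nd : Node V) :
    (Λ.leaves U O l nd).length ≤ 3 ^ (l.filter fun i => !decide (i.1 < 2 * d + 1)).length := by
  induction l generalizing nd with
  | nil => simp [leaves]
  | cons i l ih =>
    rw [leaves]
    unfold branches
    by_cases h1 : i.1 < 2 * d + 1
    · rw [if_pos h1, List.filter_cons_of_neg (by simp [h1])]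
      simpa using ih _
    rw [if_neg h1, List.filter_cons_of_pos (by simp [h1]), List.length_cons, pow_succ]
    split_ifs with h2
    · simp only [List.flatMap_cons, List.flatMap_nil, List.length_append, List.length_nil]
      have e1 := ih ⟨site i.2 (ketbra 0) *ᵥ nd.Ψ, Function.update nd.x i.2 0,
        nsq (site i.2 (ketbra 0) *ᵥ nd.Ψ), true⟩
      have e2 := ih ⟨site i.2 (ketbra 1) *ᵥ nd.Ψ, Function.update nd.x i.2 1,
        nsq (site i.2 (ketbra 1) *ᵥ nd.Ψ), true⟩
      have e3 := ih ⟨site i.2 (ketbra 0) *ᵥ nd.Ψ, Function.update nd.x i.2 0,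
        nd.N - nsq (site i.2 (ketbra 0) *ᵥ nd.Ψ) - nsq (site i.2 (ketbra 1) *ᵥ nd.Ψ), false⟩
      omega
    · simp only [List.flatMap_cons, List.flatMap_nil, List.append_nil]
      refine (ih _).trans ?_
      have := Nat.zero_le (3 ^ (l.filter fun i => !decide (i.1 < 2 * d + 1)).length)
      omega

theorem length_filter_schedule_le :
    (Λ.schedule.filter fun i => !decide (i.1 < 2 * d + 1)).length ≤ Fintype.card V := by
  rw [← List.length_map (f := Prod.snd)]
  refine List.Nodup.length_le_card ?_
  refine List.Nodup.map_on ?_ (Λ.schedule_nodup.filter _)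
  intro a ha b hb hab
  simp only [List.mem_filter, mem_schedule, Bool.not_eq_true', decide_eq_false_iff_not] at ha hb
  exact Prod.ext (by omega) hab

theorem sum_leaves_off {M : Type*} [AddCommMonoid M] (g : (V → Fin 2) → ℂ → M)
    (l : List (ℕ × V)) {nd : Node V} (h : nd.on = false) :
    ((Λ.leaves U O l nd).map fun lf =>
      if lf.on = true then g lf.x (lf.Ψ fun _ => 0) else 0).sum = 0 := by
  induction l generalizing nd with
  | nil => simp [leaves, h]
  | cons i l ih =>
    rw [leaves]
    unfold branches
    split_ifs with h1 h2
    · simp only [List.flatMap_cons, List.flatMap_nil, List.append_nil]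
      exact ih h
    · simp [h] at h2
    · simp only [List.flatMap_cons, List.flatMap_nil, List.append_nil]
      exact ih h

/-- A sum over the leaves is a sum over the configurations. -/
theorem sum_leaves {M : Type*} [AddCommMonoid M] (g : (V → Fin 2) → ℂ → M)
    {l : List (ℕ × V)} (hl : l.Nodup) (hl' : ∀ i ∈ l, i.1 ≤ 2 * d + 1) {nd : Node V}
    (h : nd.on = true) :
    ((Λ.leaves U O l nd).map fun lf =>
      if lf.on = true then g lf.x (lf.Ψ fun _ => 0) else 0).sum =
    ∑ y : V → Fin 2, if ∀ v, (2 * d + 1, v) ∉ l → y v = nd.x v then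
      g y ((Λ.runOp U O y l *ᵥ nd.Ψ) fun _ => 0) else 0 := by
  induction l generalizing nd with
  | nil =>
    rw [Finset.sum_eq_single nd.x]
    · simp [leaves, h, runOp]
    · intro y _ hy
      rw [if_neg]
      intro h'
      exact hy (funext fun v => h' v (by simp))
    · simp
  | cons i l ih =>
    rw [List.nodup_cons] at hl
    have hl'' : ∀ i ∈ l, i.1 ≤ 2 * d + 1 := fun k hk => hl' k (List.mem_cons_of_mem _ hk)
    rw [leaves]
    unfold branches
    split_ifs with h1
    · simp only [List.flatMap_cons, List.flatMap_nil, List.append_nil]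
      refine (ih hl.2 hl'' (nd := { nd with Ψ := Λ.stepOp U O i.1 i.2 *ᵥ nd.Ψ }) h).trans ?_
      refine Finset.sum_congr rfl fun y _ => ?_
      have e : (∀ v, (2 * d + 1, v) ∉ i :: l → y v = nd.x v) ↔
          ∀ v, (2 * d + 1, v) ∉ l → y v = nd.x v := by
        refine forall_congr' fun v => ?_
        have : (2 * d + 1, v) ≠ i := by rintro rfl; simp at h1
        simp [this]
      simp only [e, runOp_cons, ← Matrix.mulVec_mulVec]
      simp only [itemOp, h1, if_true]
    · obtain ⟨τ, v⟩ := i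
      have hτ : τ = 2 * d + 1 := by
        have := hl' (τ, v) (by simp)
        dsimp only at this h1
        omega
      subst hτ
      simp only [List.flatMap_cons, List.flatMap_nil, List.append_nil, List.map_append,
        List.sum_append]
      -- The dead branch contributes nothing. The two live branches divide the admissible
      -- configurations according to the value at `v`, which is fixed from now on.
      rw [ih hl.2 hl'' rfl, ih hl.2 hl'' rfl, Λ.sum_leaves_off U O g l rfl, add_zero,
        ← Finset.sum_add_distrib]
      refine Finset.sum_congr rfl fun y _ => ?_
      have e : ∀ b : Fin 2, (∀ u, (2 * d + 1, u) ∉ l → y u = Function.update nd.x v b u) ↔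
          y v = b ∧ ∀ u, (2 * d + 1, u) ∉ (2 * d + 1, v) :: l → y u = nd.x u := by
        intro b
        constructor
        · intro hy
          refine ⟨by simpa using hy v hl.1, fun u hu => ?_⟩
          simp only [List.mem_cons, Prod.mk.injEq, true_and, not_or] at hu
          simpa [hu.1] using hy u hu.2
        · rintro ⟨hb, hy⟩ u hu
          by_cases huv : u = v
          · subst huv; simpa using hb
          · rw [Function.update_of_ne huv]
            exact hy u (by simp [huv, hu])
      simp only [e, runOp_cons, ← Matrix.mulVec_mulVec]
      simp only [itemOp, lt_irrefl, if_false]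
      rcases Fin.exists_fin_two.1 ⟨y v, rfl⟩ with hb | hb
      · simp [hb]
      · simp [hb]

/-- The initial state of the sampler. -/
noncomputable def root : Node V := ⟨Pi.single (fun _ => 0) 1, fun _ => 0, 1, true⟩

theorem nsq_init : nsq (Pi.single (fun _ => 0) 1 : (V → Fin 2) → ℂ) = 1 := by
  rw [nsq, Finset.sum_eq_single (fun _ => 0)]
  · simp
  · intro y _ hy; simp [hy]
  · simp

theorem root_consistent : Consistent (root : Node V) :=
  ⟨zero_le_one, fun _ => le_of_eq nsq_init⟩

theorem sum_leaves_schedule {M : Type*} [AddCommMonoid M] (g : (V → Fin 2) → ℂ → M) :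
    ((Λ.leaves U O Λ.schedule root).map fun lf =>
      if lf.on = true then g lf.x (lf.Ψ fun _ => 0) else 0).sum =
    ∑ y : V → Fin 2, g y (Λ.amp U O y) := by
  rw [sum_leaves Λ U O g Λ.schedule_nodup (fun i hi => Λ.mem_schedule.1 hi) rfl]
  refine Finset.sum_congr rfl fun y _ => ?_
  rw [if_pos, root, runOp_schedule_mulVec]
  intro v hv
  exact absurd (Λ.mem_schedule.2 le_rfl) hv

-- Each squared amplitude is at most the weight of its live leaf, and all leaf weights add up to
-- `1`.
include hO in
theorem sum_normSq_amp_le : ∑ y : V → Fin 2, Complex.normSq (Λ.amp U O y) ≤ 1 := by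
  rw [← Λ.sum_leaves_schedule U O fun _ z => Complex.normSq z]
  have h1 := Λ.leaves_sum U O Λ.schedule root
  change _ = (1 : ℝ) at h1
  rw [← h1]
  refine List.sum_le_sum fun lf hlf => ?_
  have hc := Λ.leaves_consistent U O hO _ root_consistent lf hlf
  split_ifs with h
  · exact (normSq_le_nsq _ _).trans (hc.2 h)
  · exact hc.1

/-- The value that a sample contributes to the estimate; `β` are the amplitudes of the second
state. -/
noncomputable def value (β : (V → Fin 2) → ℂ) (lf : Node V) : ℂ :=
  if lf.on = true then (starRingEnd ℂ) (lf.Ψ fun _ => 0) * β lf.x / lf.N else 0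

-- The division by the weight in `value` cancels against the probability of the leaf; live leaves
-- correspond to configurations.
include hO in
theorem sum_weight_mul_value (β : (V → Fin 2) → ℂ) :
    ((Λ.leaves U O Λ.schedule root).map fun lf => (lf.N : ℂ) * value β lf).sum =
      ∑ y, (starRingEnd ℂ) (Λ.amp U O y) * β y := by
  rw [← Λ.sum_leaves_schedule U O fun y z => (starRingEnd ℂ) z * β y]
  congr 1
  refine List.map_congr_left fun lf hlf => ?_
  have hc := Λ.leaves_consistent U O hO _ root_consistent lf hlf
  unfold value
  split_ifs with h
  -- At weight `0` the value is `0` by the convention for division. Nothing is lost, because the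
  -- amplitude is bounded by the weight and vanishes too.
  · by_cases hN : lf.N = 0
    · have : lf.Ψ (fun _ => 0) = 0 := by
        rw [← Complex.normSq_eq_zero]
        have := (normSq_le_nsq lf.Ψ fun _ => 0).trans (hc.2 h)
        exact le_antisymm (hN ▸ this) (Complex.normSq_nonneg _)
      simp [hN, this]
    · have : (lf.N : ℂ) ≠ 0 := by exact_mod_cast hN
      field_simp
  · simp

-- In `N * |α x|² * |β x|² / N²` the ratio `|α x|² / N` is at most `1`, since the final vector has
-- squared norm at most `N`. What remains is the squared norm of the second state.
include hO in
theorem sum_weight_mul_normSq_value_le (β : (V → Fin 2) → ℂ)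
    (hβ : ∑ y, Complex.normSq (β y) ≤ 1) :
    ((Λ.leaves U O Λ.schedule root).map fun lf => lf.N * Complex.normSq (value β lf)).sum ≤ 1 := by
  refine le_trans ?_ hβ
  rw [← Λ.sum_leaves_schedule U O fun y _ => Complex.normSq (β y)]
  refine List.sum_le_sum fun lf hlf => ?_
  have hc := Λ.leaves_consistent U O hO _ root_consistent lf hlf
  unfold value
  split_ifs with h
  · have h1 := (normSq_le_nsq lf.Ψ fun _ => 0).trans (hc.2 h)
    rw [Complex.normSq_div, Complex.normSq_mul, Complex.normSq_conj, Complex.normSq_ofReal]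
    rcases hc.1.eq_or_lt with hN | hN
    · rw [← hN]; simp [Complex.normSq_nonneg]
    · have e : lf.N * (Complex.normSq (lf.Ψ fun _ => 0) * Complex.normSq (β lf.x) /
          (lf.N * lf.N)) =
          Complex.normSq (lf.Ψ fun _ => 0) / lf.N * Complex.normSq (β lf.x) := by
        field_simp
      rw [e]
      exact mul_le_of_le_one_left (Complex.normSq_nonneg _) ((div_le_one hN).2 h1)
  · simp

end Layout

/-- The mean value is an inner product of two states that are generated by parts of the
observable. -/
theorem meanValue_eq_sum (U : Circuit G d) (O : V → Matrix (Fin 2) (Fin 2) ℂ)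
    (Λ Λ' : Layout G d) (h : ∀ v, Λ.core v = !Λ'.core v) :
    meanValue U O = ∑ y, (starRingEnd ℂ) (Λ.amp U (fun v => (O v)ᴴ) y) * Λ'.amp U O y := by
  -- The inner `U U†` cancels. At each qubit one of the two core factors is `1`, as the cores are
  -- complementary, so the product of the factors is `O v`.
  have h1 : (U.opᴴ * tensorOp (Λ.coreOp fun v => (O v)ᴴ) * U.op)ᴴ *
      (U.opᴴ * tensorOp (Λ'.coreOp O) * U.op) = U.opᴴ * tensorOp O * U.op := by
    rw [Matrix.conjTranspose_mul, Matrix.conjTranspose_mul, Matrix.conjTranspose_conjTranspose,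
      tensorOp_conjTranspose]
    simp only [Matrix.mul_assoc]
    rw [← Matrix.mul_assoc U.op U.opᴴ, U.coisometry, Matrix.one_mul,
      ← Matrix.mul_assoc (tensorOp _) (tensorOp _), tensorOp_mul]
    congr 4
    ext1 v
    unfold Layout.coreOp
    rw [h v]
    cases Λ'.core v <;> simp
  rw [meanValue, ← h1, Matrix.mul_apply]
  rfl

end Sampler

end MeanValue

namespace MeanValue

/-! ### Repeated sampling -/

section Repeat

variable {α : Type*} [Inhabited α] (w : α → ℝ) (Z : α → ℂ) (l : List α)

/-- The sum of the values of `S` samples that are drawn one after another by means of a single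
number `u`. -/
noncomputable def total : ℕ → ℝ → ℂ
  | 0, _ => 0
  | S + 1, u => Z (locate w l u).1 + total S ((locate w l u).2 / w (locate w l u).1)

/-- The expectation of a function of the sum of `S` independent samples. -/
noncomputable def expect : ℕ → (ℂ → ℝ) → ℝ
  | 0, f => f 0
  | S + 1, f => (l.map fun a => w a * expect S fun z => f (Z a + z)).sum

open Classical in
/-- Sampling from a grid is almost as good as sampling from an interval. -/
theorem sub_le_card_grid (hw : ∀ a ∈ l, 0 ≤ w a) (hs : (l.map w).sum = 1) (M S : ℕ)
    (P : ℂ → Prop) {L A : ℝ} (hL : 0 ≤ L) (hA : 0 ≤ A) (hM : L + A ≤ M) :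
    A * expect w Z l S (fun z => if P z then 1 else 0) - (l.length : ℝ) ^ S ≤
      ((Finset.range M).filter fun k : ℕ =>
        L ≤ k ∧ (k : ℝ) < L + A ∧ P (total w Z l S ((k - L) / A))).card := by
  induction S generalizing P L A with
  | zero =>
    simp only [expect, total, pow_zero]
    by_cases hP : P 0
    · simp only [hP, if_true, and_true, mul_one]
      -- A half-open interval of length `A` contains at least `A - 1` integers; the deficit `1` is
      -- `l.length ^ 0`.
      have hsub : Finset.Ico ⌈L⌉₊ ⌈L + A⌉₊ ⊆
          (Finset.range M).filter fun k : ℕ => L ≤ k ∧ (k : ℝ) < L + A := by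
        intro k hk
        rw [Finset.mem_Ico, Nat.ceil_le, Nat.lt_ceil] at hk
        rw [Finset.mem_filter, Finset.mem_range]
        exact ⟨by exact_mod_cast hk.2.trans_le hM, hk⟩
      have h1 := Finset.card_le_card hsub
      rw [Nat.card_Ico] at h1
      have h2 : ((⌈L + A⌉₊ - ⌈L⌉₊ : ℕ) : ℝ) ≥ L + A - (L + 1) := by
        have a1 := Nat.le_ceil (L + A)
        have a2 := (Nat.ceil_lt_add_one hL).le
        have a3 : (⌈L + A⌉₊ : ℝ) ≤ ((⌈L + A⌉₊ - ⌈L⌉₊ : ℕ) : ℝ) + ⌈L⌉₊ := by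
          have : ⌈L + A⌉₊ ≤ (⌈L + A⌉₊ - ⌈L⌉₊) + ⌈L⌉₊ := by omega
          exact_mod_cast this
        linarith
      have h3 : ((⌈L + A⌉₊ - ⌈L⌉₊ : ℕ) : ℝ) ≤ _ := Nat.cast_le.2 h1
      linarith
    · simp [hP]
  | succ S ih =>
    -- For `A = 0` the left side is not positive. Otherwise division by `A` is meaningful below.
    rcases hA.eq_or_lt with rfl | hA'
    · rw [zero_mul, zero_sub]
      exact le_trans (neg_nonpos.2 (by positivity)) (Nat.cast_nonneg _)
    set c : ℝ := (l.length : ℝ) ^ S with hc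
    -- The first sample divides the interval into pieces of lengths `A * w a`, to which the
    -- statement for `S` applies separately. A second induction, over the list, adds these pieces
    -- and their errors; this is why `L` and `A` are arbitrary.
    have main : ∀ l' : List α, (∀ a ∈ l', 0 ≤ w a) → ∀ L : ℝ, 0 ≤ L →
        L + A * (l'.map w).sum ≤ M →
        A * (l'.map fun a => w a * expect w Z l S fun z => if P (Z a + z) then 1 else 0).sum -
          l'.length * c ≤
        ((Finset.range M).filter fun k : ℕ => L ≤ k ∧ (k : ℝ) < L + A * (l'.map w).sum ∧
          P (Z (locate w l' ((k - L) / A)).1 + total w Z l S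
            ((locate w l' ((k - L) / A)).2 / w (locate w l' ((k - L) / A)).1))).card := by
      intro l'
      induction l' with
      | nil => intro _ L _ _; simp
      | cons a t iht =>
        intro hw' L hL hM
        have ha := hw' a (by simp)
        have ht : ∀ b ∈ t, 0 ≤ w b := fun b hb => hw' b (List.mem_cons_of_mem _ hb)
        have hts : 0 ≤ (t.map w).sum := List.sum_nonneg (by simpa using ht)
        have hAa : 0 ≤ A * w a := mul_nonneg hA ha
        have hAt : 0 ≤ A * (t.map w).sum := mul_nonneg hA hts
        rw [List.map_cons, List.sum_cons, mul_add] at hM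
        have i1 := ih (fun z => P (Z a + z)) hL hAa (by linarith)
        have i2 := iht ht (L + A * w a) (by linarith) (by linarith)
        simp only [List.map_cons, List.sum_cons, List.length_cons, mul_add]
        have hdis : Disjoint
            ((Finset.range M).filter fun k : ℕ => L ≤ k ∧ (k : ℝ) < L + A * w a ∧
              P (Z a + total w Z l S ((k - L) / (A * w a))))
            ((Finset.range M).filter fun k : ℕ => L + A * w a ≤ k ∧
              (k : ℝ) < L + A * w a + A * (t.map w).sum ∧
              P (Z (locate w t ((k - (L + A * w a)) / A)).1 + total w Z l S
                ((locate w t ((k - (L + A * w a)) / A)).2 /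
                  w (locate w t ((k - (L + A * w a)) / A)).1))) := by
          rw [Finset.disjoint_left]
          intro k hk hk'
          rw [Finset.mem_filter] at hk hk'
          linarith [hk.2.2.1, hk'.2.1]
        have hcard := Finset.card_union_of_disjoint hdis
        have hle : (((Finset.range M).filter fun k : ℕ => L ≤ k ∧ (k : ℝ) < L + A * w a ∧
              P (Z a + total w Z l S ((k - L) / (A * w a)))).card : ℝ) +
            ((Finset.range M).filter fun k : ℕ => L + A * w a ≤ k ∧
              (k : ℝ) < L + A * w a + A * (t.map w).sum ∧
              P (Z (locate w t ((k - (L + A * w a)) / A)).1 + total w Z l S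
                ((locate w t ((k - (L + A * w a)) / A)).2 /
                  w (locate w t ((k - (L + A * w a)) / A)).1))).card ≤
            ((Finset.range M).filter fun k : ℕ => L ≤ k ∧
              (k : ℝ) < L + (A * w a + A * (t.map w).sum) ∧
              P (Z (locate w (a :: t) ((k - L) / A)).1 + total w Z l S
                ((locate w (a :: t) ((k - L) / A)).2 /
                  w (locate w (a :: t) ((k - L) / A)).1))).card := by
          rw [← Nat.cast_add, ← hcard]
          refine Nat.cast_le.2 (Finset.card_le_card ?_)
          intro k hk
          rw [Finset.mem_union, Finset.mem_filter, Finset.mem_filter] at hk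
          rw [Finset.mem_filter]
          rcases hk with ⟨h0, h1, h2, h3⟩ | ⟨h0, h1, h2, h3⟩
          · have hlt : ((k : ℝ) - L) / A < w a := by
              rw [div_lt_iff₀ hA']
              linarith
            refine ⟨h0, h1, by linarith, ?_⟩
            rw [locate_cons_of_lt w hlt, div_div]
            exact h3
          · have hge : w a ≤ ((k : ℝ) - L) / A := by
              rw [le_div_iff₀ hA']
              linarith
            have hne : t ≠ [] := by
              rintro rfl
              simp only [List.map_nil, List.sum_nil, mul_zero, add_zero] at h2
              linarith
            refine ⟨h0, by linarith, by linarith, ?_⟩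
            have e : ((k : ℝ) - L) / A - w a = (k - (L + A * w a)) / A := by
              field_simp
              ring
            rw [locate_cons_of_le w hne hge, e]
            exact h3
        refine le_trans ?_ hle
        push_cast
        linarith
    have := main l hw L hL (by rw [hs, mul_one]; exact hM)
    rw [hs, mul_one] at this
    rw [expect, pow_succ, mul_comm (_ ^ S)]
    exact this

variable {w Z l}

theorem expect_mono (hw : ∀ a ∈ l, 0 ≤ w a) (S : ℕ) {f g : ℂ → ℝ} (h : ∀ z, f z ≤ g z) :
    expect w Z l S f ≤ expect w Z l S g := by
  induction S generalizing f g with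
  | zero => exact h 0
  | succ S ih =>
    exact List.sum_le_sum fun a ha =>
      mul_le_mul_of_nonneg_left (ih fun z => h _) (hw a ha)

theorem list_sum_affine (hs : (l.map w).sum = 1) (a b : ℝ) (f : α → ℝ) :
    (l.map fun i => w i * (a + b * f i)).sum = a + b * (l.map fun i => w i * f i).sum := by
  have : (l.map fun i => w i * (a + b * f i)).sum =
      (l.map w).sum * a + b * (l.map fun i => w i * f i).sum := by
    clear hs
    induction l with
    | nil => simp
    | cons i l ih => simp only [List.map_cons, List.sum_cons, ih]; ring
  rw [this, hs, one_mul]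

theorem expect_affine (hs : (l.map w).sum = 1) (S : ℕ) (a b : ℝ) (f : ℂ → ℝ) :
    expect w Z l S (fun z => a + b * f z) = a + b * expect w Z l S f := by
  induction S generalizing f with
  | zero => rfl
  | succ S ih =>
    simp only [expect]
    rw [← list_sum_affine hs a b]
    congr 1
    exact List.map_congr_left fun i _ => by rw [ih]

theorem sum_weight_mul_normSq_sub (hs : (l.map w).sum = 1) {μ : ℂ}
    (hμ : (l.map fun a => (w a : ℂ) * Z a).sum = μ) (c : ℂ) :
    (l.map fun a => w a * Complex.normSq (Z a - c)).sum =
      (l.map fun a => w a * Complex.normSq (Z a)).sum - Complex.normSq μ +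
        Complex.normSq (μ - c) := by
  have : ((l.map fun a => w a * Complex.normSq (Z a - c)).sum : ℝ) =
      (l.map fun a => w a * Complex.normSq (Z a)).sum -
        2 * ((l.map fun a => (w a : ℂ) * Z a).sum * (starRingEnd ℂ) c).re +
        (l.map w).sum * Complex.normSq c := by
    clear hs hμ
    induction l with
    | nil => simp
    | cons a l ih =>
      rw [List.map_cons, List.sum_cons, ih]
      simp only [List.map_cons, List.sum_cons, add_mul, Complex.add_re, mul_assoc,
        Complex.re_ofReal_mul, Complex.normSq_sub]
      ring
  rw [this, hs, hμ, Complex.normSq_sub]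
  ring

/-- Bias and variance of a sum of independent samples: the squared bias is that of the sum, and the
variances add. The free centre `c` absorbs the first sample in the induction. -/
theorem expect_normSq_sub (hs : (l.map w).sum = 1) {μ : ℂ}
    (hμ : (l.map fun a => (w a : ℂ) * Z a).sum = μ) (S : ℕ) (c : ℂ) :
    expect w Z l S (fun z => Complex.normSq (z - c)) = Complex.normSq (S * μ - c) +
      S * ((l.map fun a => w a * Complex.normSq (Z a)).sum - Complex.normSq μ) := by
  induction S generalizing c with
  | zero => simp [expect]
  | succ S ih =>
    have e : ∀ a, expect w Z l S (fun z => Complex.normSq (Z a + z - c)) =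
        S * ((l.map fun a => w a * Complex.normSq (Z a)).sum - Complex.normSq μ) +
          1 * Complex.normSq (Z a - (c - S * μ)) := by
      intro a
      rw [show (fun z => Complex.normSq (Z a + z - c)) =
        fun z => Complex.normSq (z - (c - Z a)) from funext fun z => by congr 1; ring, ih,
        show S * μ - (c - Z a) = Z a - (c - S * μ) by ring]
      ring
    simp only [expect, e]
    rw [list_sum_affine hs, sum_weight_mul_normSq_sub hs hμ,
      show μ - (c - S * μ) = ((S + 1 : ℕ) : ℂ) * μ - c by push_cast; ring]
    push_cast
    ring

open Classical in
/-- The weak law of large numbers. -/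
theorem le_expect_of_secondMoment_le (hw : ∀ a ∈ l, 0 ≤ w a) (hs : (l.map w).sum = 1) {μ : ℂ}
    (hμ : (l.map fun a => (w a : ℂ) * Z a).sum = μ)
    (h2 : (l.map fun a => w a * Complex.normSq (Z a)).sum ≤ 1) {S : ℕ} {δ : ℝ} (hδ : 0 < δ)
    (hS : 4 ≤ S * δ ^ 2) :
    3 / 4 ≤ expect w Z l S fun z => if ‖z / S - μ‖ ≤ δ then 1 else 0 := by
  have hS0 : (0 : ℝ) < S := by
    by_contra h
    have : (S : ℝ) * δ ^ 2 ≤ 0 := mul_nonpos_of_nonpos_of_nonneg (not_lt.1 h) (sq_nonneg δ)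
    linarith
  have hSδ : (0 : ℝ) < (S * δ) ^ 2 := by positivity
  -- Chebyshev's inequality in pointwise form: the indicator of a good sum dominates `1 - |z - S μ|²
  -- / (S δ)²`. The expectation of this bound is at least `1 - 1 / (S δ²)`, hence at least `3 / 4`.
  have h := expect_mono (Z := Z) hw S
    (f := fun z => 1 + -(1 / (S * δ) ^ 2) * Complex.normSq (z - S * μ))
    (g := fun z => if ‖z / S - μ‖ ≤ δ then 1 else 0) (fun z => by
      split_ifs with hz
      · have : 0 ≤ 1 / (S * δ) ^ 2 * Complex.normSq (z - S * μ) :=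
          mul_nonneg (by positivity) (Complex.normSq_nonneg _)
        linarith
      · rw [not_le] at hz
        have hS1 : (S : ℂ) ≠ 0 := by exact_mod_cast hS0.ne'
        have e : z / S - μ = (z - S * μ) / S := by field_simp
        rw [e, norm_div, Complex.norm_natCast, lt_div_iff₀ hS0] at hz
        have : (S * δ) ^ 2 ≤ Complex.normSq (z - S * μ) := by
          rw [Complex.normSq_eq_norm_sq]
          exact pow_le_pow_left₀ (by positivity) (by linarith) 2
        have : 1 ≤ 1 / (S * δ) ^ 2 * Complex.normSq (z - S * μ) := by
          rw [one_div, inv_mul_eq_div]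
          exact (one_le_div hSδ).2 this
        linarith)
  rw [expect_affine hs, expect_normSq_sub hs hμ, sub_self, map_zero, zero_add] at h
  refine le_trans ?_ h
  have h3 : (l.map fun a => w a * Complex.normSq (Z a)).sum - Complex.normSq μ ≤ 1 := by
    have := Complex.normSq_nonneg μ
    linarith
  have h4 : 1 / (S * δ) ^ 2 * (S * ((l.map fun a => w a * Complex.normSq (Z a)).sum -
      Complex.normSq μ)) ≤ 1 / 4 := by
    calc _ ≤ 1 / (S * δ) ^ 2 * (S * 1) := by gcongr
      _ = 1 / (S * δ ^ 2) := by field_simp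
      _ ≤ 1 / 4 := one_div_le_one_div_of_le (by norm_num) hS
  linarith

end Repeat

/-! ### Coins -/

/-- The number whose binary digits are the first `m` coin tosses. -/
def coinNat (ω : ℕ → Bool) : ℕ → ℕ
  | 0 => 0
  | m + 1 => coinNat ω m + (ω m).toNat * 2 ^ m

theorem coinNat_lt (ω : ℕ → Bool) (m : ℕ) : coinNat ω m < 2 ^ m := by
  induction m with
  | zero => simp [coinNat]
  | succ m ih =>
    have : (ω m).toNat * 2 ^ m ≤ 1 * 2 ^ m := Nat.mul_le_mul_right _ (Bool.toNat_le _)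
    rw [coinNat, pow_succ]
    omega

theorem coinNat_eq_mod {ω : ℕ → Bool} {k m : ℕ} (h : ∀ i < m, ω i = k.testBit i) :
    coinNat ω m = k % 2 ^ m := by
  induction m with
  | zero => simp [coinNat, Nat.mod_one]
  | succ m ih =>
    rw [coinNat, ih fun i hi => h i (by omega), h m (by omega), Nat.mod_pow_succ,
      Nat.testBit_eq_decide_div_mod_eq, mul_comm]
    rcases Nat.mod_two_eq_zero_or_one (k / 2 ^ m) with h' | h' <;> simp [h']

instance : IsProbabilityMeasure coinMeasure := by
  unfold coinMeasure; infer_instance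

theorem coinMeasure_cylinder (m k : ℕ) :
    coinMeasure.real {ω | ∀ i < m, ω i = k.testBit i} = (2 ^ m : ℝ)⁻¹ := by
  have h : {ω : ℕ → Bool | ∀ i < m, ω i = k.testBit i} =
      (↑(Finset.range m) : Set ℕ).pi fun i => {k.testBit i} := by
    ext ω; simp [Set.mem_pi]
  rw [measureReal_def, h, coinMeasure, Measure.infinitePi_pi _ fun i _ => measurableSet_singleton _]
  simp

-- Each admissible number contributes a cylinder of measure `2⁻ᵐ`, and these cylinders are disjoint.
-- Only an inclusion into the event is needed.
open Classical in
theorem card_div_le_coinMeasure (m : ℕ) (P : ℕ → Prop) :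
    (((Finset.range (2 ^ m)).filter P).card : ℝ) / 2 ^ m ≤
      coinMeasure.real {ω | P (coinNat ω m)} := by
  set C : ℕ → Set (ℕ → Bool) := fun k => {ω | ∀ i < m, ω i = k.testBit i} with hC
  have hdis : Set.PairwiseDisjoint (↑((Finset.range (2 ^ m)).filter P) : Set ℕ) C := by
    intro k hk k' hk' hne
    rw [Function.onFun, Set.disjoint_left]
    intro ω h1 h2
    simp only [Finset.coe_filter, Finset.mem_range, Set.mem_ofPred_eq] at hk hk'
    have e1 := coinNat_eq_mod h1
    have e2 := coinNat_eq_mod h2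
    rw [Nat.mod_eq_of_lt hk.1] at e1
    rw [Nat.mod_eq_of_lt hk'.1] at e2
    exact hne (e1.symm.trans e2)
  have hm : ∀ k, MeasurableSet (C k) := by
    intro k
    have : C k = (↑(Finset.range m) : Set ℕ).pi fun i => {k.testBit i} := by
      ext ω; simp [hC, Set.mem_pi]
    rw [this]
    exact MeasurableSet.pi (Finset.countable_toSet _) fun i _ => measurableSet_singleton _
  have hsub : (⋃ k ∈ (Finset.range (2 ^ m)).filter P, C k) ⊆ {ω | P (coinNat ω m)} := by
    intro ω hω
    simp only [Set.mem_iUnion, Finset.mem_filter, Finset.mem_range] at hω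
    obtain ⟨k, ⟨hk, hP⟩, h⟩ := hω
    have e := coinNat_eq_mod h
    rw [Nat.mod_eq_of_lt hk] at e
    rw [Set.mem_ofPred_eq, e]
    exact hP
  have h := measureReal_mono (μ := coinMeasure) hsub
  rw [measureReal_biUnion_finset hdis fun k _ => hm k] at h
  simp only [hC, coinMeasure_cylinder, Finset.sum_const, nsmul_eq_mul] at h
  rwa [div_eq_mul_inv]

open Classical in
/-- A sum of samples that are drawn by means of one random binary number is concentrated. -/
theorem le_coinMeasure_total {α : Type*} [Inhabited α] {w : α → ℝ} {Z : α → ℂ} {l : List α}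
    (hw : ∀ a ∈ l, 0 ≤ w a) (hs : (l.map w).sum = 1) {μ : ℂ}
    (hμ : (l.map fun a => (w a : ℂ) * Z a).sum = μ)
    (h2 : (l.map fun a => w a * Complex.normSq (Z a)).sum ≤ 1) {S n : ℕ} {δ : ℝ} (hδ : 0 < δ)
    (hS : 4 ≤ S * δ ^ 2) (hl : l.length ≤ 3 ^ n) :
    2 / 3 ≤ coinMeasure.real {ω | ‖total w Z l S
      ((coinNat ω (2 * n * S + 4) : ℝ) / 2 ^ (2 * n * S + 4)) / S - μ‖ ≤ δ} := by
  set m := 2 * n * S + 4 with hm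
  have h1 := card_div_le_coinMeasure m fun k =>
    ‖total w Z l S ((k : ℝ) / 2 ^ m) / S - μ‖ ≤ δ
  refine le_trans ?_ h1
  have h3 := sub_le_card_grid w Z l hw hs (2 ^ m) S (fun z => ‖z / S - μ‖ ≤ δ)
    (L := 0) (A := 2 ^ m) le_rfl (by positivity) (by simp)
  have h4 := le_expect_of_secondMoment_le hw hs hμ h2 hδ hS
  have e : ((Finset.range (2 ^ m)).filter fun k : ℕ => (0 : ℝ) ≤ k ∧ (k : ℝ) < 0 + 2 ^ m ∧
      ‖total w Z l S ((k - 0) / 2 ^ m) / S - μ‖ ≤ δ) =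
      (Finset.range (2 ^ m)).filter fun k : ℕ => ‖total w Z l S ((k : ℝ) / 2 ^ m) / S - μ‖ ≤ δ := by
    refine Finset.filter_congr fun k hk => ?_
    rw [Finset.mem_range] at hk
    have : (k : ℝ) < 2 ^ m := by exact_mod_cast hk
    simp only [Nat.cast_nonneg, zero_add, this, true_and, sub_zero]
  rw [e] at h3
  -- There are at most `3 ^ (n * S) ≤ 2 ^ (2 * n * S)` intervals, each losing at most one grid
  -- point. The four extra bits make the loss at most `1 / 16`, and `3 / 4 - 1 / 16 ≥ 2 / 3`.
  have h5 : (l.length : ℝ) ^ S * 16 ≤ 2 ^ m := by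
    have : l.length ^ S * 16 ≤ 2 ^ m := by
      calc l.length ^ S * 16 ≤ (3 ^ n) ^ S * 16 := by gcongr
        _ ≤ (4 ^ n) ^ S * 16 := by gcongr; norm_num
        _ = 2 ^ m := by
          rw [hm, pow_add, mul_assoc 2 n S, pow_mul 2 2 (n * S), ← pow_mul]
          norm_num
    exact_mod_cast this
  rw [le_div_iff₀ (by positivity)]
  have h6 : (2 : ℝ) ^ m * (3 / 4) ≤ 2 ^ m *
      expect w Z l S (fun z => if ‖z / S - μ‖ ≤ δ then 1 else 0) :=
    mul_le_mul_of_nonneg_left h4 (by positivity)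
  have h7 : (0 : ℝ) < 2 ^ m := by positivity
  linarith

end MeanValue

namespace MeanValue

open Matrix

/-! ### The memory image of a state vector -/

section Push

variable {V : Type} [Fintype V] [DecidableEq V] {w : ℕ}

/-- The image of a configuration in a memory of `w` bits. -/
def enc (slot : V → Fin w) (y : V → Fin 2) : Fin w → Fin 2 :=
  fun s => ∑ v, if slot v = s then y v else 0

/-- The image of a state vector in a memory of `w` bits. -/
noncomputable def push (slot : V → Fin w) (Ψ : (V → Fin 2) → ℂ) (σ : Fin w → Fin 2) : ℂ :=
  ∑ y, if enc slot y = σ then Ψ y else 0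

/-- The configurations that vanish outside of `B`. -/
def Conf (B : Set V) : Set (V → Fin 2) := {y | ∀ v, y v ≠ 0 → v ∈ B}

variable {slot : V → Fin w} {B : Set V}

/-- Many qubits may share a memory place, but on a configuration supported in `B` at most one of
them is nonzero. -/
theorem enc_apply_slot (hB : Set.InjOn slot B) {y : V → Fin 2} (hy : y ∈ Conf B) {v : V}
    (hv : v ∈ B) : enc slot y (slot v) = y v := by
  unfold enc
  rw [Finset.sum_eq_single v]
  · simp
  · intro u _ hu
    split_ifs with h
    · by_contra h0
      exact hu (hB (hy u h0) hv h)
    · rfl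
  · simp

theorem enc_apply_of_notMem {y : V → Fin 2} (hy : y ∈ Conf B) {s : Fin w}
    (hs : ∀ v ∈ B, slot v ≠ s) : enc slot y s = 0 := by
  unfold enc
  refine Finset.sum_eq_zero fun v _ => ?_
  split_ifs with h
  · by_contra h0
    exact hs v (hy v h0) h
  · rfl

theorem enc_injOn (hB : Set.InjOn slot B) : Set.InjOn (enc slot) (Conf B) := by
  intro y hy y' hy' h
  ext1 v
  by_cases hv : v ∈ B
  · rw [← enc_apply_slot hB hy hv, h, enc_apply_slot hB hy' hv]
  · have h1 : y v = 0 := by by_contra h0; exact hv (hy v h0)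
    have h2 : y' v = 0 := by by_contra h0; exact hv (hy' v h0)
    rw [h1, h2]

theorem update_mem_conf {y : V → Fin 2} (hy : y ∈ Conf B) {v : V} (hv : v ∈ B) (b : Fin 2) :
    Function.update y v b ∈ Conf B := by
  intro u hu
  by_cases h : u = v
  · rw [h]; exact hv
  · rw [Function.update_of_ne h] at hu; exact hy u hu

theorem enc_update (hB : Set.InjOn slot B) {y : V → Fin 2} (hy : y ∈ Conf B) {v : V}
    (hv : v ∈ B) (b : Fin 2) :
    enc slot (Function.update y v b) = Function.update (enc slot y) (slot v) b := by
  ext1 s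
  by_cases hs : ∃ u ∈ B, slot u = s
  · obtain ⟨u, hu, rfl⟩ := hs
    rw [enc_apply_slot hB (update_mem_conf hy hv b) hu]
    by_cases huv : u = v
    · subst huv; simp
    · rw [Function.update_of_ne huv, Function.update_of_ne fun e => huv (hB hu hv e),
        enc_apply_slot hB hy hu]
  · push Not at hs
    rw [enc_apply_of_notMem (update_mem_conf hy hv b) hs,
      Function.update_of_ne (hs v hv).symm, enc_apply_of_notMem hy hs]

theorem push_enc (hB : Set.InjOn slot B) {Ψ : (V → Fin 2) → ℂ} (hΨ : ∀ y, Ψ y ≠ 0 → y ∈ Conf B)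
    {y : V → Fin 2} (hy : y ∈ Conf B) : push slot Ψ (enc slot y) = Ψ y := by
  unfold push
  rw [Finset.sum_eq_single y]
  · simp
  · intro y' _ hne
    split_ifs with h
    · by_contra h0
      exact hne (enc_injOn hB (hΨ y' h0) hy h)
    · rfl
  · simp

theorem push_eq_zero {Ψ : (V → Fin 2) → ℂ} (hΨ : ∀ y, Ψ y ≠ 0 → y ∈ Conf B) {σ : Fin w → Fin 2}
    (hσ : σ ∉ enc slot '' Conf B) : push slot Ψ σ = 0 := by
  unfold push
  refine Finset.sum_eq_zero fun y _ => ?_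
  split_ifs with h
  · by_contra h0
    exact hσ ⟨y, hΨ y h0, h⟩
  · rfl

theorem update_mem_image_iff (hB : Set.InjOn slot B) {v : V} (hv : v ∈ B) (b : Fin 2)
    {σ : Fin w → Fin 2} :
    Function.update σ (slot v) b ∈ enc slot '' Conf B ↔ σ ∈ enc slot '' Conf B := by
  constructor
  · rintro ⟨y, hy, h⟩
    refine ⟨_, update_mem_conf hy hv (σ (slot v)), ?_⟩
    rw [enc_update hB hy hv, h, Function.update_idem, Function.update_eq_self]
  · rintro ⟨y, hy, rfl⟩
    exact ⟨_, update_mem_conf hy hv b, enc_update hB hy hv b⟩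

theorem site_supp {Ψ : (V → Fin 2) → ℂ} (hΨ : ∀ y, Ψ y ≠ 0 → y ∈ Conf B) {v : V} (hv : v ∈ B)
    (M : Matrix (Fin 2) (Fin 2) ℂ) : ∀ y, (site v M *ᵥ Ψ) y ≠ 0 → y ∈ Conf B := by
  intro y hy
  rw [site_mulVec] at hy
  obtain ⟨b, -, hb⟩ := Finset.exists_ne_zero_of_sum_ne_zero hy
  have := update_mem_conf (hΨ _ (right_ne_zero_of_mul hb)) hv (y v)
  rwa [Function.update_idem, Function.update_eq_self] at this

/-- On the image of `Conf B` the encoding is a bijection compatible with updates at places of qubits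
in `B`. Off the image both sides vanish, because changing such a place does not lead into the image.
-/
theorem push_site (hB : Set.InjOn slot B) {Ψ : (V → Fin 2) → ℂ}
    (hΨ : ∀ y, Ψ y ≠ 0 → y ∈ Conf B) {v : V} (hv : v ∈ B) (M : Matrix (Fin 2) (Fin 2) ℂ)
    (σ : Fin w → Fin 2) :
    push slot (site v M *ᵥ Ψ) σ =
      ∑ b, M (σ (slot v)) b * push slot Ψ (Function.update σ (slot v) b) := by
  by_cases hσ : σ ∈ enc slot '' Conf B
  · obtain ⟨y, hy, rfl⟩ := hσ
    rw [push_enc hB (site_supp hΨ hv M) hy, site_mulVec]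
    refine Finset.sum_congr rfl fun b _ => ?_
    rw [enc_apply_slot hB hy hv, ← enc_update hB hy hv, push_enc hB hΨ (update_mem_conf hy hv b)]
  · rw [push_eq_zero (site_supp hΨ hv M) hσ]
    symm
    refine Finset.sum_eq_zero fun b _ => ?_
    rw [push_eq_zero hΨ, mul_zero]
    rwa [update_mem_image_iff hB hv]

theorem push_pair (hB : Set.InjOn slot B) {Ψ : (V → Fin 2) → ℂ}
    (hΨ : ∀ y, Ψ y ≠ 0 → y ∈ Conf B) {u v : V} (huv : u ≠ v) (hu : u ∈ B) (hv : v ∈ B)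
    (M : Matrix (Fin 2 × Fin 2) (Fin 2 × Fin 2) ℂ) (σ : Fin w → Fin 2) :
    push slot (pair u v M *ᵥ Ψ) σ =
      ∑ b, M (σ (slot u), σ (slot v)) b *
        push slot Ψ (Function.update (Function.update σ (slot u) b.1) (slot v) b.2) := by
  have hs : ∀ y, (pair u v M *ᵥ Ψ) y ≠ 0 → y ∈ Conf B := by
    intro y hy
    rw [pair_mulVec huv] at hy
    obtain ⟨b, -, hb⟩ := Finset.exists_ne_zero_of_sum_ne_zero hy
    have := update_mem_conf (update_mem_conf (hΨ _ (right_ne_zero_of_mul hb)) hv (y v)) hu (y u)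
    rwa [Function.update_idem, Function.update_comm huv.symm, Function.update_idem,
      Function.update_eq_self, Function.update_eq_self] at this
  by_cases hσ : σ ∈ enc slot '' Conf B
  · obtain ⟨y, hy, rfl⟩ := hσ
    rw [push_enc hB hs hy, pair_mulVec huv]
    refine Finset.sum_congr rfl fun b _ => ?_
    have hy' := update_mem_conf hy hu b.1
    rw [enc_apply_slot hB hy hu, enc_apply_slot hB hy hv, ← enc_update hB hy hu,
      ← enc_update hB hy' hv, push_enc hB hΨ (update_mem_conf hy' hv b.2)]
  · rw [push_eq_zero hs hσ]
    symm
    refine Finset.sum_eq_zero fun b _ => ?_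
    rw [push_eq_zero hΨ, mul_zero]
    rwa [update_mem_image_iff hB hv, update_mem_image_iff hB hu]

/-- No two configurations in the support collide in memory, so the probabilities may be computed
from the image. -/
theorem nsq_push (hB : Set.InjOn slot B) {Ψ : (V → Fin 2) → ℂ}
    (hΨ : ∀ y, Ψ y ≠ 0 → y ∈ Conf B) : nsq (push slot Ψ) = nsq Ψ := by
  have key : ∀ σ, Complex.normSq (push slot Ψ σ) =
      ∑ y, if enc slot y = σ then Complex.normSq (Ψ y) else 0 := by
    intro σ
    by_cases hσ : σ ∈ enc slot '' Conf B
    · obtain ⟨y, hy, rfl⟩ := hσ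
      rw [push_enc hB hΨ hy, Finset.sum_eq_single y]
      · simp
      · intro y' _ hne
        split_ifs with h
        · rw [Complex.normSq_eq_zero]
          by_contra h0
          exact hne (enc_injOn hB (hΨ y' h0) hy h)
        · rfl
      · simp
    · rw [push_eq_zero hΨ hσ, map_zero]
      symm
      refine Finset.sum_eq_zero fun y _ => ?_
      split_ifs with h
      · rw [Complex.normSq_eq_zero]
        by_contra h0
        exact hσ ⟨y, hΨ y h0, h⟩
      · rfl
  unfold nsq
  simp only [key]
  rw [Finset.sum_comm]
  simp

theorem push_single (slot : V → Fin w) :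
    push slot (Pi.single (fun _ => 0) 1) = Pi.single (fun _ => 0) 1 := by
  ext σ
  unfold push
  rw [Finset.sum_eq_single (fun _ => 0)]
  · have : enc slot (fun _ => 0) = fun _ => 0 := by ext1 s; simp [enc]
    rw [this]
    by_cases h : σ = fun _ => 0
    · subst h; simp
    · rw [if_neg (Ne.symm h), Pi.single_eq_of_ne h]
  · intro y _ hy
    rw [Pi.single_eq_of_ne hy, ite_self]
  · simp

/-- A vector that is supported on `0` can be read off from its image. -/
theorem push_zero_of_supp {Ψ : (V → Fin 2) → ℂ} (hΨ : ∀ y, Ψ y ≠ 0 → y ∈ Conf (∅ : Set V)) :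
    push slot Ψ (fun _ => 0) = Ψ fun _ => 0 := by
  have h := push_enc (slot := slot) (B := ∅) (Set.injOn_empty _) hΨ (y := fun _ => 0)
    (fun v hv => absurd rfl hv)
  have : enc slot (fun _ => 0) = fun _ => 0 := by ext1 s; simp [enc]
  rwa [this] at h

/-- The number of a memory configuration. -/
def code (σ : Fin w → Fin 2) : ℕ := finFunctionFinEquiv σ

theorem code_lt (σ : Fin w → Fin 2) : code σ < 2 ^ w := (finFunctionFinEquiv σ).2

theorem exists_code {k : ℕ} (h : k < 2 ^ w) : ∃ σ : Fin w → Fin 2, code σ = k :=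
  ⟨finFunctionFinEquiv.symm ⟨k, h⟩, by simp [code]⟩

theorem code_injective : Function.Injective (code : (Fin w → Fin 2) → ℕ) := fun _ _ h =>
  finFunctionFinEquiv.injective (Fin.ext h)

theorem code_div_mod (σ : Fin w → Fin 2) (s : Fin w) :
    code σ / 2 ^ (s : ℕ) % 2 = σ s := by
  have h : finFunctionFinEquiv.symm (finFunctionFinEquiv σ) s = σ s := by simp
  rw [← h]
  rfl

theorem code_eq_sum (σ : Fin w → Fin 2) : code σ = ∑ s, (σ s : ℕ) * 2 ^ (s : ℕ) :=
  finFunctionFinEquiv_apply σ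

theorem code_update (σ : Fin w → Fin 2) (s : Fin w) (b : Fin 2) :
    code (Function.update σ s b) = code σ - σ s * 2 ^ (s : ℕ) + b * 2 ^ (s : ℕ) := by
  rw [code_eq_sum, code_eq_sum, ← Finset.add_sum_erase _ _ (Finset.mem_univ s),
    ← Finset.add_sum_erase Finset.univ (fun t => (σ t : ℕ) * 2 ^ (t : ℕ)) (Finset.mem_univ s),
    Function.update_self, Nat.add_sub_cancel_left, add_comm]
  congr 1
  refine Finset.sum_congr rfl fun t ht => ?_
  rw [Function.update_of_ne (Finset.ne_of_mem_erase ht)]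

theorem code_zero : code (fun _ => 0 : Fin w → Fin 2) = 0 := by
  rw [code_eq_sum]; simp

theorem sum_range_code {M : Type*} [AddCommMonoid M] (f : ℕ → M) :
    ∑ k ∈ Finset.range (2 ^ w), f k = ∑ σ : Fin w → Fin 2, f (code σ) := by
  rw [Finset.sum_range, ← Equiv.sum_comp (finFunctionFinEquiv (m := 2) (n := w))]
  rfl

end Push

end MeanValue

namespace MeanValue

/-! ### Reasoning about programs -/

/-- The integer arrays that a program may change. -/
def Cmd.iw : Cmd → List ℕ
  | .skip => []
  | .istore a _ _ => [a]
  | .cstore _ _ _ => []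
  | .flip a _ => [a]
  | .seq p q => p.iw ++ q.iw
  | .ite _ p q => p.iw ++ q.iw
  | .loop _ p => p.iw

/-- The complex arrays that a program may change. -/
def Cmd.cw : Cmd → List ℕ
  | .skip => []
  | .istore _ _ _ => []
  | .cstore a _ _ => [a]
  | .flip _ _ => []
  | .seq p q => p.cw ++ q.cw
  | .ite _ p q => p.cw ++ q.cw
  | .loop _ p => p.cw

/-- The program tosses no coins. -/
def Cmd.coinFree : Cmd → Bool
  | .skip => true
  | .istore _ _ _ => true
  | .cstore _ _ _ => true
  | .flip _ _ => false
  | .seq p q => p.coinFree && q.coinFree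
  | .ite _ p q => p.coinFree && q.coinFree
  | .loop _ p => p.coinFree

/-- The states agree except for the integer arrays in `A` and the complex arrays in `C`. -/
structure Frame (A C : List ℕ) (s s' : State) : Prop where
  imem : ∀ a, a ∉ A → s'.imem a = s.imem a
  cmem : ∀ a, a ∉ C → s'.cmem a = s.cmem a

theorem Frame.refl (A C : List ℕ) (s : State) : Frame A C s s := ⟨fun _ _ => rfl, fun _ _ => rfl⟩

theorem Frame.trans {A C A' C' : List ℕ} {s s' s'' : State} (h : Frame A C s s')
    (h' : Frame A' C' s' s'') : Frame (A ++ A') (C ++ C') s s'' where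
  imem a ha := by
    rw [List.mem_append, not_or] at ha
    rw [h'.imem a ha.2, h.imem a ha.1]
  cmem a ha := by
    rw [List.mem_append, not_or] at ha
    rw [h'.cmem a ha.2, h.cmem a ha.1]

theorem Frame.mono {A C A' C' : List ℕ} {s s' : State} (h : Frame A C s s') (hA : A ⊆ A')
    (hC : C ⊆ C') : Frame A' C' s s' :=
  ⟨fun a ha => h.imem a fun h' => ha (hA h'), fun a ha => h.cmem a fun h' => ha (hC h')⟩

theorem State.imem_setI (s : State) (a i k b : ℕ) :
    (s.setI a i k).imem b = if b = a then Function.update (s.imem a) i k else s.imem b := by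
  unfold State.setI
  by_cases h : b = a
  · subst h; simp
  · simp [h]

theorem State.cmem_setC (s : State) (a i : ℕ) (z : ℂ) (b : ℕ) :
    (s.setC a i z).cmem b = if b = a then Function.update (s.cmem a) i z else s.cmem b := by
  unfold State.setC
  by_cases h : b = a
  · subst h; simp
  · simp [h]

@[simp] theorem State.cmem_setI (s : State) (a i k : ℕ) : (s.setI a i k).cmem = s.cmem := rfl
@[simp] theorem State.imem_setC (s : State) (a i : ℕ) (z : ℂ) : (s.setC a i z).imem = s.imem := rfl
@[simp] theorem State.coins_setI (s : State) (a i k : ℕ) : (s.setI a i k).coins = s.coins := rfl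
@[simp] theorem State.coins_setC (s : State) (a i : ℕ) (z : ℂ) :
    (s.setC a i z).coins = s.coins := rfl

theorem State.setI_same (s : State) (a i k : ℕ) :
    (s.setI a i k).imem a = Function.update (s.imem a) i k := by
  rw [State.imem_setI, if_pos rfl]

theorem State.setI_ne (s : State) {a b : ℕ} (i k : ℕ) (h : b ≠ a) :
    (s.setI a i k).imem b = s.imem b := by
  rw [State.imem_setI, if_neg h]

theorem Exec.frame {p : Cmd} {s s' : State} {t : ℕ} (h : Exec p s s' t) :
    Frame p.iw p.cw s s' := by
  induction h with
  | skip s => exact Frame.refl _ _ _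
  | istore s a i e =>
    exact ⟨fun b hb => s.setI_ne _ _ (by simpa [Cmd.iw] using hb), fun _ _ => rfl⟩
  | cstore s a i e =>
    refine ⟨fun _ _ => rfl, fun b hb => ?_⟩
    rw [State.cmem_setC, if_neg (by simpa [Cmd.cw] using hb)]
  | flip s a i =>
    exact ⟨fun b hb => State.setI_ne _ _ _ (by simpa [Cmd.iw] using hb), fun _ _ => rfl⟩
  | seq _ _ h₁ h₂ => exact h₁.trans h₂
  | ite_true _ _ h => exact h.mono (List.subset_append_left _ _) (List.subset_append_left _ _)
  | ite_false _ _ h => exact h.mono (List.subset_append_right _ _) (List.subset_append_right _ _)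
  | loop_done _ => exact Frame.refl _ _ _
  | loop_step _ _ _ h₁ h₂ =>
    exact (h₁.trans h₂).mono (by simp [Cmd.iw]) (by simp [Cmd.cw])

theorem Exec.coins_eq {p : Cmd} {s s' : State} {t : ℕ} (h : Exec p s s' t)
    (hp : p.coinFree = true) : s'.coins = s.coins := by
  induction h with
  | skip | istore | cstore | loop_done => rfl
  | flip => simp [Cmd.coinFree] at hp
  | seq _ _ h₁ h₂ =>
    simp only [Cmd.coinFree, Bool.and_eq_true] at hp
    rw [h₂ hp.2, h₁ hp.1]
  | ite_true _ _ h =>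
    simp only [Cmd.coinFree, Bool.and_eq_true] at hp
    exact h hp.1
  | ite_false _ _ h =>
    simp only [Cmd.coinFree, Bool.and_eq_true] at hp
    exact h hp.2
  | loop_step _ _ _ h₁ h₂ => rw [h₂ hp, h₁ hp]

/-- The program `p`, started in `s`, halts after at most `T` steps in a state that satisfies
`Q`. -/
def Runs (p : Cmd) (s : State) (T : ℕ) (Q : State → Prop) : Prop :=
  ∃ s' t, Exec p s s' t ∧ t ≤ T ∧ Q s'

theorem Runs.mono {p : Cmd} {s : State} {T T' : ℕ} {Q Q' : State → Prop} (h : Runs p s T Q)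
    (hT : T ≤ T') (hQ : ∀ s', Q s' → Q' s') : Runs p s T' Q' := by
  obtain ⟨s', t, he, ht, hq⟩ := h
  exact ⟨s', t, he, ht.trans hT, hQ s' hq⟩

/-- Everything that a program does not write stays the same. -/
theorem Runs.frame {p : Cmd} {s : State} {T : ℕ} {Q : State → Prop} (h : Runs p s T Q) :
    Runs p s T fun s' => Q s' ∧ Frame p.iw p.cw s s' ∧ (p.coinFree = true → s'.coins = s.coins) := by
  obtain ⟨s', t, he, ht, hq⟩ := h
  exact ⟨s', t, he, ht, hq, he.frame, he.coins_eq⟩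

theorem Runs.skip {s : State} {Q : State → Prop} (h : Q s) : Runs .skip s 1 Q :=
  ⟨s, 1, .skip s, le_rfl, h⟩

theorem Runs.istore {s : State} {a : ℕ} {i e : IExp} {Q : State → Prop}
    (h : Q (s.setI a (i.eval s) (e.eval s))) : Runs (.istore a i e) s (i.cost + e.cost + 1) Q :=
  ⟨_, _, .istore s a i e, le_rfl, h⟩

theorem Runs.cstore {s : State} {a : ℕ} {i : IExp} {e : CExp} {Q : State → Prop}
    (h : Q (s.setC a (i.eval s) (e.eval s))) : Runs (.cstore a i e) s (i.cost + e.cost + 1) Q :=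
  ⟨_, _, .cstore s a i e, le_rfl, h⟩

theorem Runs.flip {s : State} {a : ℕ} {i : IExp} {Q : State → Prop}
    (h : Q (s.dropCoin.setI a (i.eval s) (s.coins 0).toNat)) :
    Runs (.flip a i) s (i.cost + 1) Q :=
  ⟨_, _, .flip s a i, le_rfl, h⟩

theorem Runs.seq {p q : Cmd} {s : State} {T T' : ℕ} {Q : State → Prop}
    (h : Runs p s T fun s' => Runs q s' T' Q) : Runs (.seq p q) s (T + T') Q := by
  obtain ⟨s', t, he, ht, s'', t', he', ht', hq⟩ := h
  exact ⟨s'', t + t', .seq he he', Nat.add_le_add ht ht', hq⟩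

theorem Runs.ite {b : BExp} {p q : Cmd} {s : State} {T : ℕ} {Q : State → Prop}
    (h₁ : b.eval s → Runs p s T Q) (h₂ : ¬ b.eval s → Runs q s T Q) :
    Runs (.ite b p q) s (b.cost + T) Q := by
  by_cases hb : b.eval s
  · obtain ⟨s', t, he, ht, hq⟩ := h₁ hb
    exact ⟨s', _, .ite_true hb he, Nat.add_le_add_left ht _, hq⟩
  · obtain ⟨s', t, he, ht, hq⟩ := h₂ hb
    exact ⟨s', _, .ite_false hb he, Nat.add_le_add_left ht _, hq⟩

/-! ### Expressions -/

instance : Add IExp := ⟨.add⟩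
instance : Sub IExp := ⟨.sub⟩
instance : Mul IExp := ⟨.mul⟩
instance (k : ℕ) : OfNat IExp k := ⟨.lit k⟩
instance : Add CExp := ⟨.add⟩
instance : Sub CExp := ⟨.sub⟩
instance : Mul CExp := ⟨.mul⟩
instance : Div CExp := ⟨.div⟩
instance (k : ℕ) : OfNat CExp k := ⟨.cast (.lit k)⟩

/-- The integer variable `a`. -/
abbrev iv (a : ℕ) : IExp := .load a 0

/-- The complex variable `a`. -/
abbrev cv (a : ℕ) : CExp := .load a 0

/-- The test `e < f`. -/
abbrev ltE (e f : IExp) : BExp := .ile (e + 1) f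

/-- The indicator of `m ≤ e`. -/
abbrev geE (m e : IExp) : IExp := 1 - (1 - (e + 1 - m))

/-- An assignment to the integer variable `a`. -/
abbrev iset (a : ℕ) (e : IExp) : Cmd := .istore a 0 e

/-- An assignment to the complex variable `a`. -/
abbrev cset (a : ℕ) (e : CExp) : Cmd := .cstore a 0 e

/-- The loop in which the variable `i` runs from `0` to the value of the variable `b`. -/
def forLoop (i b : ℕ) (p : Cmd) : Cmd :=
  .seq (iset i 0) (.loop (ltE (iv i) (iv b)) (.seq p (iset i (iv i + 1))))

section Eval

variable (s : State)

@[simp] theorem IExp.eval_ofNat (k : ℕ) : (no_index (OfNat.ofNat k : IExp)).eval s = (OfNat.ofNat k : ℕ) := rfl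
@[simp] theorem IExp.eval_add (e f : IExp) : (e + f).eval s = e.eval s + f.eval s := rfl
@[simp] theorem IExp.eval_sub (e f : IExp) : (e - f).eval s = e.eval s - f.eval s := rfl
@[simp] theorem IExp.eval_mul (e f : IExp) : (e * f).eval s = e.eval s * f.eval s := rfl
@[simp] theorem IExp.eval_load (a : ℕ) (e : IExp) :
    (IExp.load a e).eval s = s.imem a (e.eval s) := rfl
@[simp] theorem IExp.eval_lit (k : ℕ) : (IExp.lit k).eval s = k := rfl
@[simp] theorem CExp.eval_ofNat (k : ℕ) : (no_index (OfNat.ofNat k : CExp)).eval s = ((OfNat.ofNat k : ℕ) : ℂ) := rfl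
@[simp] theorem CExp.eval_add (e f : CExp) : (e + f).eval s = e.eval s + f.eval s := rfl
@[simp] theorem CExp.eval_sub (e f : CExp) : (e - f).eval s = e.eval s - f.eval s := rfl
@[simp] theorem CExp.eval_mul (e f : CExp) : (e * f).eval s = e.eval s * f.eval s := rfl
@[simp] theorem CExp.eval_div (e f : CExp) : (e / f).eval s = e.eval s / f.eval s := rfl
@[simp] theorem CExp.eval_cast (e : IExp) : (CExp.cast e).eval s = (e.eval s : ℂ) := rfl
@[simp] theorem CExp.eval_conj (e : CExp) :
    (CExp.conj e).eval s = (starRingEnd ℂ) (e.eval s) := rfl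
@[simp] theorem CExp.eval_load (a : ℕ) (e : IExp) :
    (CExp.load a e).eval s = s.cmem a (e.eval s) := rfl
@[simp] theorem BExp.eval_ile (e f : IExp) : (BExp.ile e f).eval s ↔ e.eval s ≤ f.eval s := Iff.rfl
@[simp] theorem BExp.eval_cle (e f : CExp) :
    (BExp.cle e f).eval s ↔ (e.eval s).re ≤ (f.eval s).re := Iff.rfl
@[simp] theorem BExp.eval_not (b : BExp) : (BExp.not b).eval s ↔ ¬ b.eval s := Iff.rfl
@[simp] theorem BExp.eval_and (b c : BExp) :
    (BExp.and b c).eval s ↔ b.eval s ∧ c.eval s := Iff.rfl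

end Eval

@[simp] theorem forLoop_iw (i b : ℕ) (p : Cmd) : (forLoop i b p).iw = i :: (p.iw ++ [i]) := rfl
@[simp] theorem forLoop_cw (i b : ℕ) (p : Cmd) : (forLoop i b p).cw = p.cw := by
  simp [forLoop, Cmd.cw]
@[simp] theorem forLoop_coinFree (i b : ℕ) (p : Cmd) :
    (forLoop i b p).coinFree = p.coinFree := by
  simp [forLoop, Cmd.coinFree]

/-- The rule for loops. The invariant `I k` holds before the iteration `k`. -/
theorem Runs.forLoop {i b : ℕ} {p : Cmd} {s₀ : State} {n T : ℕ} (hn : s₀.imem b 0 = n)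
    (hib : b ≠ i) (hi : i ∉ p.iw) (hb : b ∉ p.iw) (I : ℕ → State → Prop)
    (h0 : I 0 (s₀.setI i 0 0))
    (hs : ∀ k < n, ∀ s, Frame (i :: p.iw) p.cw s₀ s → s.imem i 0 = k → I k s →
      Runs p s T fun s' => I (k + 1) (s'.setI i 0 (k + 1))) :
    Runs (MeanValue.forLoop i b p) s₀ (10 + n * (T + 13)) (I n) := by
  have main : ∀ m k s, k + m = n → Frame (i :: p.iw) p.cw s₀ s → s.imem i 0 = k → I k s →
      Runs (.loop (ltE (iv i) (iv b)) (.seq p (iset i (iv i + 1)))) s (7 + m * (T + 13)) (I n) := by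
    intro m
    induction m with
    | zero =>
      intro k s hk hf hik hI
      have hbs : s.imem b 0 = n := by rw [hf.imem b (by simp [hib, hb]), hn]
      refine ⟨s, _, .loop_done (by simp [hik, hbs]; omega), ?_, ?_⟩
      · exact Nat.le_add_right _ _
      · rw [← hk]; exact hI
    | succ m ih =>
      intro k s hk hf hik hI
      have hbs : s.imem b 0 = n := by rw [hf.imem b (by simp [hib, hb]), hn]
      obtain ⟨s', t, he, ht, hI'⟩ := hs k (by omega) s hf hik hI
      have hf' := he.frame
      have hik' : s'.imem i 0 = k := by rw [hf'.imem i hi, hik]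
      obtain ⟨s'', t', he', ht', hq⟩ := ih (k + 1) (s'.setI i 0 (k + 1)) (by omega)
        ⟨fun a ha => by
          rw [List.mem_cons, not_or] at ha
          rw [State.setI_ne _ _ _ ha.1, hf'.imem a ha.2, hf.imem a (by simp [ha])],
         fun a ha => by rw [State.cmem_setI, hf'.cmem a ha, hf.cmem a ha]⟩
        (by rw [State.setI_same]; simp) hI'
      have hst := Exec.istore s' i 0 (iv i + 1)
      simp only [IExp.eval_ofNat, IExp.eval_add, IExp.eval_load, hik'] at hst
      refine ⟨s'', _, .loop_step (by simp [hik, hbs]; omega) (.seq he hst) he', ?_, hq⟩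
      -- The overhead `13` of an iteration is this test and the increment; the constant `10` in the
      -- statement is the initialization, of cost `3`, and the last test.
      have c1 : (ltE (iv i) (iv b)).cost = 7 := rfl
      have c2 : (0 : IExp).cost + (iv i + 1).cost + 1 = 6 := rfl
      rw [c1, c2, add_mul, one_mul]
      omega
  have hf0 : Frame (i :: p.iw) p.cw s₀ (s₀.setI i 0 0) :=
    ⟨fun a ha => State.setI_ne _ _ _ (by simp at ha; exact ha.1), fun _ _ => rfl⟩
  have := main n 0 (s₀.setI i 0 0) (by omega) hf0 (by rw [State.setI_same]; simp) h0
  refine (Runs.seq (T := 3) (T' := 7 + n * (T + 13)) ⟨_, _, .istore s₀ i 0 0, le_rfl, this⟩).mono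
    (by omega) fun _ h => h

/-- Filling an integer array by a recurrence. -/
theorem Runs.fillI {i b a : ℕ} {e : IExp} {s₀ : State} {n : ℕ} (hn : s₀.imem b 0 = n)
    (hib : b ≠ i) (hia : a ≠ i) (hba : b ≠ a) (f : ℕ → ℕ)
    (hf : ∀ k < n, ∀ s, Frame [i, a] [] s₀ s → s.imem i 0 = k →
      (∀ k' < k, s.imem a k' = f k') → e.eval s = f k) :
    Runs (MeanValue.forLoop i b (.istore a (iv i) e)) s₀ (10 + n * (e.cost + 16)) fun s' =>
      ∀ k < n, s'.imem a k = f k := by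
  refine (Runs.forLoop (T := e.cost + 3) hn hib (by simpa [Cmd.iw] using hia.symm)
    (by simpa [Cmd.iw] using hba) (fun k s => ∀ k' < k, s.imem a k' = f k') (by simp) ?_).mono
    (by simp only [Nat.add_assoc]; exact le_rfl) fun _ h => h
  intro k hk s hs hik hI
  refine (Runs.istore ?_).mono (by simp only [IExp.cost]; omega)
    fun _ h => h
  intro k' hk'
  rw [State.setI_ne _ _ _ hia, State.setI_same]
  simp only [IExp.eval_load, IExp.eval_ofNat, hik]
  by_cases h : k' = k
  · subst h
    rw [Function.update_self, hf k' hk s hs hik hI]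
  · rw [Function.update_of_ne h]
    exact hI k' (by omega)

/-- Filling a complex array. -/
theorem Runs.fillC {i b a : ℕ} {e : CExp} {s₀ : State} {n : ℕ} (hn : s₀.imem b 0 = n)
    (hib : b ≠ i) (f : ℕ → ℂ)
    (hf : ∀ k < n, ∀ s, Frame [i] [a] s₀ s → s.imem i 0 = k → e.eval s = f k) :
    Runs (MeanValue.forLoop i b (.cstore a (iv i) e)) s₀ (10 + n * (e.cost + 16)) fun s' =>
      ∀ k < n, s'.cmem a k = f k := by
  refine (Runs.forLoop (T := e.cost + 3) hn hib (by simp [Cmd.iw])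
    (by simp [Cmd.iw]) (fun k s => ∀ k' < k, s.cmem a k' = f k') (by simp) ?_).mono
    (by simp only [Nat.add_assoc]; exact le_rfl) fun _ h => h
  intro k hk s hs hik hI
  refine (Runs.cstore ?_).mono (by simp only [IExp.cost]; omega)
    fun _ h => h
  intro k' hk'
  rw [State.cmem_setI, State.cmem_setC, if_pos rfl]
  simp only [IExp.eval_load, IExp.eval_ofNat, hik]
  by_cases h : k' = k
  · subst h
    rw [Function.update_self, hf k' hk s hs hik]
  · rw [Function.update_of_ne h]
    exact hI k' (by omega)

end MeanValue

namespace MeanValue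

/-! ### Cutting a grid into strips -/

/-- The side lengths of a grid and the depth of a circuit. -/
structure Dims where
  a : ℕ
  b : ℕ
  c : ℕ
  d : ℕ

namespace Dims

variable (D : Dims)

/-- The number of qubits. -/
abbrev n : ℕ := D.a * D.b * D.c
/-- The number of rows of a strip. -/
abbrev H : ℕ := 4 * D.d + 2
/-- The number of qubits in a column of a strip. -/
abbrev L : ℕ := D.H * D.c
/-- The number of bits of the memory. -/
abbrev w : ℕ := (4 * D.d + 4) * D.L
/-- The number of time steps. -/
abbrev F : ℕ := 2 * D.d + 2
/-- The number of steps of a sweep. -/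
abbrev J : ℕ := (D.a * D.b + 4 * D.d + 2) * D.F * D.L

/-- The row of a qubit. -/
def row (q : ℕ) : ℕ := q / D.c / D.b
/-- The column of a qubit. -/
def col (q : ℕ) : ℕ := q / D.c % D.b
/-- The row of a qubit inside its strip. -/
def rho (off q : ℕ) : ℕ := (D.row q + off) % D.H
/-- The position of a qubit along the strip. -/
def pos (off q : ℕ) : ℕ := (D.row q + off) / D.H * D.b + D.col q
/-- The height of a qubit above the bottom of the strip. -/
def lane (off q : ℕ) : ℕ := D.rho off q * D.c + q % D.c
/-- The place of a qubit in the memory. -/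
def slot (off q : ℕ) : ℕ := D.pos off q % (4 * D.d + 4) * D.L + D.lane off q

/-- The lane of a step of the sweep. -/
def laneOf (j : ℕ) : ℕ := j % D.L
/-- The time of a step of the sweep. -/
def tauOf (j : ℕ) : ℕ := j / D.L % D.F
/-- The stage of a step of the sweep. -/
def keyOf (j : ℕ) : ℕ := j / D.L / D.F
/-- The position of a step of the sweep. -/
def posOf (j : ℕ) : ℕ := D.keyOf j - 2 * D.tauOf j
/-- The row of a step of the sweep, shifted. -/
def rowOf (j : ℕ) : ℕ := D.posOf j / D.b * D.H + D.laneOf j / D.c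
/-- The qubit of a step of the sweep. -/
def qubitOf (off j : ℕ) : ℕ :=
  ((D.rowOf j - off) * D.b + D.posOf j % D.b) * D.c + D.laneOf j % D.c

/-- A step of the sweep has a qubit. -/
def Valid (off j : ℕ) : Prop :=
  2 * D.tauOf j ≤ D.keyOf j ∧ D.posOf j < D.a * D.b ∧ off ≤ D.rowOf j ∧ D.rowOf j < D.a + off

theorem div_mod_succ {H : ℕ} (hH : 0 < H) (R : ℕ) :
    R % H + 1 < H ∧ (R + 1) / H = R / H ∧ (R + 1) % H = R % H + 1 ∨
      R % H + 1 = H ∧ (R + 1) % H = 0 := by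
  have h := Nat.div_add_mod R H
  have hlt := Nat.mod_lt R hH
  rcases Nat.lt_or_ge (R % H + 1) H with h1 | h1
  · left
    refine ⟨h1, (Nat.div_mod_unique hH).2 ⟨?_, h1⟩⟩
    omega
  · right
    have h2 : R % H + 1 = H := by omega
    refine ⟨h2, ?_⟩
    have : R + 1 = H * (R / H + 1) := by rw [mul_add, mul_one]; omega
    rw [this, Nat.mul_mod_right]

theorem mul_add_div_mod {L a r : ℕ} (h : r < L) : (a * L + r) / L = a ∧ (a * L + r) % L = r :=
  (Nat.div_mod_unique (by omega)).2 ⟨by rw [mul_comm, add_comm], h⟩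

variable {D}

theorem row_lt {q : ℕ} (hq : q < D.n) : D.row q < D.a := by
  unfold row
  rw [Nat.div_div_eq_div_mul]
  refine Nat.div_lt_of_lt_mul ?_
  calc q < D.n := hq
    _ = D.c * D.b * D.a := by unfold n; ring

theorem col_lt (hb : 0 < D.b) (q : ℕ) : D.col q < D.b := Nat.mod_lt _ hb

theorem eq_row_col (q : ℕ) : q = (D.row q * D.b + D.col q) * D.c + q % D.c := by
  unfold row col
  rw [Nat.div_add_mod', Nat.div_add_mod']

theorem rho_lt (off q : ℕ) : D.rho off q < D.H := Nat.mod_lt _ (by unfold H; omega)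

theorem lane_lt (hc : 0 < D.c) (off q : ℕ) : D.lane off q < D.L := by
  have h1 := D.rho_lt off q
  have h2 := Nat.mod_lt q hc
  have h3 : (D.rho off q + 1) * D.c ≤ D.H * D.c := Nat.mul_le_mul_right _ h1
  rw [add_mul] at h3
  unfold lane L
  omega

/-- As the shift is smaller than the height of a strip, the number of a strip never exceeds the row.
Hence the strips laid end to end fit into the length `a * b`. -/
theorem pos_lt (hb : 0 < D.b) {off q : ℕ} (ho : off ≤ 2 * D.d + 1) (hq : q < D.n) :
    D.pos off q < D.a * D.b := by
  have h1 := row_lt hq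
  have h2 := col_lt hb q
  have h3 : (D.row q + off) / D.H < D.row q + 1 := by
    refine Nat.div_lt_of_lt_mul ?_
    unfold H
    have : D.row q * 2 ≤ (4 * D.d + 2) * D.row q := by
      rw [mul_comm]; exact Nat.mul_le_mul_right _ (by omega)
    rw [mul_add]
    omega
  have h4 : ((D.row q + off) / D.H + 1) * D.b ≤ D.a * D.b := Nat.mul_le_mul_right _ (by omega)
  rw [add_mul] at h4
  unfold pos
  omega

theorem pos_div_mod (hb : 0 < D.b) (off q : ℕ) :
    D.pos off q / D.b = (D.row q + off) / D.H ∧ D.pos off q % D.b = D.col q :=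
  mul_add_div_mod (col_lt hb q)

theorem lane_div_mod (hc : 0 < D.c) (off q : ℕ) :
    D.lane off q / D.c = D.rho off q ∧ D.lane off q % D.c = q % D.c :=
  mul_add_div_mod (Nat.mod_lt _ hc)

theorem rho_add_pos (hb : 0 < D.b) (hc : 0 < D.c) (off q : ℕ) :
    D.pos off q / D.b * D.H + D.lane off q / D.c = D.row q + off := by
  rw [(pos_div_mod hb off q).1, (lane_div_mod hc off q).1]
  exact Nat.div_add_mod' _ _

theorem inj (hb : 0 < D.b) (hc : 0 < D.c) {off q q' : ℕ} (h₁ : D.pos off q = D.pos off q')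
    (h₂ : D.lane off q = D.lane off q') : q = q' := by
  have e1 := rho_add_pos hb hc off q
  have e2 := rho_add_pos hb hc off q'
  rw [h₁, h₂, e2] at e1
  have e3 := (pos_div_mod hb off q).2
  rw [h₁, (pos_div_mod hb off q').2] at e3
  have e4 := (lane_div_mod hc off q).2
  rw [h₂, (lane_div_mod hc off q').2] at e4
  rw [D.eq_row_col q, D.eq_row_col q', e3, e4, show D.row q = D.row q' by omega]

/-- The numbering of the vertices of a graph makes it look like a grid. -/
structure IsGrid (D : Dims) {V : Type} (G : SimpleGraph V) (num : V ≃ Fin D.n) : Prop where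
  b_pos : 0 < D.b
  c_pos : 0 < D.c
  row_le : ∀ u v, G.Adj u v → D.row (num u) ≤ D.row (num v) + 1
  col_le : ∀ u v, G.Adj u v → D.col (num u) ≤ D.col (num v) + 1

variable {V : Type} {G : SimpleGraph V} {num : V ≃ Fin D.n}

/-- Neighbours either share a strip and lie in the same or adjacent rows, or they straddle a strip
boundary, and then one of them is in the top row that will be cut off. -/
theorem IsGrid.rho_cases (hG : D.IsGrid G num) (off : ℕ) {u v : V} (h : G.Adj u v) :
    (D.row (num u) + off) / D.H = (D.row (num v) + off) / D.H ∧
      D.rho off (num u) ≤ D.rho off (num v) + 1 ∧ D.rho off (num v) ≤ D.rho off (num u) + 1 ∨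
    D.rho off (num u) + 1 = D.H ∧ D.rho off (num v) = 0 ∨
    D.rho off (num v) + 1 = D.H ∧ D.rho off (num u) = 0 := by
  have h1 := hG.row_le u v h
  have h2 := hG.row_le v u h.symm
  have hH : 0 < D.H := by unfold H; omega
  unfold rho
  rcases Nat.lt_trichotomy (D.row (num u)) (D.row (num v)) with h3 | h3 | h3
  · have e : D.row (num v) + off = D.row (num u) + off + 1 := by omega
    rw [e]
    rcases div_mod_succ hH (D.row (num u) + off) with ⟨-, h5, h6⟩ | h5
    · rw [h5, h6]; left; exact ⟨rfl, by omega, by omega⟩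
    · exact Or.inr (Or.inl h5)
  · rw [h3]; left; exact ⟨rfl, by omega, by omega⟩
  · have e : D.row (num u) + off = D.row (num v) + off + 1 := by omega
    rw [e]
    rcases div_mod_succ hH (D.row (num v) + off) with ⟨-, h5, h6⟩ | h5
    · rw [h5, h6]; left; exact ⟨rfl, by omega, by omega⟩
    · exact Or.inr (Or.inr h5)

/-- The strips with the shift `off`. -/
def layout (hG : D.IsGrid G num) (off : ℕ) (ho : off ≤ 2 * D.d + 1) : Layout G D.d where
  pos v := D.pos off (num v)
  lane v := D.lane off (num v)
  height := D.L
  len := D.a * D.b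
  -- The core consists of the rows `d` to `3 * d` and the separator is the row `4 * d + 1`. In
  -- truncated subtraction `dist` vanishes exactly on the core rows, equals `d` in the row `0` and
  -- `d + 1` in the separator, so it changes by at most one across a strip boundary as well.
  sep v := decide (D.rho off (num v) + 1 = D.H)
  core v := decide (D.d ≤ D.rho off (num v) ∧ D.rho off (num v) < 3 * D.d + 1)
  dist v := (D.d - D.rho off (num v)) + (D.rho off (num v) - 3 * D.d)
  lane_lt v := lane_lt hG.c_pos off _
  pos_lt v := pos_lt hG.b_pos ho (num v).2
  inj u v h₁ h₂ := num.injective (Fin.ext (inj hG.b_pos hG.c_pos h₁ h₂))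
  pos_le u v h hu hv := by
    rw [decide_eq_false_iff_not] at hu hv
    rcases hG.rho_cases off h with h1 | h1 | h1
    · have := hG.col_le u v h
      unfold pos
      rw [h1.1]
      omega
    · exact absurd h1.1 hu
    · exact absurd h1.1 hv
  dist_le u v h := by
    have := hG.rho_cases off h
    unfold H at this
    omega
  dist_core v h := by
    rw [decide_eq_true_eq] at h
    omega
  dist_sep v h := by
    rw [decide_eq_true_eq] at h
    unfold H at h
    omega

/-- The core is a block of `2 * d + 1` rows in a period of `2 * (2 * d + 1)`, and a shift by half a
period exchanges it with its complement. -/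
theorem layout_core_compl (hG : D.IsGrid G num) (v : V) :
    (layout hG 0 (Nat.zero_le _)).core v = !(layout hG (2 * D.d + 1) le_rfl).core v := by
  rw [Bool.eq_iff_iff, Bool.not_eq_true', layout, layout, decide_eq_true_eq,
    decide_eq_false_iff_not]
  have hlt : D.rho 0 (num v) < 4 * D.d + 2 := Nat.mod_lt _ (by unfold H; omega)
  have e : D.rho (2 * D.d + 1) (num v) = (D.rho 0 (num v) + (2 * D.d + 1)) % (4 * D.d + 2) := by
    unfold rho H
    rw [add_zero, Nat.mod_add_mod]
  rcases Nat.lt_or_ge (D.rho 0 (num v)) (2 * D.d + 1) with h1 | h1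
  · rw [Nat.mod_eq_of_lt (by omega)] at e
    omega
  · rw [Nat.mod_eq_sub_mod (by omega), Nat.mod_eq_of_lt (by omega)] at e
    omega

variable [Fintype V] [DecidableEq V]

theorem layout_count (hG : D.IsGrid G num) (off : ℕ) (ho : off ≤ 2 * D.d + 1) :
    (layout hG off ho).count = D.J := rfl

theorem tauOf_lt (j : ℕ) : D.tauOf j < D.F := Nat.mod_lt _ (by unfold F; omega)

theorem lane_split (hc : 0 < D.c) (j : ℕ) : D.laneOf j / D.c < D.H := by
  refine Nat.div_lt_of_lt_mul ?_
  rw [mul_comm]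
  exact Nat.mod_lt _ (Nat.mul_pos (by unfold H; omega) hc)

/-- The digits of `j` give the lane, the time and the key, from which the coordinates of the qubit
are recovered. This makes the abstract `item` computable from tables. -/
theorem Valid.spec (hG : D.IsGrid G num) {off : ℕ} (ho : off ≤ 2 * D.d + 1) {j : ℕ}
    (h : D.Valid off j) : ∃ v, (num v : ℕ) = D.qubitOf off j ∧
      (layout hG off ho).item j = some (D.tauOf j, v) := by
  obtain ⟨h1, -, h3, h4⟩ := h
  have hL : 0 < D.L := Nat.mul_pos (by unfold H; omega) hG.c_pos
  have hz : D.laneOf j % D.c < D.c := Nat.mod_lt _ hG.c_pos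
  have hcol : D.posOf j % D.b < D.b := Nat.mod_lt _ hG.b_pos
  have hq : D.qubitOf off j < D.n := by
    have e1 : (D.rowOf j - off + 1) * D.b ≤ D.a * D.b := Nat.mul_le_mul_right _ (by omega)
    rw [add_mul] at e1
    have e2 : ((D.rowOf j - off) * D.b + D.posOf j % D.b + 1) * D.c ≤ D.a * D.b * D.c :=
      Nat.mul_le_mul_right _ (by omega)
    rw [add_mul _ 1] at e2
    unfold qubitOf n
    omega
  refine ⟨num.symm ⟨_, hq⟩, by simp, ?_⟩
  rw [Layout.item_eq_some_iff]
  have htau := D.tauOf_lt j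
  refine ⟨by unfold F at htau; dsimp only; omega, ?_⟩
  have q1 := mul_add_div_mod (a := (D.rowOf j - off) * D.b + D.posOf j % D.b) hz
  have q2 := mul_add_div_mod (a := D.rowOf j - off) hcol
  have hrow : D.row (D.qubitOf off j) = D.rowOf j - off := by
    unfold row qubitOf; rw [q1.1, q2.1]
  have hcol' : D.col (D.qubitOf off j) = D.posOf j % D.b := by
    unfold col qubitOf; rw [q1.1, q2.2]
  have hz' : D.qubitOf off j % D.c = D.laneOf j % D.c := by
    unfold qubitOf; rw [q1.2]
  have hR : D.row (D.qubitOf off j) + off = D.posOf j / D.b * D.H + D.laneOf j / D.c := by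
    rw [hrow]; unfold rowOf at h3 ⊢; omega
  have q3 := mul_add_div_mod (a := D.posOf j / D.b) (lane_split (D := D) hG.c_pos j)
  have hpos : D.pos off (D.qubitOf off j) = D.posOf j := by
    unfold pos
    rw [hR, q3.1, hcol', Nat.div_add_mod']
  have hlane : D.lane off (D.qubitOf off j) = D.laneOf j := by
    unfold lane rho
    rw [hR, q3.2, hz', Nat.div_add_mod']
  unfold Layout.idx Layout.key
  simp only [layout, Equiv.apply_symm_apply, hpos, hlane]
  have e3 : D.posOf j + 2 * D.tauOf j = D.keyOf j := by unfold posOf; omega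
  rw [e3]
  change (D.keyOf j * D.F + D.tauOf j) * D.L + D.laneOf j = j
  unfold keyOf tauOf laneOf
  rw [Nat.div_add_mod', Nat.div_add_mod']

theorem not_valid_spec (hG : D.IsGrid G num) {off : ℕ} (ho : off ≤ 2 * D.d + 1) {j : ℕ}
    (h : ¬ D.Valid off j) : (layout hG off ho).item j = none := by
  by_contra hne
  obtain ⟨⟨τ, v⟩, hi⟩ := Option.ne_none_iff_exists'.1 hne
  rw [Layout.item_eq_some_iff] at hi
  obtain ⟨hτ, rfl⟩ := hi
  dsimp only at hτ
  refine h ?_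
  have hl := lane_lt hG.c_pos off (num v : ℕ)
  set Λ := layout hG off ho
  have hidx : Λ.idx (τ, v) = ((D.pos off (num v) + 2 * τ) * D.F + τ) * D.L + D.lane off (num v) :=
    rfl
  have q1 := mul_add_div_mod (a := (D.pos off (num v) + 2 * τ) * D.F + τ) hl
  have q2 := mul_add_div_mod (L := D.F) (a := D.pos off (num v) + 2 * τ) (r := τ)
    (by unfold F; omega)
  have e1 : D.laneOf (Λ.idx (τ, v)) = D.lane off (num v) := by
    unfold laneOf; rw [hidx, q1.2]
  have e2 : D.tauOf (Λ.idx (τ, v)) = τ := by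
    unfold tauOf; rw [hidx, q1.1, q2.2]
  have e3 : D.keyOf (Λ.idx (τ, v)) = D.pos off (num v) + 2 * τ := by
    unfold keyOf; rw [hidx, q1.1, q2.1]
  have e4 : D.posOf (Λ.idx (τ, v)) = D.pos off (num v) := by
    unfold posOf; rw [e2, e3]; omega
  have e5 : D.rowOf (Λ.idx (τ, v)) = D.row (num v) + off := by
    unfold rowOf; rw [e4, e1, rho_add_pos hG.b_pos hG.c_pos]
  have h1 := row_lt (num v).2
  have h2 := pos_lt hG.b_pos ho (num v).2
  refine ⟨by rw [e2, e3]; omega, by rw [e4]; exact h2, by rw [e5]; omega, by rw [e5]; omega⟩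

end Dims

end MeanValue

namespace MeanValue

open Matrix

/-! ### Tables and memory -/

/-- The variables that describe the grid, and the tables of quotients, remainders and powers of
two. -/
structure Tables (D : Dims) (s : State) : Prop where
  a : s.imem 10 0 = D.a
  b : s.imem 11 0 = D.b
  c : s.imem 12 0 = D.c
  d : s.imem 13 0 = D.d
  n : s.imem 14 0 = D.n
  H : s.imem 15 0 = D.H
  L : s.imem 16 0 = D.L
  size : s.imem 19 0 = 2 ^ D.w
  J : s.imem 21 0 = D.J
  div_c : ∀ i < D.J, s.imem 40 i = i / D.c
  mod_c : ∀ i < D.J, s.imem 41 i = i % D.c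
  div_b : ∀ i < D.J, s.imem 42 i = i / D.b
  mod_b : ∀ i < D.J, s.imem 43 i = i % D.b
  div_H : ∀ i < D.J, s.imem 44 i = i / D.H
  mod_H : ∀ i < D.J, s.imem 45 i = i % D.H
  mod_W : ∀ i < D.J, s.imem 47 i = i % (4 * D.d + 4)
  div_L : ∀ i < D.J, s.imem 48 i = i / D.L
  mod_L : ∀ i < D.J, s.imem 49 i = i % D.L
  div_F : ∀ i < D.J, s.imem 50 i = i / D.F
  mod_F : ∀ i < D.J, s.imem 51 i = i % D.F
  pw : ∀ i < D.w, s.imem 54 i = 2 ^ i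

/-- The memory describes the circuit `U` and the observables `O`. -/
structure Describes {V : Type} [Fintype V] [DecidableEq V] {G : SimpleGraph V} (D : Dims)
    (num : V ≃ Fin D.n) (U : Circuit G D.d) (O : V → Matrix (Fin 2) (Fin 2) ℂ) (s : State) :
    Prop extends Tables D s where
  gate_none : ∀ (t : Fin D.d) (v : V), (∀ g ∈ (U t).gates, g.fst ≠ v) →
    s.imem 56 (t * D.n + num v) = 0
  gate_some : ∀ (t : Fin D.d), ∀ g ∈ (U t).gates, ∃ k, s.imem 56 (t * D.n + num g.fst) = k + 1 ∧
    s.imem 2 (2 * k + 1) = num g.snd ∧ ∀ r r' c c' : Fin 2,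
      s.cmem 2 (16 * k + 8 * r + 4 * r' + 2 * c + c') =
        (g.mat : Matrix (Fin 2 × Fin 2) (Fin 2 × Fin 2) ℂ) (r, r') (c, c')
  obs : ∀ (v : V) (r c : Fin 2), s.cmem 1 (4 * num v + 2 * r + c) = O v r c

theorem Tables.frame {D : Dims} {s s' : State} (h : Tables D s) {A C : List ℕ}
    (hf : Frame A C s s') (hA : ∀ a ∈ A, a = 24 ∨ a = 25 ∨ 54 < a) : Tables D s' := by
  have hi : ∀ a, a < 24 ∨ 25 < a ∧ a < 55 → s'.imem a = s.imem a := fun a ha =>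
    hf.imem a fun h' => by have := hA a h'; omega
  constructor
  all_goals rw [hi _ (by norm_num)]
  exacts [h.a, h.b, h.c, h.d, h.n, h.H, h.L, h.size, h.J, h.div_c, h.mod_c, h.div_b, h.mod_b,
    h.div_H, h.mod_H, h.mod_W, h.div_L, h.mod_L, h.div_F, h.mod_F, h.pw]

theorem Describes.frame {V : Type} [Fintype V] [DecidableEq V] {G : SimpleGraph V} {D : Dims}
    {num : V ≃ Fin D.n} {U : Circuit G D.d} {O : V → Matrix (Fin 2) (Fin 2) ℂ} {s s' : State}
    (h : Describes D num U O s) {A C : List ℕ} (hf : Frame A C s s') (hA : ∀ a ∈ A, 100 ≤ a)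
    (hC : ∀ a ∈ C, 100 ≤ a) : Describes D num U O s' where
  toTables := h.toTables.frame hf fun a ha => by have := hA a ha; omega
  gate_none := by rw [hf.imem _ fun h' => by have := hA _ h'; omega]; exact h.gate_none
  gate_some := by
    rw [hf.imem _ fun h' => by have := hA _ h'; omega, hf.imem _ fun h' => by have := hA _ h'; omega,
      hf.cmem _ fun h' => by have := hC _ h'; omega]
    exact h.gate_some
  obs := by rw [hf.cmem _ fun h' => by have := hC _ h'; omega]; exact h.obs

/-! ### Expressions for the geometry -/

/-- The lane of the step `j`. -/
abbrev laneE (j : IExp) : IExp := .load 49 j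
/-- The time of the step `j`. -/
abbrev tauE (j : IExp) : IExp := .load 51 (.load 48 j)
/-- The stage of the step `j`. -/
abbrev keyE (j : IExp) : IExp := .load 50 (.load 48 j)
/-- The position of the step `j`. -/
abbrev posE (j : IExp) : IExp := keyE j - 2 * tauE j
/-- The shifted row of the step `j`. -/
abbrev rowE (j : IExp) : IExp := .load 42 (posE j) * iv 15 + .load 40 (laneE j)
/-- The qubit of the step `j`. -/
abbrev qubitE (j : IExp) : IExp :=
  ((rowE j - iv 100) * iv 11 + .load 43 (posE j)) * iv 12 + .load 41 (laneE j)
/-- The step `j` has a qubit. -/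
abbrev validE (j : IExp) : BExp :=
  .and (.ile (2 * tauE j) (keyE j)) (.and (ltE (posE j) (iv 10 * iv 11))
    (.and (.ile (iv 100) (rowE j)) (ltE (rowE j) (iv 10 + iv 100))))
/-- The shifted row of the qubit `q`. -/
abbrev srowE (q : IExp) : IExp := .load 42 (.load 40 q) + iv 100
/-- The row of the qubit `q` inside its strip. -/
abbrev rhoE (q : IExp) : IExp := .load 45 (srowE q)
/-- The place of the qubit `q` in the memory. -/
abbrev slotE (q : IExp) : IExp :=
  .load 47 (.load 44 (srowE q) * iv 11 + .load 43 (.load 40 q)) * iv 16 +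
    (rhoE q * iv 12 + .load 41 q)

namespace Dims

variable {D : Dims}

theorem count_eq (D : Dims) : D.J = (D.a * D.b + 4 * D.d + 2) * ((2 * D.d + 2) * (4 * D.d + 2)) * D.c := by
  unfold J F L H; ring

/-- All tables have length `J`. This bound and the next keep the lookups of shifted rows, positions
and qubits in range. -/
theorem le_J (hc : 0 < D.c) : D.a * D.b + 4 * D.d + 2 ≤ D.J := by
  rw [count_eq, mul_assoc]
  exact Nat.le_mul_of_pos_right _ (Nat.mul_pos (Nat.mul_pos (by omega) (by omega)) hc)

theorem n_le_J (D : Dims) : D.n ≤ D.J := by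
  rw [count_eq]
  refine Nat.mul_le_mul_right _ ?_
  calc D.a * D.b ≤ D.a * D.b + 4 * D.d + 2 := by omega
    _ ≤ _ := Nat.le_mul_of_pos_right _ (Nat.mul_pos (by omega) (by omega))

end Dims

section Geometry

variable {D : Dims} {s : State} {off : ℕ}

theorem Tables.step_eval (h : Tables D s) (ho : s.imem 100 0 = off) {e : IExp} {j : ℕ}
    (he : e.eval s = j) (hj : j < D.J) :
    (tauE e).eval s = D.tauOf j ∧ (qubitE e).eval s = D.qubitOf off j ∧
      ((validE e).eval s ↔ D.Valid off j) := by
  have h1 : s.imem 49 j = D.laneOf j := h.mod_L j hj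
  have h2 : s.imem 48 j = j / D.L := h.div_L j hj
  have hj' : j / D.L < D.J := (Nat.div_le_self _ _).trans_lt hj
  have h3 : s.imem 51 (j / D.L) = D.tauOf j := h.mod_F _ hj'
  have h4 : s.imem 50 (j / D.L) = D.keyOf j := h.div_F _ hj'
  have hp : D.posOf j < D.J := by
    have : D.keyOf j ≤ j / D.L := Nat.div_le_self _ _
    unfold Dims.posOf; omega
  have hl : D.laneOf j < D.J := (Nat.mod_le _ _).trans_lt hj
  have h5 : D.keyOf j - 2 * D.tauOf j = D.posOf j := rfl
  have h6 : (rowE e).eval s = D.rowOf j := by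
    simp only [IExp.eval_load, IExp.eval_add, IExp.eval_mul, IExp.eval_sub, IExp.eval_ofNat, he,
      h1, h2, h3, h4, h5, h.div_b _ hp, h.div_c _ hl, h.H]
    rfl
  refine ⟨?_, ?_, ?_⟩
  · simp only [IExp.eval_load, he, h2, h3]
  · simp only [IExp.eval_load, IExp.eval_add, IExp.eval_mul, IExp.eval_sub, IExp.eval_ofNat] at h6
    simp only [IExp.eval_load, IExp.eval_add, IExp.eval_mul, IExp.eval_sub, IExp.eval_ofNat, h6]
    simp only [he, h1, h2, h3, h4, h5, h.mod_b _ hp, h.mod_c _ hl, h.b, h.c, ho]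
    rfl
  · simp only [IExp.eval_load, IExp.eval_add, IExp.eval_mul, IExp.eval_sub, IExp.eval_ofNat] at h6
    simp only [BExp.eval_and, BExp.eval_ile, IExp.eval_load, IExp.eval_add, IExp.eval_mul,
      IExp.eval_sub, IExp.eval_ofNat, h6]
    simp only [he, h2, h3, h4, h5, h.a, h.b, ho]
    rfl

theorem Tables.qubit_eval (h : Tables D s) (hb : 0 < D.b) (hc : 0 < D.c) (ho : s.imem 100 0 = off)
    (ho' : off ≤ 2 * D.d + 1) {e : IExp} {q : ℕ} (he : e.eval s = q) (hq : q < D.n) :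
    (rhoE e).eval s = D.rho off q ∧ (slotE e).eval s = D.slot off q := by
  have hJ := Dims.n_le_J D
  have hJ' := Dims.le_J hc
  have h1 : s.imem 40 q = q / D.c := h.div_c q (by omega)
  have hq' : q / D.c < D.J := (Nat.div_le_self _ _).trans_lt (by omega)
  have h2 : s.imem 42 (q / D.c) = D.row q := h.div_b _ hq'
  have h3 : s.imem 43 (q / D.c) = D.col q := h.mod_b _ hq'
  have hr : D.row q + off < D.J := by
    have := Dims.row_lt hq
    have : D.a ≤ D.a * D.b := Nat.le_mul_of_pos_right _ hb
    omega
  have h4 : s.imem 45 (D.row q + off) = D.rho off q := h.mod_H _ hr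
  have h5 : s.imem 44 (D.row q + off) = (D.row q + off) / D.H := h.div_H _ hr
  have hp : D.pos off q < D.J := by
    have := Dims.pos_lt hb ho' hq
    omega
  have h6 : (D.row q + off) / D.H * D.b + D.col q = D.pos off q := rfl
  constructor
  · simp only [IExp.eval_load, IExp.eval_add, IExp.eval_ofNat, he, h1, h2, ho, h4]
  · simp only [IExp.eval_load, IExp.eval_add, IExp.eval_mul, IExp.eval_ofNat, he, h1, h2, h3, ho,
      h4, h5, h.b, h6, h.mod_W _ hp, h.L, h.c, h.mod_c q (by omega)]
    rfl

end Geometry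

/-! ### Operations on the state vector -/

/-- Compute the bits with the weight `p` of all the addresses. -/
def bitsCmd (B p : ℕ) : Cmd :=
  forLoop 110 19 (.istore B (iv 110)
    (geE (iv p) (iv 110) * (1 - .load B (iv 110 - iv p))))

/-- Replace the state vector. -/
def applyCmd (e : CExp) : Cmd :=
  .seq (forLoop 110 19 (.cstore 101 (iv 110) e)) (forLoop 110 19 (.cstore 100 (iv 110) (.load 101 (iv 110))))

/-- The squared norm of a vector. -/
def normCmd (a : ℕ) (e : CExp) : Cmd :=
  .seq (cset a 0) (forLoop 110 19 (cset a (cv a + e * .conj e)))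

theorem geE_eval (m e : IExp) (s : State) :
    (geE m e).eval s = if m.eval s ≤ e.eval s then 1 else 0 := by
  simp only [IExp.eval_sub, IExp.eval_ofNat, IExp.eval_add]
  split_ifs <;> omega

/-- Subtracting `p` flips the parity of the quotient. Without division on the machine, this
recurrence is how bits of addresses are tabulated. -/
theorem bit_rec {p : ℕ} (hp : 0 < p) (k : ℕ) :
    k / p % 2 = (if p ≤ k then 1 else 0) * (1 - (k - p) / p % 2) := by
  split_ifs with h
  · have e : k / p = (k - p) / p + 1 := by
      obtain ⟨m, rfl⟩ := Nat.exists_eq_add_of_le h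
      rw [Nat.add_sub_cancel_left, Nat.add_div_left _ hp]
    omega
  · rw [Nat.div_eq_of_lt (by omega)]
    omega

theorem bitsCmd_runs {B p : ℕ} (hB : B ≠ 19) (hB' : B ≠ 110) (hp : p ≠ B) (hp' : p ≠ 110)
    {s : State} {N P : ℕ} (hN : s.imem 19 0 = N) (hP : s.imem p 0 = P) (hP0 : 0 < P) :
    Runs (bitsCmd B p) s (10 + N * 36) fun s' => ∀ k < N, s'.imem B k = k / P % 2 := by
  refine (Runs.fillI hN (by decide) hB' hB.symm (fun k => k / P % 2) ?_).mono (le_of_eq rfl) fun _ h => h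
  intro k hk s' hf hi hI
  have hP' : s'.imem p 0 = P := by rw [hf.imem p (by simp [hp, hp']), hP]
  rw [IExp.eval_mul, geE_eval, bit_rec hP0]
  simp only [IExp.eval_load, IExp.eval_ofNat, IExp.eval_sub, hi, hP']
  split_ifs with h
  · rw [hI (k - P) (by omega)]
  · simp

/-- The new vector is built in the scratch array `101` and copied afterwards, so during the
evaluation `e` still sees the old vector in the array `100`. -/
theorem applyCmd_runs {e : CExp} {s : State} {N : ℕ} (hN : s.imem 19 0 = N) (f : ℕ → ℂ)
    (hf : ∀ k < N, ∀ s', Frame [110] [101] s s' → s'.imem 110 0 = k → e.eval s' = f k) :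
    Runs (applyCmd e) s (20 + N * (e.cost + 35)) fun s' => ∀ k < N, s'.cmem 100 k = f k := by
  refine (Runs.seq (T' := 10 + N * 19) ((Runs.fillC hN (by decide) f hf).frame.mono le_rfl ?_)).mono
    (le_of_eq (by ring)) fun _ h => h
  rintro s₁ ⟨h₁, hf₁, -⟩
  have hN₁ : s₁.imem 19 0 = N := by rw [hf₁.imem _ (by simp [Cmd.iw]), hN]
  refine (Runs.fillC hN₁ (by decide) f ?_).mono (le_of_eq rfl) fun _ h => h
  intro k hk s₂ hf₂ hi
  rw [CExp.eval_load, hf₂.cmem _ (by decide)]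
  simp only [IExp.eval_load, IExp.eval_ofNat, hi]
  exact h₁ k hk

theorem normCmd_runs {a : ℕ} {e : CExp} {s : State} {N : ℕ} (hN : s.imem 19 0 = N) (f : ℕ → ℂ)
    (hf : ∀ k < N, ∀ s', Frame [110] [a] s s' → s'.imem 110 0 = k → e.eval s' = f k) :
    Runs (normCmd a e) s (14 + N * (2 * e.cost + 21)) fun s' =>
      s'.cmem a 0 = ((∑ k ∈ Finset.range N, Complex.normSq (f k) : ℝ) : ℂ) := by
  have hf0 : ∀ z, Frame [] [a] s (s.setC a 0 z) := fun z => ⟨fun _ _ => rfl, fun b hb => by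
    rw [State.cmem_setC, if_neg (by simpa using hb)]⟩
  have hN' : (s.setC a ((0 : IExp).eval s) ((0 : CExp).eval s)).imem 19 0 = N := hN
  refine (Runs.seq (T := 4) (T' := 10 + N * (2 * e.cost + 21)) (Runs.cstore ?_)).mono
    (by omega) fun _ h => h
  refine (Runs.forLoop (i := 110) (b := 19) (p := cset a (cv a + e * .conj e)) (n := N)
    (T := 2 * e.cost + 8) hN' (by decide)
    (by simp [Cmd.iw]) (by simp [Cmd.iw]) (fun k s' => s'.cmem a 0 = ((∑ k ∈ Finset.range k, Complex.normSq (f k) : ℝ) : ℂ))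
    ?_ ?_).mono (by ring_nf; exact le_rfl) fun _ h => h
  · simp [State.cmem_setC]
  · intro k hk s' hf' hi hI
    refine (Runs.cstore ?_).mono ?_ fun _ h => h
    · rw [State.cmem_setI, State.cmem_setC, if_pos rfl]
      simp only [CExp.eval_add, CExp.eval_load, IExp.eval_ofNat, CExp.eval_mul, CExp.eval_conj]
      rw [Function.update_self, hf k hk s' ?_ hi, hI, Finset.sum_range_succ, Complex.mul_conj]
      · push_cast; rfl
      · exact ((hf0 _).trans hf').mono (by simp [Cmd.iw]) (by simp [Cmd.cw])
    · change 1 + (2 + 1 - 1 + (e.cost + (e.cost + 1) + 1) + 1) + 1 ≤ _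
      omega

end MeanValue

namespace MeanValue

open Matrix

/-! ### Gates, observables and projections on the machine -/

section Cost

@[simp] theorem IExp.cost_ofNat (k : ℕ) : (no_index (OfNat.ofNat k : IExp)).cost = 1 := rfl
@[simp] theorem IExp.cost_add (e f : IExp) : (e + f).cost = e.cost + f.cost + 1 := rfl
@[simp] theorem IExp.cost_sub (e f : IExp) : (e - f).cost = e.cost + f.cost + 1 := rfl
@[simp] theorem IExp.cost_mul (e f : IExp) : (e * f).cost = e.cost + f.cost + 1 := rfl
@[simp] theorem IExp.cost_load (a : ℕ) (e : IExp) : (IExp.load a e).cost = e.cost + 1 := rfl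
@[simp] theorem CExp.cost_ofNat (k : ℕ) : (no_index (OfNat.ofNat k : CExp)).cost = 2 := rfl
@[simp] theorem CExp.cost_add (e f : CExp) : (e + f).cost = e.cost + f.cost + 1 := rfl
@[simp] theorem CExp.cost_sub (e f : CExp) : (e - f).cost = e.cost + f.cost + 1 := rfl
@[simp] theorem CExp.cost_mul (e f : CExp) : (e * f).cost = e.cost + f.cost + 1 := rfl
@[simp] theorem CExp.cost_div (e f : CExp) : (e / f).cost = e.cost + f.cost + 1 := rfl
@[simp] theorem CExp.cost_cast (e : IExp) : (CExp.cast e).cost = e.cost + 1 := rfl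
@[simp] theorem CExp.cost_conj (e : CExp) : (CExp.conj e).cost = e.cost + 1 := rfl
@[simp] theorem CExp.cost_load (a : ℕ) (e : IExp) : (CExp.load a e).cost = e.cost + 1 := rfl
@[simp] theorem BExp.cost_ile (e f : IExp) : (BExp.ile e f).cost = e.cost + f.cost + 1 := rfl
@[simp] theorem BExp.cost_cle (e f : CExp) : (BExp.cle e f).cost = e.cost + f.cost + 1 := rfl
@[simp] theorem BExp.cost_not (b : BExp) : (BExp.not b).cost = b.cost + 1 := rfl
@[simp] theorem BExp.cost_and (b c : BExp) : (BExp.and b c).cost = b.cost + c.cost + 1 := rfl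

end Cost

/-- Find the place of the qubit `q` in the memory. -/
def focusCmd (p B q : ℕ) : Cmd := .seq (iset p (.load 54 (slotE (iv q)))) (bitsCmd B p)

/-- The current address with the bits of weight `p` replaced by `b`. -/
abbrev addrE (e : IExp) (p B : ℕ) (b : IExp) : IExp := e - .load B (iv 110) * iv p + b * iv p

/-- The effect of a single-qubit operator. -/
abbrev siteE (ent : IExp → IExp → CExp) : CExp :=
  ent (.load 120 (iv 110)) 0 * .load 100 (addrE (iv 110) 122 120 0) +
    ent (.load 120 (iv 110)) 1 * .load 100 (addrE (iv 110) 122 120 1)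

/-- A summand in the effect of a two-qubit operator. -/
abbrev pairTermE (ent : IExp → IExp → IExp → IExp → CExp) (b b' : IExp) : CExp :=
  ent (.load 120 (iv 110)) (.load 121 (iv 110)) b b' *
    .load 100 (addrE (addrE (iv 110) 122 120 b) 123 121 b')

/-- The effect of a two-qubit operator. -/
abbrev pairE (ent : IExp → IExp → IExp → IExp → CExp) : CExp :=
  (pairTermE ent 0 0 + pairTermE ent 0 1) + (pairTermE ent 1 0 + pairTermE ent 1 1)

/-- The effect of a projection onto `b` followed by a reset. -/
abbrev ketbraE (b : IExp) : CExp :=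
  .cast (1 - .load 120 (iv 110)) * .load 100 (addrE (iv 110) 122 120 b)

/-- Apply a single-qubit operator to the qubit in the variable `126`. -/
def siteCmd (ent : IExp → IExp → CExp) : Cmd := .seq (focusCmd 122 120 126) (applyCmd (siteE ent))

/-- Apply a two-qubit operator to the qubits in the variables `126` and `125`. -/
def pairCmd (ent : IExp → IExp → IExp → IExp → CExp) : Cmd :=
  .seq (focusCmd 122 120 126) (.seq (focusCmd 123 121 125) (applyCmd (pairE ent)))

section Eval

variable {w : ℕ} {s : State} {φ : (Fin w → Fin 2) → ℂ} {σ : Fin w → Fin 2}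

/-- The bit is looked up at the loop address `σ`, while the address `τ` being modified may already
differ from it in another bit. Agreement at `t` is all that is needed, and this allows two
replacements in a row. -/
theorem addrE_eval {e b : IExp} {p B : ℕ} {t : Fin w} {c : Fin 2} {τ : Fin w → Fin 2}
    (hB : s.imem B (code σ) = code σ / 2 ^ (t : ℕ) % 2) (hp : s.imem p 0 = 2 ^ (t : ℕ))
    (hi : s.imem 110 0 = code σ) (he : e.eval s = code τ) (hτ : τ t = σ t) (hb : b.eval s = c) :
    (addrE e p B b).eval s = code (Function.update τ t c) := by
  rw [code_update, hτ, ← code_div_mod σ t, ← hB]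
  simp only [IExp.eval_add, IExp.eval_sub, IExp.eval_mul, IExp.eval_load, IExp.eval_ofNat, he, hp,
    hi, hb]

theorem siteE_eval {ent : IExp → IExp → CExp} {t : Fin w} {M : Matrix (Fin 2) (Fin 2) ℂ}
    (hψ : ∀ σ, s.cmem 100 (code σ) = φ σ)
    (hB : s.imem 120 (code σ) = code σ / 2 ^ (t : ℕ) % 2) (hp : s.imem 122 0 = 2 ^ (t : ℕ))
    (hi : s.imem 110 0 = code σ)
    (hent : ∀ (r c : Fin 2) e f, e.eval s = (r : ℕ) → f.eval s = (c : ℕ) → (ent e f).eval s = M r c) :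
    (siteE ent).eval s = ∑ b, M (σ t) b * φ (Function.update σ t b) := by
  have hr : (IExp.load 120 (iv 110)).eval s = σ t := by
    rw [← code_div_mod σ t, ← hB]; simp [hi]
  have h0 : (iv 110).eval s = code σ := by simp [hi]
  rw [Fin.sum_univ_two, CExp.eval_add, CExp.eval_mul, CExp.eval_mul, CExp.eval_load,
    CExp.eval_load, addrE_eval (c := 0) hB hp hi h0 rfl rfl,
    addrE_eval (c := 1) hB hp hi h0 rfl rfl, hψ, hψ, hent (σ t) 0 _ _ hr rfl,
    hent (σ t) 1 _ _ hr rfl]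

theorem ketbraE_eval {b : IExp} {c : Fin 2} {t : Fin w}
    (hψ : ∀ σ, s.cmem 100 (code σ) = φ σ)
    (hB : s.imem 120 (code σ) = code σ / 2 ^ (t : ℕ) % 2) (hp : s.imem 122 0 = 2 ^ (t : ℕ))
    (hi : s.imem 110 0 = code σ) (hb : b.eval s = c) :
    (ketbraE b).eval s = ∑ b, ketbra c (σ t) b * φ (Function.update σ t b) := by
  have h0 : (iv 110).eval s = code σ := by simp [hi]
  have hr : (IExp.load 120 (iv 110)).eval s = σ t := by
    rw [← code_div_mod σ t, ← hB]; simp [hi]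
  rw [CExp.eval_mul, CExp.eval_load, addrE_eval (c := c) hB hp hi h0 rfl hb, hψ,
    Finset.sum_eq_single c]
  · congr 1
    rw [CExp.eval_cast, IExp.eval_sub, hr, ketbra]
    generalize σ t = r
    fin_cases r <;> simp
  · intro b' _ hne
    simp [ketbra, hne.symm]
  · simp

theorem pairE_eval {ent : IExp → IExp → IExp → IExp → CExp} {t t' : Fin w} (htt : t ≠ t')
    {M : Matrix (Fin 2 × Fin 2) (Fin 2 × Fin 2) ℂ}
    (hψ : ∀ σ, s.cmem 100 (code σ) = φ σ)
    (hB : s.imem 120 (code σ) = code σ / 2 ^ (t : ℕ) % 2) (hp : s.imem 122 0 = 2 ^ (t : ℕ))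
    (hB' : s.imem 121 (code σ) = code σ / 2 ^ (t' : ℕ) % 2) (hp' : s.imem 123 0 = 2 ^ (t' : ℕ))
    (hi : s.imem 110 0 = code σ)
    (hent : ∀ (r r' c c' : Fin 2) e e' f f', e.eval s = (r : ℕ) → e'.eval s = (r' : ℕ) →
      f.eval s = (c : ℕ) → f'.eval s = (c' : ℕ) → (ent e e' f f').eval s = M (r, r') (c, c')) :
    (pairE ent).eval s = ∑ b, M (σ t, σ t') b *
      φ (Function.update (Function.update σ t b.1) t' b.2) := by
  have hr : (IExp.load 120 (iv 110)).eval s = σ t := by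
    rw [← code_div_mod σ t, ← hB]; simp [hi]
  have hr' : (IExp.load 121 (iv 110)).eval s = σ t' := by
    rw [← code_div_mod σ t', ← hB']; simp [hi]
  have h0 : (iv 110).eval s = code σ := by simp [hi]
  have key : ∀ (b b' : IExp) (c c' : Fin 2), b.eval s = c → b'.eval s = c' →
      (pairTermE ent b b').eval s = M (σ t, σ t') (c, c') *
        φ (Function.update (Function.update σ t c) t' c') := by
    intro b b' c c' hb hb'
    rw [CExp.eval_mul, CExp.eval_load, hent _ _ _ _ _ _ _ _ hr hr' hb hb',
      addrE_eval hB' hp' hi (addrE_eval hB hp hi h0 rfl hb)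
        (Function.update_of_ne htt.symm _ _) hb', hψ]
  rw [Fintype.sum_prod_type, Fin.sum_univ_two, Fin.sum_univ_two, Fin.sum_univ_two,
    CExp.eval_add, CExp.eval_add, CExp.eval_add, key 0 0 0 0 rfl rfl, key 0 1 0 1 rfl rfl,
    key 1 0 1 0 rfl rfl, key 1 1 1 1 rfl rfl]

end Eval

section Step

variable {V : Type} [Fintype V] [DecidableEq V] {G : SimpleGraph V} {D : Dims}
  {num : V ≃ Fin D.n} (hG : D.IsGrid G num) {off : ℕ} (ho : off ≤ 2 * D.d + 1)
  {U : Circuit G D.d} {O : V → Matrix (Fin 2) (Fin 2) ℂ}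

/-- The place of a qubit in the memory. -/
def place (v : V) : Fin D.w := ⟨(Dims.layout hG off ho).slot v, (Dims.layout hG off ho).slot_lt v⟩

/-- The machine is in the state of the sampler `(nd, u)`. -/
structure Rel (U : Circuit G D.d) (O : V → Matrix (Fin 2) (Fin 2) ℂ) (nd : Node V) (u : ℝ)
    (s : State) : Prop where
  desc : Describes D num U O s
  off : s.imem 100 0 = off
  psi : ∀ σ, s.cmem 100 (code σ) = push (place hG ho) nd.Ψ σ
  x : ∀ v, s.imem 103 (num v) = nd.x v
  on : s.imem 101 0 = nd.on.toNat
  u : s.cmem 102 0 = u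
  N : s.cmem 103 0 = nd.N

variable {hG ho} {nd : Node V} {u : ℝ} {s : State}

theorem Rel.update (h : Rel hG ho U O nd u s) {A C : List ℕ} {s' : State} (hf : Frame A C s s')
    (hA : ∀ a ∈ A, 103 < a) (hC : ∀ a ∈ C, a = 100 ∨ a = 101 ∨ 103 < a) {Ψ : (V → Fin 2) → ℂ}
    (hψ : ∀ σ, s'.cmem 100 (code σ) = push (place hG ho) Ψ σ) :
    Rel hG ho U O { nd with Ψ := Ψ } u s' where
  desc := h.desc.frame hf (fun a ha => by have := hA a ha; omega)
    fun a ha => by have := hC a ha; omega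
  off := by rw [hf.imem _ fun ha => by have := hA _ ha; omega]; exact h.off
  psi := hψ
  x := by rw [hf.imem _ fun ha => by have := hA _ ha; omega]; exact h.x
  on := by rw [hf.imem _ fun ha => by have := hA _ ha; omega]; exact h.on
  u := by rw [hf.cmem _ fun ha => by have := hC _ ha; omega]; exact h.u
  N := by rw [hf.cmem _ fun ha => by have := hC _ ha; omega]; exact h.N

theorem Rel.frame (h : Rel hG ho U O nd u s) {A C : List ℕ} {s' : State} (hf : Frame A C s s')
    (hA : ∀ a ∈ A, 103 < a) (hC : ∀ a ∈ C, a = 101 ∨ 103 < a) : Rel hG ho U O nd u s' :=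
  h.update hf hA (fun a ha => Or.inr (hC a ha)) (Ψ := nd.Ψ) (by
    rw [hf.cmem _ fun ha => by have := hC _ ha; omega]; exact h.psi)

theorem focusCmd_runs {p B q : ℕ} (hB : B ≠ 19) (hB' : B ≠ 110) (hp : p ≠ B) (hp' : p ≠ 110)
    (hp'' : p ≠ 19) (hd : Describes D num U O s) (hoff : s.imem 100 0 = off) {v : V}
    (hq : s.imem q 0 = num v) :
    Runs (focusCmd p B q) s (49 + 2 ^ D.w * 36) fun s' =>
      s'.imem p 0 = 2 ^ (place hG ho v : ℕ) ∧
        ∀ k < 2 ^ D.w, s'.imem B k = k / 2 ^ (place hG ho v : ℕ) % 2 := by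
  have e : (slotE (iv q)).eval s = (place hG ho v : ℕ) :=
    (hd.qubit_eval hG.b_pos hG.c_pos hoff ho (by simp [hq]) (num v).2).2
  have e1 : (IExp.load 54 (slotE (iv q))).eval s = 2 ^ (place hG ho v : ℕ) := by
    rw [IExp.eval_load, e]
    exact hd.pw _ (place hG ho v).2
  refine (Runs.seq (T := 39) ((Runs.istore ?_).mono (le_of_eq rfl) fun _ h => h)).mono
    (T := 39 + (10 + 2 ^ D.w * 36)) (by omega) fun _ h => h
  rw [e1]
  have h1 : (s.setI p ((0 : IExp).eval s) (2 ^ (place hG ho v : ℕ))).imem p 0 =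
      2 ^ (place hG ho v : ℕ) := by rw [State.setI_same]; simp
  refine (bitsCmd_runs hB hB' hp hp' (by rw [State.setI_ne _ _ _ hp''.symm]; exact hd.size) h1
    (by positivity)).frame.mono le_rfl fun s' ⟨h2, hf, _⟩ => ⟨?_, h2⟩
  rw [hf.imem _ (by simp [bitsCmd, Cmd.iw, hp, hp']), h1]

/-- What is needed for an operation on the qubits in `B`. -/
structure Local (B : Set V) (nd : Node V) : Prop where
  inj : Set.InjOn (place hG ho) B
  supp : ∀ y, nd.Ψ y ≠ 0 → y ∈ Conf B

theorem siteCmd_runs {B : Set V} (hl : Local (hG := hG) (ho := ho) B nd) {v : V} (hv : v ∈ B)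
    (h : Rel hG ho U O nd u s) (hq : s.imem 126 0 = num v) {ent : IExp → IExp → CExp}
    {M : Matrix (Fin 2) (Fin 2) ℂ}
    (hent : ∀ s', Frame [110, 120, 121, 122, 123] [101] s s' →
      ∀ (r c : Fin 2) e f, e.eval s' = (r : ℕ) → f.eval s' = (c : ℕ) → (ent e f).eval s' = M r c) :
    Runs (siteCmd ent) s (69 + 2 ^ D.w * ((siteE ent).cost + 71))
      (Rel hG ho U O { nd with Ψ := site v M *ᵥ nd.Ψ } u) := by
  refine (Runs.seq (T := 49 + 2 ^ D.w * 36) (T' := 20 + 2 ^ D.w * ((siteE ent).cost + 35))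
    ((focusCmd_runs (hG := hG) (ho := ho) (by decide) (by decide) (by decide) (by decide)
      (by decide) h.desc h.off hq).frame.mono le_rfl ?_)).mono (by ring_nf; exact le_rfl)
    fun _ h => h
  rintro s₁ ⟨⟨hp, hb⟩, hf, -⟩
  have hf' : Frame [110, 120, 121, 122, 123] [101] s s₁ :=
    hf.mono (by simp [focusCmd, bitsCmd, Cmd.iw]) (by simp [focusCmd, bitsCmd, Cmd.cw])
  have h₁ := h.frame hf' (by simp) (by simp)
  -- The target is prescribed as a function of numerical addresses, so an address is decoded by a
  -- chosen configuration; `code_injective` removes the choice at the end.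
  refine (applyCmd_runs h₁.desc.size (fun k => if hk : k < 2 ^ D.w then
    push (place hG ho) (site v M *ᵥ nd.Ψ) (exists_code hk).choose else 0) ?_).frame.mono le_rfl ?_
  · intro k hk s₂ hf₂ hi
    rw [dif_pos hk]
    have hσ := (exists_code hk).choose_spec
    set σ := (exists_code hk).choose
    rw [push_site hl.inj hl.supp hv]
    have h₂ := h₁.frame hf₂ (by simp) (by simp)
    refine siteE_eval h₂.psi ?_ ?_ (by rw [hi, hσ]) (hent s₂ ((hf'.trans hf₂).mono (by simp) (by simp)))
    · rw [hf₂.imem _ (by simp), hσ, hb _ hk]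
    · rw [hf₂.imem _ (by simp), hp]
  · rintro s₂ ⟨h₂, hf₂, -⟩
    refine h₁.update hf₂ (by simp [applyCmd, Cmd.iw]) (by simp [applyCmd, Cmd.cw]) fun σ => ?_
    have hk := code_lt σ
    rw [h₂ _ hk, dif_pos hk, code_injective (exists_code hk).choose_spec]

theorem pairCmd_runs {B : Set V} (hl : Local (hG := hG) (ho := ho) B nd) {v v' : V} (hv : v ∈ B)
    (hv' : v' ∈ B) (hvv : v ≠ v') (h : Rel hG ho U O nd u s) (hq : s.imem 126 0 = num v)
    (hq' : s.imem 125 0 = num v') {ent : IExp → IExp → IExp → IExp → CExp}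
    {M : Matrix (Fin 2 × Fin 2) (Fin 2 × Fin 2) ℂ}
    (hent : ∀ s', Frame [110, 120, 121, 122, 123] [101] s s' →
      ∀ (r r' c c' : Fin 2) e e' f f', e.eval s' = (r : ℕ) → e'.eval s' = (r' : ℕ) →
        f.eval s' = (c : ℕ) → f'.eval s' = (c' : ℕ) → (ent e e' f f').eval s' = M (r, r') (c, c')) :
    Runs (pairCmd ent) s (118 + 2 ^ D.w * ((pairE ent).cost + 107))
      (Rel hG ho U O { nd with Ψ := pair v v' M *ᵥ nd.Ψ } u) := by
  refine (Runs.seq (T := 49 + 2 ^ D.w * 36) (T' := 69 + 2 ^ D.w * ((pairE ent).cost + 71))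
    ((focusCmd_runs (hG := hG) (ho := ho) (by decide) (by decide) (by decide) (by decide)
      (by decide) h.desc h.off hq).frame.mono le_rfl ?_)).mono (by ring_nf; exact le_rfl)
    fun _ h => h
  rintro s₁ ⟨⟨hp, hb⟩, hf, -⟩
  have hf' : Frame [110, 120, 121, 122, 123] [101] s s₁ :=
    hf.mono (by simp [focusCmd, bitsCmd, Cmd.iw]) (by simp [focusCmd, bitsCmd, Cmd.cw])
  have h₁ := h.frame hf' (by simp) (by simp)
  refine (Runs.seq (T := 49 + 2 ^ D.w * 36) (T' := 20 + 2 ^ D.w * ((pairE ent).cost + 35))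
    ((focusCmd_runs (hG := hG) (ho := ho) (by decide) (by decide) (by decide) (by decide)
      (by decide) h₁.desc h₁.off (v := v') (by rw [hf'.imem _ (by simp), hq'])).frame.mono
      le_rfl ?_)).mono (by ring_nf; exact le_rfl) fun _ h => h
  rintro s₂ ⟨⟨hp', hb'⟩, hf₂, -⟩
  have hf₂' : Frame [110, 121, 123] [101] s₁ s₂ :=
    hf₂.mono (by simp [focusCmd, bitsCmd, Cmd.iw]) (by simp [focusCmd, bitsCmd, Cmd.cw])
  have h₂ := h₁.frame hf₂' (by simp) (by simp)
  refine (applyCmd_runs h₂.desc.size (fun k => if hk : k < 2 ^ D.w then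
    push (place hG ho) (pair v v' M *ᵥ nd.Ψ) (exists_code hk).choose else 0) ?_).frame.mono
    le_rfl ?_
  · intro k hk s₃ hf₃ hi
    rw [dif_pos hk]
    have hσ := (exists_code hk).choose_spec
    set σ := (exists_code hk).choose
    rw [push_pair hl.inj hl.supp hvv hv hv']
    have h₃ := h₂.frame hf₃ (by simp) (by simp)
    -- Both qubits lie in the window, where places in memory are distinct.
    refine pairE_eval (fun e => hvv (hl.inj hv hv' e)) h₃.psi ?_ ?_ ?_ ?_ (by rw [hi, hσ])
      (hent s₃ (((hf'.trans hf₂').trans hf₃).mono (by simp) (by simp)))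
    · rw [hf₃.imem _ (by simp), hf₂'.imem _ (by simp), hσ, hb _ hk]
    · rw [hf₃.imem _ (by simp), hf₂'.imem _ (by simp), hp]
    · rw [hf₃.imem _ (by simp), hσ, hb' _ hk]
    · rw [hf₃.imem _ (by simp), hp']
  · rintro s₃ ⟨h₃, hf₃, -⟩
    refine h₂.update hf₃ (by simp [applyCmd, Cmd.iw]) (by simp [applyCmd, Cmd.cw]) fun σ => ?_
    have hk := code_lt σ
    rw [h₃ _ hk, dif_pos hk, code_injective (exists_code hk).choose_spec]

end Step

end MeanValue

namespace MeanValue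

open Matrix

/-! ### A step of the sweep on the machine -/

/-- An entry of the gate in the variable `124`, or of its adjoint. -/
def gateEnt (dag : Bool) (e e' f f' : IExp) : CExp :=
  if dag then .conj (.load 2 (16 * (iv 124 - 1) + 8 * f + 4 * f' + 2 * e + e'))
  else .load 2 (16 * (iv 124 - 1) + 8 * e + 4 * e' + 2 * f + f')

/-- An entry of the observable of the qubit in the variable `126`, or of its adjoint. -/
def obsEnt (dag : Bool) (e f : IExp) : CExp :=
  if dag then .conj (.load 1 (4 * iv 126 + 2 * f + e)) else .load 1 (4 * iv 126 + 2 * e + f)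

/-- Apply the gate of the layer `t` that begins at the qubit in the variable `126`. -/
def gateCmd (dag : Bool) (t : IExp) : Cmd :=
  .seq (iset 124 (.load 56 (t * iv 14 + iv 126)))
    (.ite (.ile 1 (iv 124))
      (.seq (iset 125 (.load 2 (2 * (iv 124 - 1) + 1)))
        (.ite (.and (ltE (rhoE (iv 126) + 1) (iv 15)) (ltE (rhoE (iv 125) + 1) (iv 15)))
          (pairCmd (gateEnt dag)) .skip)) .skip)

/-- Apply the observable of the qubit in the variable `126` if it belongs to the core. -/
def coreCmd : Cmd :=
  .ite (.and (.ile (iv 13) (rhoE (iv 126))) (ltE (rhoE (iv 126)) (3 * iv 13 + 1)))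
    (.ite (.ile (iv 100) 0) (siteCmd (obsEnt true)) (siteCmd (obsEnt false))) .skip

/-- Choose the outcome of the measurement of the qubit in the variable `126`. -/
def chooseCmd : Cmd :=
  .seq (normCmd 107 (ketbraE 0)) (.seq (normCmd 108 (ketbraE 1))
    (.ite (.cle (cv 107) (cv 102))
      (.seq (cset 102 (cv 102 - cv 107))
        (.ite (.cle (cv 108) (cv 102))
          (.seq (cset 102 (cv 102 - cv 108)) (.seq (cset 103 (cv 103 - cv 107 - cv 108))
            (.seq (iset 101 0) (.istore 103 (iv 126) 0))))
          (.seq (cset 103 (cv 108)) (.istore 103 (iv 126) 1))))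
      (.seq (cset 103 (cv 107)) (.istore 103 (iv 126) 0))))

/-- Measure and reset the qubit in the variable `126`. -/
def finishCmd : Cmd :=
  .seq (focusCmd 122 120 126)
    (.seq (.ite (.ile 1 (iv 101)) chooseCmd .skip) (applyCmd (ketbraE (.load 103 (iv 126)))))

/-- The step in the variable `111`. -/
def stepCmd : Cmd :=
  .ite (validE (iv 111))
    (.seq (iset 126 (qubitE (iv 111)))
      (.ite (ltE (tauE (iv 111)) (iv 13)) (gateCmd false (tauE (iv 111)))
        (.ite (.ile (tauE (iv 111)) (iv 13)) coreCmd
          (.ite (.ile (tauE (iv 111)) (2 * iv 13)) (gateCmd true (2 * iv 13 - tauE (iv 111)))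
            finishCmd)))) .skip

/-- The observables in the two halves of the computation. -/
noncomputable def halfOp {V : Type} (off : ℕ) (O : V → Matrix (Fin 2) (Fin 2) ℂ) (v : V) :
    Matrix (Fin 2) (Fin 2) ℂ := if off = 0 then (O v)ᴴ else O v

section Step

variable {V : Type} [Fintype V] [DecidableEq V] {G : SimpleGraph V} {D : Dims}
  {num : V ≃ Fin D.n} {hG : D.IsGrid G num} {off : ℕ} {ho : off ≤ 2 * D.d + 1}
  {U : Circuit G D.d} {O : V → Matrix (Fin 2) (Fin 2) ℂ} {nd : Node V} {u : ℝ} {s : State}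

theorem sep_eq_false_iff (v : V) :
    (Dims.layout hG off ho).sep v = false ↔ D.rho off (num v) + 1 + 1 ≤ D.H := by
  have h := D.rho_lt off (num v)
  change decide (D.rho off (num v) + 1 = D.H) = false ↔ _
  rw [decide_eq_false_iff_not]
  omega

/-- The program skips exactly when `gateAt` is the identity: there is no gate with first qubit `v`,
or the gate meets the separator. Otherwise the second qubit is within one position of `v`, hence in
the window. -/
theorem gateCmd_runs {B : Set V} (hl : Local (hG := hG) (ho := ho) B nd) {v : V}
    (hv : {u | (Dims.layout hG off ho).pos u ≤ (Dims.layout hG off ho).pos v + 1 ∧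
      (Dims.layout hG off ho).pos v ≤ (Dims.layout hG off ho).pos u + 1} ⊆ B)
    (h : Rel hG ho U O nd u s) (hq : s.imem 126 0 = num v) {dag : Bool} {e : IExp} {t : Fin D.d}
    (he : e.eval s = t) (hc : e.cost ≤ 20) :
    Runs (gateCmd dag e) s (1000 * 2 ^ D.w) (Rel hG ho U O { nd with Ψ :=
      (if dag then ((U t).gateAt (Dims.layout hG off ho).sep v)ᴴ
        else (U t).gateAt (Dims.layout hG off ho).sep v) *ᵥ nd.Ψ } u) := by
  have hN : 1 ≤ 2 ^ D.w := Nat.one_le_two_pow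
  set N := 2 ^ D.w with hNd
  set Λ := Dims.layout hG off ho with hΛ
  have hid : (U t).gateAt Λ.sep v = 1 → ∀ {s'}, Rel hG ho U O nd u s' →
      Rel hG ho U O { nd with Ψ := (if dag then ((U t).gateAt Λ.sep v)ᴴ
        else (U t).gateAt Λ.sep v) *ᵥ nd.Ψ } u s' := by
    intro h1 s' h'
    rw [h1]
    simpa using h'
  refine (Runs.seq (T := 40) (T' := 960 * N) ((Runs.istore ?_).mono ?_ fun _ h => h)).mono
    (by omega) fun _ h => h
  swap
  · simp only [IExp.cost_ofNat, IExp.cost_load, IExp.cost_add, IExp.cost_mul]; omega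
  set s₁ := s.setI 124 ((0 : IExp).eval s) ((IExp.load 56 (e * iv 14 + iv 126)).eval s) with hs₁
  have hf₁ : Frame [124] [] s s₁ :=
    ⟨fun a ha => State.setI_ne _ _ _ (by simpa using ha), fun _ _ => rfl⟩
  have h₁ := h.frame hf₁ (by simp) (by simp)
  have hk₁ : s₁.imem 124 0 = s.imem 56 (t * D.n + num v) := by
    rw [hs₁, State.setI_same]
    simp [he, hq, h.desc.n]
  -- The table holds the slot of the gate plus one, so that `0` means that there is no gate.
  refine (Runs.ite (T := 900 * N) (fun hb => ?_) fun hb => ?_).mono (by simp; omega) fun _ h => h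
  swap
  · refine (Runs.skip (hid ?_ h₁)).mono (by omega) fun _ h => h
    refine (U t).gateAt_of_forall_ne _ fun g hg hgv => hb ?_
    obtain ⟨k, hk, -⟩ := h.desc.gate_some t g hg
    simp [hk₁, ← hgv, hk]
  have hex : ∃ g ∈ (U t).gates, g.fst = v := by
    by_contra hne
    push Not at hne
    have := h.desc.gate_none t v hne
    simp [hk₁, this] at hb
  obtain ⟨g, hg, rfl⟩ := hex
  obtain ⟨k, hk, hk2, hkc⟩ := h.desc.gate_some t g hg
  rw [hk] at hk₁
  refine (Runs.seq (T := 20) (T' := 880 * N) ((Runs.istore ?_).mono (by simp) fun _ h => h)).mono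
    (by omega) fun _ h => h
  set s₂ := s₁.setI 125 ((0 : IExp).eval s₁) ((IExp.load 2 (2 * (iv 124 - 1) + 1)).eval s₁) with hs₂
  have hf₂ : Frame [125] [] s₁ s₂ :=
    ⟨fun a ha => State.setI_ne _ _ _ (by simpa using ha), fun _ _ => rfl⟩
  have h₂ := h₁.frame hf₂ (by simp) (by simp)
  have hq₂ : s₂.imem 126 0 = num g.fst := by
    rw [hf₂.imem _ (by simp), hf₁.imem _ (by simp), hq]
  have hq₂' : s₂.imem 125 0 = num g.snd := by
    rw [hs₂, State.setI_same]
    simp [hk₁, hf₁.imem 2 (by simp), hk2]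
  have e1 := (h₂.desc.qubit_eval hG.b_pos hG.c_pos h₂.off ho (e := iv 126) (by simp [hq₂])
    (num g.fst).2).1
  have e2 := (h₂.desc.qubit_eval hG.b_pos hG.c_pos h₂.off ho (e := iv 125) (by simp [hq₂'])
    (num g.snd).2).1
  have hcond : (BExp.and (ltE (rhoE (iv 126) + 1) (iv 15)) (ltE (rhoE (iv 125) + 1) (iv 15))).eval s₂ ↔
      Λ.sep g.fst = false ∧ Λ.sep g.snd = false := by
    rw [hΛ, sep_eq_false_iff, sep_eq_false_iff, BExp.eval_and, BExp.eval_ile, BExp.eval_ile,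
      IExp.eval_add, IExp.eval_add, IExp.eval_add, IExp.eval_add, e1, e2]
    simp only [IExp.eval_load, IExp.eval_ofNat, h₂.desc.H]
  have hga := (U t).gateAt_of_mem Λ.sep hg
  refine (Runs.ite (T := 800 * N) (fun hb => ?_) fun hb => ?_).mono (by simp; omega) fun _ h => h
  swap
  · refine (Runs.skip (hid ?_ h₂)).mono (by omega) fun _ h => h
    rw [hga, if_neg fun h' => hb (hcond.2 h')]
  have hsep := hcond.1 hb
  rw [hga, if_pos hsep, g.op_eq_pair, pair_conjTranspose]
  have hent : ∀ s', Frame [110, 120, 121, 122, 123] [101] s₂ s' →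
      ∀ (r r' c c' : Fin 2) e e' f f', e.eval s' = (r : ℕ) → e'.eval s' = (r' : ℕ) →
        f.eval s' = (c : ℕ) → f'.eval s' = (c' : ℕ) → (gateEnt dag e e' f f').eval s' =
      (if dag then (g.mat : Matrix (Fin 2 × Fin 2) (Fin 2 × Fin 2) ℂ)ᴴ else
        (g.mat : Matrix (Fin 2 × Fin 2) (Fin 2 × Fin 2) ℂ)) (r, r') (c, c') := by
    intro s' hf r r' c c' e e' f f' he he' hf1 hf2
    have hk' : s'.imem 124 0 = k + 1 := by
      rw [hf.imem _ (by simp), hf₂.imem _ (by simp), hk₁]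
    have hc' : s'.cmem 2 = s.cmem 2 := by
      rw [hf.cmem _ (by simp), hf₂.cmem _ (by simp), hf₁.cmem _ (by simp)]
    unfold gateEnt
    cases dag
    · simp [he, he', hf1, hf2, hk', hc', hkc]
    · simp [he, he', hf1, hf2, hk', hc', hkc, Matrix.conjTranspose_apply]
  have hr := pairCmd_runs hl (hv ⟨by omega, by omega⟩ : g.fst ∈ B)
    (hv ⟨Λ.pos_le _ _ g.adj.symm hsep.2 hsep.1, Λ.pos_le _ _ g.adj hsep.1 hsep.2⟩)
    g.adj.ne h₂ hq₂ hq₂' hent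
  refine hr.mono ?_ fun s' h' => ?_
  · have : (pairE (gateEnt dag)).cost ≤ 400 := by cases dag <;> simp [gateEnt]
    rw [← hNd]
    have := Nat.mul_le_mul_left N (show (pairE (gateEnt dag)).cost + 107 ≤ 507 by omega)
    omega
  · cases dag <;> exact h'

theorem coreCmd_runs {B : Set V} (hl : Local (hG := hG) (ho := ho) B nd) {v : V} (hv : v ∈ B)
    (h : Rel hG ho U O nd u s) (hq : s.imem 126 0 = num v) :
    Runs coreCmd s (1000 * 2 ^ D.w) (Rel hG ho U O
      { nd with Ψ := site v ((Dims.layout hG off ho).coreOp (halfOp off O) v) *ᵥ nd.Ψ } u) := by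
  have hN : 1 ≤ 2 ^ D.w := Nat.one_le_two_pow
  set N := 2 ^ D.w with hNd
  have e1 := (h.desc.qubit_eval hG.b_pos hG.c_pos h.off ho (e := iv 126) (by simp [hq])
    (num v).2).1
  have hcond : (BExp.and (.ile (iv 13) (rhoE (iv 126)))
      (ltE (rhoE (iv 126)) (3 * iv 13 + 1))).eval s ↔ (Dims.layout hG off ho).core v = true := by
    change _ ↔ decide (D.d ≤ D.rho off (num v) ∧ D.rho off (num v) < 3 * D.d + 1) = true
    rw [decide_eq_true_iff, BExp.eval_and, BExp.eval_ile, BExp.eval_ile, IExp.eval_add, e1]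
    simp only [IExp.eval_load, IExp.eval_ofNat, IExp.eval_add, IExp.eval_mul, h.desc.d]
    rfl
  have hcost : ∀ dag, (siteE (obsEnt dag)).cost ≤ 200 := by
    intro dag; cases dag <;> simp [obsEnt]
  have hent : ∀ dag s', Frame [110, 120, 121, 122, 123] [101] s s' →
      ∀ (r c : Fin 2) e f, e.eval s' = (r : ℕ) → f.eval s' = (c : ℕ) →
        (obsEnt dag e f).eval s' = (if dag then (O v)ᴴ else O v) r c := by
    intro dag s' hf r c e f he hf'
    have hc' : s'.cmem 1 = s.cmem 1 := hf.cmem _ (by simp)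
    have hq' : s'.imem 126 0 = num v := by rw [hf.imem _ (by simp), hq]
    unfold obsEnt
    cases dag
    · simp [he, hf', hc', hq', h.desc.obs]
    · simp [he, hf', hc', hq', h.desc.obs, Matrix.conjTranspose_apply]
  have hrun : ∀ dag, Runs (siteCmd (obsEnt dag)) s (800 * N)
      (Rel hG ho U O { nd with Ψ := site v (if dag then (O v)ᴴ else O v) *ᵥ nd.Ψ } u) := by
    intro dag
    refine (siteCmd_runs hl hv h hq (hent dag)).mono ?_ fun _ h => h
    rw [← hNd]
    have := Nat.mul_le_mul_left N (show (siteE (obsEnt dag)).cost + 71 ≤ 271 by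
      have := hcost dag; omega)
    omega
  refine (Runs.ite (T := 900 * N) (fun hb => ?_) fun hb => ?_).mono (by simp; omega) fun _ h => h
  · rw [Layout.coreOp, if_pos (hcond.1 hb), halfOp]
    refine (Runs.ite (T := 800 * N) (fun hb => ?_) fun hb => ?_).mono (by simp; omega)
      fun _ h => h
    · have : off = 0 := by simpa [h.off] using hb
      rw [if_pos this]
      exact hrun true
    · have : off ≠ 0 := by simpa [h.off] using hb
      rw [if_neg this]
      exact hrun false
  · rw [Layout.coreOp, if_neg fun h' => hb (hcond.2 h'), site_one, Matrix.one_mulVec]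
    exact (Runs.skip h).mono (by omega) fun _ h => h

end Step

end MeanValue

namespace MeanValue

open Matrix

/-! ### Measurements on the machine and the complete step of the sweep. -/

section Step

variable {V : Type} [Fintype V] [DecidableEq V] {G : SimpleGraph V} {D : Dims}
  {num : V ≃ Fin D.n} {hG : D.IsGrid G num} {off : ℕ} {ho : off ≤ 2 * D.d + 1}
  {U : Circuit G D.d} {O : V → Matrix (Fin 2) (Fin 2) ℂ} {nd : Node V} {u : ℝ} {s : State}

/-- The variables of the program point to the qubit `v`. -/
structure Focus (hG : D.IsGrid G num) (ho : off ≤ 2 * D.d + 1) (v : V) (s : State) : Prop where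
  p : s.imem 122 0 = 2 ^ (place hG ho v : ℕ)
  bits : ∀ k < 2 ^ D.w, s.imem 120 k = k / 2 ^ (place hG ho v : ℕ) % 2
  q : s.imem 126 0 = num v

theorem Focus.frame {v : V} (h : Focus hG ho v s) {A C : List ℕ} {s' : State}
    (hf : Frame A C s s') (hA : 120 ∉ A ∧ 122 ∉ A ∧ 126 ∉ A) : Focus hG ho v s' where
  p := by rw [hf.imem _ hA.2.1]; exact h.p
  bits := by rw [hf.imem _ hA.1]; exact h.bits
  q := by rw [hf.imem _ hA.2.2]; exact h.q

/-- The vector that results from a projection, as a function of the address. -/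
noncomputable def projected (hG : D.IsGrid G num) (ho : off ≤ 2 * D.d + 1) (Ψ : (V → Fin 2) → ℂ)
    (v : V) (c : Fin 2) (k : ℕ) : ℂ :=
  if hk : k < 2 ^ D.w then
    push (place hG ho) (site v (ketbra c) *ᵥ Ψ) (exists_code hk).choose else 0

theorem projected_code (Ψ : (V → Fin 2) → ℂ) (v : V) (c : Fin 2) (σ : Fin D.w → Fin 2) :
    projected hG ho Ψ v c (code σ) = push (place hG ho) (site v (ketbra c) *ᵥ Ψ) σ := by
  have hk := code_lt σ
  rw [projected, dif_pos hk, code_injective (exists_code hk).choose_spec]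

theorem ketbraE_eval_projected {B : Set V} (hl : Local (hG := hG) (ho := ho) B nd) {v : V}
    (hv : v ∈ B) (h : Rel hG ho U O nd u s) (hF : Focus hG ho v s) {b : IExp} {c : Fin 2}
    (hb : b.eval s = (c : ℕ)) {k : ℕ} (hk : k < 2 ^ D.w) (hi : s.imem 110 0 = k) :
    (ketbraE b).eval s = projected hG ho nd.Ψ v c k := by
  obtain ⟨σ, rfl⟩ := exists_code hk
  rw [projected_code, push_site hl.inj hl.supp hv]
  exact ketbraE_eval h.psi (hF.bits _ hk) hF.p hi hb

theorem sum_normSq_projected {B : Set V} (hl : Local (hG := hG) (ho := ho) B nd) {v : V}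
    (hv : v ∈ B) (c : Fin 2) :
    ∑ k ∈ Finset.range (2 ^ D.w), Complex.normSq (projected hG ho nd.Ψ v c k) =
      nsq (site v (ketbra c) *ᵥ nd.Ψ) := by
  rw [sum_range_code, ← nsq_push hl.inj (site_supp hl.supp hv _), nsq]
  exact Finset.sum_congr rfl fun σ _ => by rw [projected_code]

theorem normCmd_ketbra_runs {B : Set V} (hl : Local (hG := hG) (ho := ho) B nd) {v : V}
    (hv : v ∈ B) (h : Rel hG ho U O nd u s) (hF : Focus hG ho v s) {b : IExp} {c : Fin 2}
    (hb : ∀ s, b.eval s = (c : ℕ)) {a : ℕ} (ha : 103 < a) :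
    Runs (normCmd a (ketbraE b)) s (14 + 2 ^ D.w * (2 * (ketbraE b).cost + 21)) fun s' =>
      s'.cmem a 0 = (nsq (site v (ketbra c) *ᵥ nd.Ψ) : ℝ) := by
  refine (normCmd_runs h.desc.size (projected hG ho nd.Ψ v c) fun k hk s' hf hi => ?_).mono
    le_rfl fun s' hs' => ?_
  · have h' := h.frame hf (by simp) (by simp [ha])
    exact ketbraE_eval_projected hl hv h' (hF.frame hf (by simp)) (hb s') hk hi
  · rw [hs', sum_normSq_projected hl hv]

theorem Rel.node (h : Rel hG ho U O nd u s) {s' : State} (hf : Frame [101, 103] [102, 103] s s')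
    {x : V → Fin 2} {N u' : ℝ} {on : Bool} (hx : ∀ v, s'.imem 103 (num v) = x v)
    (hon : s'.imem 101 0 = on.toNat) (hu : s'.cmem 102 0 = u') (hN : s'.cmem 103 0 = N) :
    Rel hG ho U O ⟨nd.Ψ, x, N, on⟩ u' s' where
  desc := h.desc.frame hf (by simp) (by simp)
  off := by rw [hf.imem _ (by simp)]; exact h.off
  psi := by rw [hf.cmem _ (by simp)]; exact h.psi
  x := hx
  on := hon
  u := hu
  N := hN

theorem Rel.update_x (h : Rel hG ho U O nd u s) (v : V) (b : Fin 2) (w : V) :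
    Function.update (s.imem 103) (num v : ℕ) b (num w) = (Function.update nd.x v b w : ℕ) := by
  by_cases hw : w = v
  · subst hw; simp
  · rw [Function.update_of_ne hw, Function.update_of_ne, h.x]
    intro e
    exact hw (num.injective (Fin.ext e))

/-- The node that is chosen when the qubit `v` is measured. -/
noncomputable def choice (nd : Node V) (v : V) (u : ℝ) : Node V × ℝ :=
  if u < nsq (site v (ketbra 0) *ᵥ nd.Ψ) then
    (⟨site v (ketbra 0) *ᵥ nd.Ψ, Function.update nd.x v 0, nsq (site v (ketbra 0) *ᵥ nd.Ψ), true⟩, u)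
  else if u - nsq (site v (ketbra 0) *ᵥ nd.Ψ) < nsq (site v (ketbra 1) *ᵥ nd.Ψ) then
    (⟨site v (ketbra 1) *ᵥ nd.Ψ, Function.update nd.x v 1, nsq (site v (ketbra 1) *ᵥ nd.Ψ), true⟩,
      u - nsq (site v (ketbra 0) *ᵥ nd.Ψ))
  else
    (⟨site v (ketbra 0) *ᵥ nd.Ψ, Function.update nd.x v 0,
      nd.N - nsq (site v (ketbra 0) *ᵥ nd.Ψ) - nsq (site v (ketbra 1) *ᵥ nd.Ψ), false⟩,
      u - nsq (site v (ketbra 0) *ᵥ nd.Ψ) - nsq (site v (ketbra 1) *ᵥ nd.Ψ))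

/-- In all three branches, the dead one included, the new vector is the projection onto the recorded
outcome. So the machine can record the outcome first and project afterwards by one command. -/
theorem choice_Ψ (nd : Node V) (v : V) (u : ℝ) :
    (choice nd v u).1.Ψ = site v (ketbra ((choice nd v u).1.x v)) *ᵥ nd.Ψ := by
  unfold choice
  split_ifs <;> simp

theorem locate_branches (Λ : Layout G D.d) (O' : V → Matrix (Fin 2) (Fin 2) ℂ) {i : ℕ × V}
    (hi : ¬ i.1 < 2 * D.d + 1) :
    locate Node.N (Λ.branches U O' i nd) u = if nd.on = true then choice nd i.2 u
      else ({ nd with Ψ := site i.2 (ketbra (nd.x i.2)) *ᵥ nd.Ψ }, u) := by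
  unfold Layout.branches choice
  rw [if_neg hi]
  split_ifs with h1 h2 h3
  · rw [locate, if_pos h2]
  · rw [locate, if_neg h2, locate, if_pos h3]
  · rw [locate, if_neg h2, locate, if_neg h3, locate]
  · rfl

/-- The outcome, the weight, the residue and the switch are updated, but the vector is not yet
projected; hence the old `Ψ` in the conclusion. -/
theorem chooseCmd_runs {B : Set V} (hl : Local (hG := hG) (ho := ho) B nd) {v : V}
    (hv : v ∈ B) (h : Rel hG ho U O nd u s) (hF : Focus hG ho v s) (hon : nd.on = true) :
    Runs chooseCmd s (500 * 2 ^ D.w) (Rel hG ho U O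
      { (choice nd v u).1 with Ψ := nd.Ψ } (choice nd v u).2) := by
  have hN : 1 ≤ 2 ^ D.w := Nat.one_le_two_pow
  set N := 2 ^ D.w with hNd
  refine (Runs.seq (T := 100 * N) (T' := 400 * N)
    ((normCmd_ketbra_runs hl hv h hF (b := 0) (c := 0) (fun _ => rfl) (by decide)).frame.mono ?_
      ?_)).mono (by omega) fun _ h => h
  · simp; omega
  rintro s₁ ⟨hn0, hf, -⟩
  have hf₁ : Frame [110] [107] s s₁ :=
    hf.mono (by simp [normCmd, Cmd.iw]) (by simp [normCmd, Cmd.cw])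
  have h₁ := h.frame hf₁ (by simp) (by simp)
  refine (Runs.seq (T := 100 * N) (T' := 300 * N)
    ((normCmd_ketbra_runs hl hv h₁ (hF.frame hf₁ (by simp)) (b := 1) (c := 1) (fun _ => rfl)
      (by decide)).frame.mono ?_ ?_)).mono (by omega) fun _ h => h
  · simp; omega
  rintro s₂ ⟨hn1, hf, -⟩
  have hf₂ : Frame [110] [108] s₁ s₂ :=
    hf.mono (by simp [normCmd, Cmd.iw]) (by simp [normCmd, Cmd.cw])
  have h₂ := h₁.frame hf₂ (by simp) (by simp)
  have hq := ((hF.frame hf₁ (by simp)).frame hf₂ (by simp)).q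
  replace hn0 : s₂.cmem 107 0 = (nsq (site v (ketbra 0) *ᵥ nd.Ψ) : ℝ) := by
    rw [hf₂.cmem _ (by simp), hn0]
  clear hf₁ hf₂ h₁ hF
  unfold choice
  set n0 := nsq (site v (ketbra 0) *ᵥ nd.Ψ)
  set n1 := nsq (site v (ketbra 1) *ᵥ nd.Ψ)
  have hu := h₂.u
  have hN' := h₂.N
  refine (Runs.ite (T := 200 * N) (fun hb => ?_) fun hb => ?_).mono (by simp; omega) fun _ h => h
  · have hb' : ¬ u < n0 := by
      rw [not_lt]; simpa [hn0, hu] using hb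
    rw [if_neg hb']
    refine (Runs.seq (T := 7) (T' := 100 * N) ((Runs.cstore ?_).mono (by simp)
      fun _ h => h)).mono (by omega) fun _ h => h
    refine (Runs.ite (T := 50 * N) (fun hb => ?_) fun hb => ?_).mono (by simp; omega) fun _ h => h
    · have hb'' : ¬ u - n0 < n1 := by
        rw [not_lt]; simpa [hn0, hn1, hu, State.cmem_setC] using hb
      rw [if_neg hb'']
      refine (Runs.seq (T := 7) (T' := 43) ((Runs.cstore ?_).mono (by simp)
        fun _ h => h)).mono (by omega) fun _ h => h
      refine (Runs.seq (T := 10) (T' := 33) ((Runs.cstore ?_).mono (by simp)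
        fun _ h => h)).mono (by omega) fun _ h => h
      refine (Runs.seq (T := 10) (T' := 23) ((Runs.istore ?_).mono (by simp)
        fun _ h => h)).mono (by omega) fun _ h => h
      refine (Runs.istore ?_).mono (by simp) fun _ h => h
      refine h₂.node ⟨fun a ha => ?_, fun a ha => ?_⟩ ?_ ?_ ?_ ?_
      · simp at ha; simp [State.imem_setI, ha]
      · simp at ha; simp [State.cmem_setC, ha]
      · intro w; simpa [State.imem_setI, hq] using h₂.update_x v 0 w
      · simp [State.imem_setI]
      · simp [State.cmem_setC, hu, hn0, hn1]
      · simp [State.cmem_setC, hN', hn0, hn1]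
    · have hb'' : u - n0 < n1 := by
        rw [← not_le]; simpa [hn0, hn1, hu, State.cmem_setC] using hb
      rw [if_pos hb'']
      refine (Runs.seq (T := 7) (T' := 43) ((Runs.cstore ?_).mono (by simp)
        fun _ h => h)).mono (by omega) fun _ h => h
      refine (Runs.istore ?_).mono (by simp) fun _ h => h
      refine h₂.node ⟨fun a ha => ?_, fun a ha => ?_⟩ ?_ ?_ ?_ ?_
      · simp at ha; simp [State.imem_setI, ha]
      · simp at ha; simp [State.cmem_setC, ha]
      · intro w; simpa [State.imem_setI, hq] using h₂.update_x v 1 w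
      · simpa [State.imem_setI, hon] using h₂.on
      · simp [State.cmem_setC, hu, hn0]
      · simp [State.cmem_setC, hn1]
  · have hb' : u < n0 := by
      rw [← not_le]; simpa [hn0, hu] using hb
    rw [if_pos hb']
    refine (Runs.seq (T := 7) (T' := 100 * N) ((Runs.cstore ?_).mono (by simp)
      fun _ h => h)).mono (by omega) fun _ h => h
    refine (Runs.istore ?_).mono (by simp; omega) fun _ h => h
    refine h₂.node ⟨fun a ha => ?_, fun a ha => ?_⟩ ?_ ?_ ?_ ?_
    · simp at ha; simp [State.imem_setI, ha]
    · simp at ha; simp [State.cmem_setC, ha]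
    · intro w; simpa [State.imem_setI, hq] using h₂.update_x v 0 w
    · simpa [State.imem_setI, hon] using h₂.on
    · simp [State.cmem_setC, hu]
    · simp [State.cmem_setC, hn0]

theorem finishCmd_runs {B : Set V} (hl : Local (hG := hG) (ho := ho) B nd) {v : V}
    (hv : v ∈ B) (h : Rel hG ho U O nd u s) (hq : s.imem 126 0 = num v) :
    Runs finishCmd s (1000 * 2 ^ D.w) fun s' =>
      Rel hG ho U O (if nd.on = true then choice nd v u
        else ({ nd with Ψ := site v (ketbra (nd.x v)) *ᵥ nd.Ψ }, u)).1
        (if nd.on = true then choice nd v u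
        else ({ nd with Ψ := site v (ketbra (nd.x v)) *ᵥ nd.Ψ }, u)).2 s' := by
  have hN : 1 ≤ 2 ^ D.w := Nat.one_le_two_pow
  -- Sampling and replaying prescribed outcomes are treated together: in both modes the recorded bit
  -- determines the projection that follows.
  have hΨ : ∀ p : Node V × ℝ, p = (if nd.on = true then choice nd v u
      else ({ nd with Ψ := site v (ketbra (nd.x v)) *ᵥ nd.Ψ }, u)) →
      p.1.Ψ = site v (ketbra (p.1.x v)) *ᵥ nd.Ψ ∧
      ∀ T s, (nd.on = true → Runs chooseCmd s T (Rel hG ho U O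
        { (choice nd v u).1 with Ψ := nd.Ψ } (choice nd v u).2)) →
      (Rel hG ho U O nd u s) → 1 ≤ T →
      Runs (.ite (.ile 1 (iv 101)) chooseCmd .skip) s (4 + T)
        (Rel hG ho U O { p.1 with Ψ := nd.Ψ } p.2) := by
    rintro p rfl
    by_cases hon : nd.on = true
    · rw [if_pos hon]
      refine ⟨choice_Ψ nd v u, fun T s h h' hT => ?_⟩
      refine Runs.ite (fun _ => h hon) fun hb => absurd ?_ hb
      simp [h'.on, hon]
    · rw [if_neg hon]
      refine ⟨rfl, fun T s h h' hT => ?_⟩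
      refine Runs.ite (fun hb => absurd hb ?_) fun _ => (Runs.skip h').mono hT fun _ h => h
      simp [h'.on, hon]
  obtain ⟨hp1, hp2⟩ := hΨ _ rfl
  set p := (if nd.on = true then choice nd v u
        else ({ nd with Ψ := site v (ketbra (nd.x v)) *ᵥ nd.Ψ }, u))
  refine (Runs.seq (T := 49 + 2 ^ D.w * 36) (T' := 900 * 2 ^ D.w)
    ((focusCmd_runs (hG := hG) (ho := ho) (by decide) (by decide) (by decide) (by decide)
      (by decide) h.desc h.off hq).frame.mono le_rfl ?_)).mono (by omega) fun _ h => h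
  rintro s₁ ⟨⟨hp, hb⟩, hf, -⟩
  have hf' : Frame [110, 120, 122] [] s s₁ :=
    hf.mono (by simp [focusCmd, bitsCmd, Cmd.iw]) (by simp [focusCmd, bitsCmd, Cmd.cw])
  have h₁ := h.frame hf' (by simp) (by simp)
  have hF : Focus hG ho v s₁ := ⟨hp, hb, by rw [hf'.imem _ (by simp), hq]⟩
  refine (Runs.seq (T := 4 + 500 * 2 ^ D.w) (T' := 300 * 2 ^ D.w)
    ((hp2 _ _ (chooseCmd_runs hl hv h₁ hF) h₁ (by omega)).frame.mono le_rfl ?_)).mono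
    (by omega) fun _ h => h
  rintro s₂ ⟨h₂, hf₂, -⟩
  have hF₂ := hF.frame hf₂ (by simp [chooseCmd, normCmd, Cmd.iw])
  have hl₂ : Local (hG := hG) (ho := ho) B { p.1 with Ψ := nd.Ψ } := ⟨hl.inj, hl.supp⟩
  refine (applyCmd_runs h₂.desc.size (projected hG ho nd.Ψ v (p.1.x v)) ?_).frame.mono ?_ ?_
  · intro k hk s₃ hf₃ hi
    have h₃ := h₂.frame hf₃ (by simp) (by simp)
    have hF₃ := hF₂.frame hf₃ (by simp)
    refine ketbraE_eval_projected hl₂ hv h₃ hF₃ ?_ hk hi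
    simp [hF₃.q, h₃.x]
  · simp; omega
  · rintro s₃ ⟨h₃, hf₃, -⟩
    have := h₂.update (Ψ := p.1.Ψ) hf₃ (by simp [applyCmd, Cmd.iw]) (by simp [applyCmd, Cmd.cw])
      fun σ => by rw [h₃ _ (code_lt σ), projected_code, hp1]
    exact this

/-- The result of a step of the sweep. -/
noncomputable def stepNode (Λ : Layout G D.d) (U : Circuit G D.d)
    (O : V → Matrix (Fin 2) (Fin 2) ℂ) (j : ℕ) (p : Node V × ℝ) : Node V × ℝ :=
  match Λ.item j with
  | none => p
  | some i => locate Node.N (Λ.branches U O i p.1) p.2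

theorem stepNode_tidy (Λ : Layout G D.d) (O' : V → Matrix (Fin 2) (Fin 2) ℂ) {j : ℕ}
    (h : Λ.Tidy j nd.Ψ) : Λ.Tidy (j + 1) (stepNode Λ U O' j (nd, u)).1.Ψ := by
  unfold stepNode
  cases hi : Λ.item j with
  | none => exact h.step_none Λ hi
  | some i =>
    -- Whatever branch is taken, the vector changes by `itemOp` for some `x`: the configuration with
    -- the outcome just chosen, the prescribed one, or any one at all at earlier times.
    have key := fun x => h.step Λ U O' x hi
    dsimp only
    by_cases h1 : i.1 < 2 * D.d + 1
    · have := key 0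
      rw [Layout.itemOp, if_pos h1] at this
      rw [Layout.branches, if_pos h1, locate]
      exact this
    · rw [locate_branches Λ O' h1]
      split_ifs with hon
      · have := key (choice nd i.2 u).1.x
        rwa [Layout.itemOp, if_neg h1, ← choice_Ψ] at this
      · have := key nd.x
        rwa [Layout.itemOp, if_neg h1] at this

theorem stepCmd_runs {j : ℕ} (hj : j < D.J) (h : Rel hG ho U O nd u s)
    (ht : (Dims.layout hG off ho).Tidy j nd.Ψ) (hjs : s.imem 111 0 = j) :
    Runs stepCmd s (2000 * 2 ^ D.w) (Rel hG ho U O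
      (stepNode (Dims.layout hG off ho) U (halfOp off O) j (nd, u)).1
      (stepNode (Dims.layout hG off ho) U (halfOp off O) j (nd, u)).2) := by
  have hN : 1 ≤ 2 ^ D.w := Nat.one_le_two_pow
  set N := 2 ^ D.w with hNd
  set Λ := Dims.layout hG off ho with hΛ
  obtain ⟨e1, e2, e3⟩ := h.desc.step_eval h.off (e := iv 111) (by simp [hjs]) hj
  refine (Runs.ite (T := 1800 * N) (fun hb => ?_) fun hb => ?_).mono (by simp; omega) fun _ h => h
  swap
  · rw [stepNode, Dims.not_valid_spec hG ho fun hv => hb (e3.2 hv)]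
    exact (Runs.skip h).mono (by omega) fun _ h => h
  obtain ⟨v, hvq, hi⟩ := (e3.1 hb).spec hG ho
  have hle : D.tauOf j ≤ 2 * D.d + 1 := (Λ.item_eq_some_iff.1 hi).1
  refine (Runs.seq (T := 100) (T' := 1700 * N) ((Runs.istore ?_).mono (by simp)
    fun _ h => h)).mono (by omega) fun _ h => h
  set s₁ := s.setI 126 ((0 : IExp).eval s) ((qubitE (iv 111)).eval s) with hs₁
  have hf₁ : Frame [126] [] s s₁ :=
    ⟨fun a ha => State.setI_ne _ _ _ (by simpa using ha), fun _ _ => rfl⟩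
  have h₁ := h.frame hf₁ (by simp) (by simp)
  have hq₁ : s₁.imem 126 0 = num v := by
    rw [hs₁, State.setI_same, e2, hvq]; simp
  have hτ : (tauE (iv 111)).eval s₁ = D.tauOf j :=
    (h₁.desc.step_eval h₁.off (e := iv 111) (by simp [hf₁.imem 111 (by simp), hjs]) hj).1
  have hd : s₁.imem 13 0 = D.d := h₁.desc.d
  -- Tidiness confines the support to the window of the current stage. It is what justifies working
  -- with the compressed vector.
  have hl : Local (hG := hG) (ho := ho) (Λ.window (Λ.key (D.tauOf j, v))) nd :=
    ⟨fun a ha b hb hab => Λ.slot_injOn _ ha hb (congrArg Fin.val hab),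
      fun y hy w hw => ht.mem_window Λ hi hy hw⟩
  have htouch := Λ.touch_subset_window hle (i := (D.tauOf j, v))
  rw [stepNode, hi]
  dsimp only
  clear_value s₁
  by_cases h1 : D.tauOf j < 2 * D.d + 1
  · have ht' : {w | Λ.pos w ≤ Λ.pos v + 1 ∧ Λ.pos v ≤ Λ.pos w + 1} ⊆
        Λ.window (Λ.key (D.tauOf j, v)) := by
      rwa [Layout.touch, if_pos h1] at htouch
    rw [Layout.branches, if_pos h1, locate]
    unfold Layout.stepOp
    dsimp only
    refine (Runs.ite (T := 1600 * N) (fun hb => ?_) fun hb => ?_).mono (by simp; omega)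
      fun _ h => h
    · have hlt : D.tauOf j < D.d := by
        rw [BExp.eval_ile, IExp.eval_add, hτ] at hb
        simpa [hd] using hb
      rw [dif_pos hlt]
      have := gateCmd_runs hl ht' h₁ hq₁ (dag := false) (t := ⟨_, hlt⟩) hτ (by simp)
      exact this.mono (by omega) fun _ h => h
    · have hlt : ¬ D.tauOf j < D.d := by
        rw [BExp.eval_ile, IExp.eval_add, hτ] at hb
        simpa [hd] using hb
      rw [dif_neg hlt]
      refine (Runs.ite (T := 1500 * N) (fun hb => ?_) fun hb => ?_).mono (by simp; omega)
        fun _ h => h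
      · have he : D.tauOf j = D.d := by
          rw [BExp.eval_ile, hτ] at hb
          have : D.tauOf j ≤ D.d := by simpa [hd] using hb
          omega
        rw [if_pos he]
        exact (coreCmd_runs hl (ht' ⟨Nat.le_succ _, Nat.le_succ _⟩) h₁ hq₁).mono (by omega)
          fun _ h => h
      · have hne : D.d < D.tauOf j := by
          rw [BExp.eval_ile, hτ] at hb
          simpa [hd] using hb
        rw [if_neg (by omega)]
        refine (Runs.ite (T := 1400 * N) (fun hb => ?_) fun hb => absurd ?_ hb).mono
          (by simp; omega) fun _ h => h
        · have hlt : 2 * D.d - D.tauOf j < D.d := by omega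
          rw [dif_pos hlt]
          have := gateCmd_runs hl ht' h₁ hq₁ (dag := true) (e := 2 * iv 13 - tauE (iv 111))
            (t := ⟨_, hlt⟩) (by rw [IExp.eval_sub, hτ]; simp [hd]) (by simp)
          exact this.mono (by omega) fun _ h => h
        · rw [BExp.eval_ile, hτ]
          simp [hd]
          omega
  · rw [locate_branches Λ _ h1]
    refine (Runs.ite (T := 1600 * N) (fun hb => absurd hb ?_) fun _ => ?_).mono (by simp; omega)
      fun _ h => h
    · rw [BExp.eval_ile, IExp.eval_add, hτ]
      simp [hd]
      omega
    refine (Runs.ite (T := 1500 * N) (fun hb => absurd hb ?_) fun _ => ?_).mono (by simp; omega)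
      fun _ h => h
    · rw [BExp.eval_ile, hτ]
      simp [hd]
      omega
    refine (Runs.ite (T := 1400 * N) (fun hb => absurd hb ?_) fun _ => ?_).mono (by simp; omega)
      fun _ h => h
    · rw [BExp.eval_ile, hτ]
      simp [hd]
      omega
    refine (finishCmd_runs hl (htouch ?_) h₁ hq₁).mono (by omega) fun _ h => h
    rw [Layout.touch, if_neg h1]
    rfl

end Step

end MeanValue

namespace MeanValue

open Matrix

/-! ### A sample on the machine -/

/-- Run the sweep from the initial state. -/
def runCmd : Cmd :=
  .seq (forLoop 110 19 (.cstore 100 (iv 110) 0))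
    (.seq (.cstore 100 0 1) (forLoop 111 21 stepCmd))

/-- Draw a sample and add its value to the variable `105`. -/
def sampleCmd : Cmd :=
  .seq (forLoop 110 14 (.istore 103 (iv 110) 0)) (.seq (cset 103 1) (.seq (iset 100 0)
    (.seq (iset 101 1) (.seq runCmd (.seq (cset 106 (cv 100)) (.seq (iset 104 (iv 101))
      (.seq (iset 100 (2 * iv 13 + 1)) (.seq (iset 101 0) (.seq runCmd
        (.seq (.ite (.ile 1 (iv 104)) (cset 105 (cv 105 + .conj (cv 106) * cv 100 / cv 103)) .skip)
          (cset 102 (cv 102 / cv 103))))))))))))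

/-- Compute the mean of the samples. -/
def averageCmd : Cmd :=
  .seq (cset 105 0) (.seq (forLoop 112 24 sampleCmd) (cset 3 (cv 105 / CExp.cast (iv 24))))

theorem stepCmd_iw : ∀ a ∈ stepCmd.iw, a = 101 ∨ a = 103 ∨ a = 110 ∨ 120 ≤ a := by
  simp [stepCmd, gateCmd, coreCmd, finishCmd, chooseCmd, focusCmd, bitsCmd, pairCmd, siteCmd,
    applyCmd, normCmd, Cmd.iw]

theorem stepCmd_cw : ∀ a ∈ stepCmd.cw, a ≤ 103 ∨ a = 107 ∨ a = 108 := by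
  simp [stepCmd, gateCmd, coreCmd, finishCmd, chooseCmd, focusCmd, bitsCmd, pairCmd, siteCmd,
    applyCmd, normCmd, Cmd.cw]

theorem runCmd_iw : ∀ a ∈ runCmd.iw, a = 101 ∨ a = 103 ∨ a = 110 ∨ a = 111 ∨ 120 ≤ a := by
  intro a ha
  simp only [runCmd, Cmd.iw, forLoop_iw, List.mem_append, List.mem_cons, List.not_mem_nil,
    or_false, false_or] at ha
  have := stepCmd_iw a
  tauto

theorem runCmd_cw : ∀ a ∈ runCmd.cw, a ≤ 103 ∨ a = 107 ∨ a = 108 := by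
  intro a ha
  simp only [runCmd, Cmd.cw, forLoop_cw, List.mem_append, List.mem_cons, List.not_mem_nil,
    or_false] at ha
  rcases ha with h | h | h
  · omega
  · omega
  · exact stepCmd_cw a h

theorem sampleCmd_iw : ∀ a ∈ sampleCmd.iw, 100 ≤ a ∧ a ≠ 112 := by
  intro a ha
  simp only [sampleCmd, Cmd.iw, forLoop_iw, List.mem_append, List.mem_cons, List.not_mem_nil,
    or_false, false_or] at ha
  by_cases h : a ∈ runCmd.iw
  · have := runCmd_iw a h
    omega
  · simp only [h, false_or, or_false] at ha
    omega

namespace Layout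

variable {V : Type} [Fintype V] [DecidableEq V] {G : SimpleGraph V} {d : ℕ} (Λ : Layout G d)
  (U : Circuit G d) (O : V → Matrix (Fin 2) (Fin 2) ℂ)

/-- Switched off, the sampler makes no choices and consumes no randomness. The same program thus
evaluates an amplitude for prescribed outcomes. -/
theorem sweep_off (l : List (ℕ × V)) {nd : Node V} (h : nd.on = false) (u : ℝ) :
    Λ.sweep U O l (nd, u) = ({ nd with Ψ := Λ.runOp U O nd.x l *ᵥ nd.Ψ }, u) := by
  induction l generalizing nd with
  | nil => simp [sweep, runOp]
  | cons i l ih =>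
    have hb : Λ.branches U O i nd = [{ nd with Ψ := Λ.itemOp U O nd.x i *ᵥ nd.Ψ }] := by
      unfold branches itemOp
      by_cases hi : i.1 < 2 * d + 1 <;> simp [hi, h]
    rw [sweep, hb, locate, ih (by exact h), runOp_cons, Matrix.mulVec_mulVec]

/-- After the last step every qubit has been finished and reset, so the amplitude is stored at
address `0`. -/
theorem Tidy.supp {Ψ : (V → Fin 2) → ℂ} (h : Λ.Tidy Λ.count Ψ) :
    ∀ y, Ψ y ≠ 0 → y ∈ Conf (∅ : Set V) := by
  intro y hy v hv
  exact hy (h v (Or.inr (Λ.idx_lt_count le_rfl)) y hv)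

end Layout

section Step

variable {V : Type} [Fintype V] [DecidableEq V] {G : SimpleGraph V} {D : Dims}
  {num : V ≃ Fin D.n} {hG : D.IsGrid G num} {off : ℕ} {ho : off ≤ 2 * D.d + 1}
  {U : Circuit G D.d} {O : V → Matrix (Fin 2) (Fin 2) ℂ} {nd : Node V} {u : ℝ} {s : State}

theorem foldl_stepNode (Λ : Layout G D.d) (O' : V → Matrix (Fin 2) (Fin 2) ℂ) (l : List ℕ)
    (p : Node V × ℝ) : l.foldl (fun p j => stepNode Λ U O' j p) p =
      Λ.sweep U O' (l.filterMap Λ.item) p := by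
  induction l generalizing p with
  | nil => rfl
  | cons j l ih =>
    rw [List.foldl_cons, ih, stepNode, List.filterMap_cons]
    cases Λ.item j <;> rfl

theorem foldl_stepNode_tidy (Λ : Layout G D.d) (O' : V → Matrix (Fin 2) (Fin 2) ℂ) (p : Node V × ℝ)
    (h : Λ.Tidy 0 p.1.Ψ) (k : ℕ) :
    Λ.Tidy k ((List.range k).foldl (fun p j => stepNode Λ U O' j p) p).1.Ψ := by
  induction k with
  | zero => exact h
  | succ k ih =>
    rw [List.range_succ, List.foldl_append]
    exact stepNode_tidy Λ O' ih

theorem runCmd_runs (hd : Describes D num U O s) (hoff : s.imem 100 0 = off) {x : V → Fin 2}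
    {on : Bool} {N : ℝ} (hx : ∀ v, s.imem 103 (num v) = x v) (hon : s.imem 101 0 = on.toNat)
    (hu : s.cmem 102 0 = u) (hN : s.cmem 103 0 = N) (ho : off ≤ 2 * D.d + 1) {p : Node V × ℝ}
    (hp : (Dims.layout hG off ho).sweep U (halfOp off O) (Dims.layout hG off ho).schedule
      (⟨Pi.single (fun _ => 0) 1, x, N, on⟩, u) = p) :
    Runs runCmd s (3000 * (D.J * 2 ^ D.w)) fun s' =>
      Rel hG ho U O p.1 p.2 s' ∧ s'.cmem 100 0 = p.1.Ψ fun _ => 0 := by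
  set Λ := Dims.layout hG off ho with hΛ
  have hJ : 1 ≤ D.J := by have := Dims.le_J (D := D) hG.c_pos; omega
  have hN1 : 1 ≤ 2 ^ D.w := Nat.one_le_two_pow
  have hJN : 2 ^ D.w ≤ D.J * 2 ^ D.w := Nat.le_mul_of_pos_left _ hJ
  have hJN' : D.J ≤ D.J * 2 ^ D.w := Nat.le_mul_of_pos_right _ hN1
  refine (Runs.seq (T := 10 + 2 ^ D.w * 18) (T' := 2900 * (D.J * 2 ^ D.w))
    ((Runs.fillC hd.size (by decide) (fun _ => 0) fun k _ s' _ _ => by simp).frame.mono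
      (by simp) ?_)).mono (by omega) fun _ h => h
  rintro s₁ ⟨h₁, hf, -⟩
  have hf₁ : Frame [110] [100] s s₁ := hf.mono (by simp [Cmd.iw]) (by simp [Cmd.cw])
  refine (Runs.seq (T := 4) (T' := 10 + D.J * (2000 * 2 ^ D.w + 13)) ((Runs.cstore ?_).mono
    (by simp) fun _ h => h)).mono ?_ fun _ h => h
  swap
  · rw [mul_add]
    have : D.J * (2000 * 2 ^ D.w) = 2000 * (D.J * 2 ^ D.w) := by ring
    omega
  have hf₂ : Frame [110] [100] s (s₁.setC 100 ((0 : IExp).eval s₁) ((1 : CExp).eval s₁)) :=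
    ⟨hf₁.imem, fun a ha => by
      rw [← hf₁.cmem a ha, State.cmem_setC, if_neg (by simpa using ha)]⟩
  have hR : Rel hG ho U O ⟨Pi.single (fun _ => 0) 1, x, N, on⟩ u
      (s₁.setC 100 ((0 : IExp).eval s₁) ((1 : CExp).eval s₁)) :=
    { desc := hd.frame hf₂ (by simp) (by simp)
      off := by rw [hf₂.imem _ (by simp)]; exact hoff
      psi := by
        intro σ
        rw [push_single, State.cmem_setC, if_pos rfl]
        by_cases hσ : σ = fun _ => 0
        · rw [hσ, code_zero]; simp
        · rw [Pi.single_eq_of_ne hσ, Function.update_of_ne, h₁ _ (code_lt σ)]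
          intro e
          refine hσ (code_injective ?_)
          rw [code_zero]
          exact e
      x := by rw [hf₂.imem _ (by simp)]; exact hx
      on := by rw [hf₂.imem _ (by simp)]; exact hon
      u := by rw [hf₂.cmem _ (by simp)]; exact hu
      N := by rw [hf₂.cmem _ (by simp)]; exact hN }
  clear_value Λ
  set s₂ := s₁.setC 100 ((0 : IExp).eval s₁) ((1 : CExp).eval s₁)
  set it := fun k => (List.range k).foldl (fun p j => stepNode Λ U (halfOp off O) j p)
    (⟨Pi.single (fun _ => 0) 1, x, N, on⟩, u) with hit
  have hfin : it D.J = p := by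
    rw [← hp, hit]
    dsimp only
    rw [foldl_stepNode, Layout.schedule, hΛ, Dims.layout_count]
  -- Tidiness is a property of the mathematical sampler alone, so it is proved outside the loop
  -- invariant.
  have htidy : ∀ k, Λ.Tidy k (it k).1.Ψ := foldl_stepNode_tidy Λ _ _ Λ.tidy_init
  refine (Runs.forLoop hR.desc.J (by decide) (fun h => by have := stepCmd_iw _ h; omega)
    (fun h => by have := stepCmd_iw _ h; omega)
    (fun k s => Rel hG ho U O (it k).1 (it k).2 s) ?_ ?_).mono le_rfl ?_
  · exact hR.frame (A := [111]) (C := []) ⟨fun a ha => State.setI_ne _ _ _ (by simpa using ha),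
      fun _ _ => rfl⟩ (by simp) (by simp)
  · intro k hk s' _ hi hI
    refine (stepCmd_runs hk hI (hΛ ▸ htidy k) hi).mono le_rfl fun s'' h => ?_
    have e : it (k + 1) = stepNode Λ U (halfOp off O) k (it k) := by
      rw [hit]; dsimp only; rw [List.range_succ, List.foldl_append]; rfl
    rw [e, hΛ]
    exact h.frame (A := [111]) (C := []) ⟨fun a ha => State.setI_ne _ _ _ (by simpa using ha),
      fun _ _ => rfl⟩ (by simp) (by simp)
  · intro s' h
    rw [hfin] at h
    refine ⟨h, ?_⟩
    have hT := htidy D.J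
    rw [hfin] at hT
    have hT' : Λ.Tidy Λ.count p.1.Ψ := by rw [hΛ, Dims.layout_count, ← hΛ]; exact hT
    have hsupp := hT'.supp
    have := h.psi fun _ => 0
    rwa [code_zero, push_zero_of_supp hsupp] at this

/-- Two sweeps make a sample: with shift `0` the outcomes and the first amplitude are drawn, with
shift `2 * d + 1` the second amplitude is evaluated at these outcomes. The residue divided by the
weight of the leaf is the seed of the next sample. -/
theorem sampleCmd_runs (hd : Describes D num U O s) (hu : s.cmem 102 0 = u) {p : Node V × ℝ}
    (hp : (Dims.layout hG 0 (Nat.zero_le _)).sweep U (fun v => (O v)ᴴ)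
      (Dims.layout hG 0 (Nat.zero_le _)).schedule (Layout.root, u) = p) :
    Runs sampleCmd s (10000 * (D.J * 2 ^ D.w)) fun s' => Describes D num U O s' ∧
      s'.cmem 102 0 = ((p.2 / p.1.N : ℝ) : ℂ) ∧ s'.cmem 105 0 =
        s.cmem 105 0 + Layout.value ((Dims.layout hG (2 * D.d + 1) le_rfl).amp U O) p.1 := by
  set M := D.J * 2 ^ D.w with hM
  have hJ : 1 ≤ D.J := by have := Dims.le_J (D := D) hG.c_pos; omega
  have hN1 : 1 ≤ 2 ^ D.w := Nat.one_le_two_pow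
  have hJN' : D.J ≤ M := Nat.le_mul_of_pos_right _ hN1
  have hn := Dims.n_le_J D
  refine (Runs.seq (T := 10 + D.n * 17) (T' := 9000 * M)
    ((Runs.fillI hd.n (by decide) (by decide) (by decide) (fun _ => 0)
      fun k _ s' _ _ _ => by simp).frame.mono (by simp) ?_)).mono (by omega) fun _ h => h
  rintro s₁ ⟨h₁, hf, -⟩
  have hf₁ : Frame [110, 103] [] s s₁ := hf.mono (by simp [Cmd.iw]) (by simp [Cmd.cw])
  refine (Runs.seq (T := 4) (T' := 8900 * M) ((Runs.cstore ?_).mono (by simp)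
    fun _ h => h)).mono (by omega) fun _ h => h
  refine (Runs.seq (T := 4) (T' := 8800 * M) ((Runs.istore ?_).mono (by simp)
    fun _ h => h)).mono (by omega) fun _ h => h
  refine (Runs.seq (T := 4) (T' := 8700 * M) ((Runs.istore ?_).mono (by simp)
    fun _ h => h)).mono (by omega) fun _ h => h
  set s₂ := (((s₁.setC 103 ((0 : IExp).eval s₁) ((1 : CExp).eval s₁)).setI 100 _ _).setI 101 _ _)
    with hs₂
  have hf₂ : Frame [100, 101] [103] s₁ s₂ :=
    ⟨fun a ha => by simp at ha; simp [hs₂, State.imem_setI, ha],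
      fun a ha => by simp at ha; simp [hs₂, State.cmem_setC, ha]⟩
  have hf₂' : Frame [100, 101, 103, 110] [103] s s₂ :=
    (hf₁.trans hf₂).mono (by simp) (by simp)
  have hrun := runCmd_runs (hG := hG) (off := 0) (s := s₂) (u := u) (x := fun _ => 0)
    (on := true) (N := 1) (hd.frame hf₂' (by simp) (by simp))
    (by simp [hs₂, State.imem_setI])
    (fun v => by rw [hf₂.imem _ (by simp), h₁ _ (num v).2]; rfl)
    (by simp [hs₂, State.imem_setI]) (by rw [hf₂'.cmem _ (by simp), hu])
    (by simp [hs₂, State.cmem_setC]) (Nat.zero_le _) (p := p) (by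
      rw [← hp]; rfl)
  refine (Runs.seq (T := 3000 * M) (T' := 5000 * M) (hrun.frame.mono le_rfl ?_)).mono (by omega)
    fun _ h => h
  rintro s₃ ⟨⟨h₃, hα⟩, hf₃, -⟩
  have hacc₃ : s₃.cmem 105 0 = s.cmem 105 0 := by
    rw [hf₃.cmem _ fun h => by have := runCmd_cw _ h; omega, hf₂'.cmem _ (by simp)]
  clear hrun hf₃
  clear_value s₂
  refine (Runs.seq (T := 4) (T' := 4900 * M) ((Runs.cstore ?_).mono (by simp)
    fun _ h => h)).mono (by omega) fun _ h => h
  refine (Runs.seq (T := 4) (T' := 4800 * M) ((Runs.istore ?_).mono (by simp)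
    fun _ h => h)).mono (by omega) fun _ h => h
  refine (Runs.seq (T := 10) (T' := 4700 * M) ((Runs.istore ?_).mono (by simp)
    fun _ h => h)).mono (by omega) fun _ h => h
  refine (Runs.seq (T := 4) (T' := 4600 * M) ((Runs.istore ?_).mono (by simp)
    fun _ h => h)).mono (by omega) fun _ h => h
  set s₄ := ((((s₃.setC 106 _ _).setI 104 _ _).setI 100 _ _).setI 101 _ _) with hs₄
  have hf₄ : Frame [100, 101, 104] [106] s₃ s₄ :=
    ⟨fun a ha => by simp at ha; simp [hs₄, State.imem_setI, ha],
      fun a ha => by simp at ha; simp [hs₄, State.cmem_setC, ha]⟩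
  have hα₄ : s₄.cmem 106 0 = p.1.Ψ fun _ => 0 := by
    simp [hs₄, State.cmem_setC, hα]
  have hon₄ : s₄.imem 104 0 = p.1.on.toNat := by
    simp [hs₄, State.imem_setI, h₃.on]
  have hd₃ := h₃.desc.d
  -- With the switch off, the second sweep leaves outcomes, residue and weight intact. It runs even
  -- after a dead leaf, whose value is then suppressed by the saved switch.
  have hrun := runCmd_runs (hG := hG) (off := 2 * D.d + 1) (s := s₄) (u := p.2) (x := p.1.x)
    (on := false) (N := p.1.N) (h₃.desc.frame hf₄ (by simp) (by simp))
    (by simp [hs₄, State.imem_setI, hd₃])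
    (fun v => by rw [hf₄.imem _ (by simp), h₃.x])
    (by simp [hs₄, State.imem_setI]) (by rw [hf₄.cmem _ (by simp), h₃.u])
    (by rw [hf₄.cmem _ (by simp), h₃.N]) le_rfl (Layout.sweep_off _ _ _ _ rfl _)
  refine (Runs.seq (T := 3000 * M) (T' := 1000 * M) (hrun.frame.mono le_rfl ?_)).mono (by omega)
    fun _ h => h
  rintro s₅ ⟨⟨h₅, hβ⟩, hf₅, -⟩
  dsimp only at hβ
  have hO : halfOp (2 * D.d + 1) O = O := by
    ext1 v; rw [halfOp, if_neg (by omega)]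
  rw [Layout.runOp_schedule_mulVec, hO] at hβ
  have hα₅ : s₅.cmem 106 0 = p.1.Ψ fun _ => 0 := by
    rw [hf₅.cmem _ fun h => by have := runCmd_cw _ h; omega, hα₄]
  have hon₅ : s₅.imem 104 0 = p.1.on.toNat := by
    rw [hf₅.imem _ fun h => by have := runCmd_iw _ h; omega, hon₄]
  have hacc₅ : s₅.cmem 105 0 = s.cmem 105 0 := by
    rw [hf₅.cmem _ fun h => by have := runCmd_cw _ h; omega, hf₄.cmem _ (by simp), hacc₃]
  clear hrun hf₅ hf₄ hα₄ hon₄ hs₄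
  have hN₅ : s₅.cmem 103 0 = p.1.N := h₅.N
  have hu₅ : s₅.cmem 102 0 = p.2 := h₅.u
  have hite : Runs (.ite (.ile 1 (iv 104))
      (cset 105 (cv 105 + .conj (cv 106) * cv 100 / cv 103)) .skip) s₅ 40 fun s' =>
      Frame [] [105] s₅ s' ∧ s'.cmem 105 0 = s.cmem 105 0 +
        Layout.value ((Dims.layout hG (2 * D.d + 1) le_rfl).amp U O) p.1 := by
    refine (Runs.ite (T := 30) (fun hb => ?_) fun hb => ?_).mono (by simp) fun _ h => h
    · have hon : p.1.on = true := by
        cases hc : p.1.on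
        · simp [hon₅, hc] at hb
        · rfl
      refine (Runs.cstore ⟨⟨fun _ _ => rfl, fun a ha => ?_⟩, ?_⟩).mono (by simp) fun _ h => h
      · rw [State.cmem_setC, if_neg (by simpa using ha)]
      · rw [State.cmem_setC, if_pos rfl, Layout.value, if_pos hon]
        simp [hacc₅, hα₅, hβ, hN₅]
    · have hon : p.1.on = false := by
        cases hc : p.1.on
        · rfl
        · simp [hon₅, hc] at hb
      refine (Runs.skip ⟨Frame.refl _ _ _, ?_⟩).mono (by simp) fun _ h => h
      rw [Layout.value, hon, hacc₅]
      simp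
  refine (Runs.seq (T := 40) (T' := 10) (hite.mono le_rfl ?_)).mono (by omega) fun _ h => h
  rintro s₆ ⟨hf₆, hacc₆⟩
  refine (Runs.cstore ⟨?_, ?_, ?_⟩).mono (by simp) fun _ h => h
  · refine (h₅.desc.frame hf₆ (by simp) (by simp)).frame (A := []) (C := [102])
      ⟨fun _ _ => rfl, fun a ha => ?_⟩ (by simp) (by simp)
    rw [State.cmem_setC, if_neg (by simpa using ha)]
  · rw [State.cmem_setC, if_pos rfl]
    simp [hf₆.cmem 102 (by simp), hf₆.cmem 103 (by simp), hu₅, hN₅]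
  · rw [State.cmem_setC, if_neg (by decide), hacc₆]

theorem averageCmd_runs (hO : ∀ v, ‖Matrix.toEuclideanCLM (n := Fin 2) (𝕜 := ℂ) (O v)‖ ≤ 1)
    (hd : Describes D num U O s) (hu : s.cmem 102 0 = u) (h0 : 0 ≤ u) (h1 : u < 1) {S : ℕ}
    (hS : s.imem 24 0 = S) :
    Runs averageCmd s (30 + S * (10100 * (D.J * 2 ^ D.w))) fun s' => s'.cmem 3 0 =
      total Node.N (Layout.value ((Dims.layout hG (2 * D.d + 1) le_rfl).amp U O))
        ((Dims.layout hG 0 (Nat.zero_le _)).leaves U (fun v => (O v)ᴴ)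
          (Dims.layout hG 0 (Nat.zero_le _)).schedule Layout.root) S u / S := by
  set Λ := Dims.layout hG 0 (Nat.zero_le _)
  set Z := Layout.value ((Dims.layout hG (2 * D.d + 1) le_rfl).amp U O)
  set lv := Λ.leaves U (fun v => (O v)ᴴ) Λ.schedule Layout.root with hlv
  have hO' : ∀ v, ‖Matrix.toEuclideanCLM (n := Fin 2) (𝕜 := ℂ) (O v)ᴴ‖ ≤ 1 := fun v => by
    rw [norm_toEuclideanCLM_conjTranspose]; exact hO v
  have hM : 1 ≤ D.J * 2 ^ D.w := Nat.mul_pos (by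
    have := Dims.le_J (D := D) hG.c_pos; omega) (by positivity)
  set M := D.J * 2 ^ D.w
  refine (Runs.seq (T := 4) (T' := 20 + S * (10100 * M)) ((Runs.cstore ?_).mono (by simp)
    fun _ h => h)).mono (by linarith) fun _ h => h
  set s₁ := s.setC 105 ((0 : IExp).eval s) ((0 : CExp).eval s) with hs₁
  have hf₁ : Frame [] [105] s s₁ := ⟨fun _ _ => rfl, fun a ha => by
    rw [hs₁, State.cmem_setC, if_neg (by simpa using ha)]⟩
  have hloop := Runs.forLoop (i := 112) (b := 24) (p := sampleCmd) (s₀ := s₁) (n := S)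
    (T := 10000 * M) hS (by decide) (fun h => (sampleCmd_iw _ h).2 rfl)
    (fun h => by have := (sampleCmd_iw _ h).1; omega)
    -- The accumulated sum plus what the remaining samples would contribute from the current seed is
    -- constant.
    (fun k s' => Describes D num U O s' ∧ ∃ u', s'.cmem 102 0 = ((u' : ℝ) : ℂ) ∧ 0 ≤ u' ∧ u' < 1 ∧
      s'.cmem 105 0 + total Node.N Z lv (S - k) u' = total Node.N Z lv S u) ?_ ?_
  · refine (Runs.seq (T := 10 + S * (10000 * M + 13)) (T' := 10) (hloop.frame.mono le_rfl ?_)).mono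
      ?_ fun _ h => h
    · rintro s₂ ⟨⟨-, u', -, -, -, h⟩, hf₂, -⟩
      refine (Runs.cstore ?_).mono (by simp) fun _ h => h
      rw [Nat.sub_self, total, add_zero] at h
      have hS₂ : s₂.imem 24 0 = S := by
        rw [hf₂.imem _ fun h => ?_]
        · exact hS
        · rw [forLoop_iw] at h
          simp only [List.mem_cons, List.mem_append, List.not_mem_nil, or_false] at h
          rcases h with h | h | h
          · omega
          · exact absurd (sampleCmd_iw _ h).1 (by decide)
          · omega
      rw [State.cmem_setC, if_pos rfl]
      simp [h, hS₂]
    · have := Nat.mul_le_mul_left S (show 10000 * M + 13 ≤ 10100 * M by omega)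
      linarith
  · refine ⟨(hd.frame hf₁ (by simp) (by simp)).frame (A := [112]) (C := [])
      ⟨fun a ha => State.setI_ne _ _ _ (by simpa using ha), fun _ _ => rfl⟩ (by simp) (by simp),
      u, ?_, h0, h1, ?_⟩
    · rw [State.cmem_setI, hf₁.cmem _ (by simp), hu]
    · simp [hs₁, State.cmem_setC]
  · rintro k hk s' - - ⟨hd', u', hu', h0', h1', hA⟩
    have hsw := Λ.sweep_eq_locate U _ hO' Λ.schedule Layout.root_consistent h0' h1'
    have hsum : (lv.map Node.N).sum = 1 := Λ.leaves_sum U _ _ _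
    obtain ⟨-, hl2, hl3⟩ := locate_spec Node.N h0' (h1'.trans_eq hsum.symm)
    refine (sampleCmd_runs hd' hu' hsw).mono le_rfl ?_
    rintro s'' ⟨hd'', hu'', hacc⟩
    refine ⟨hd''.frame (A := [112]) (C := [])
      ⟨fun a ha => State.setI_ne _ _ _ (by simpa using ha), fun _ _ => rfl⟩ (by simp) (by simp),
      _, hu'', div_nonneg hl2 (hl2.trans hl3.le), ?_, ?_⟩
    -- The residue is strictly smaller than the weight of the leaf, so that weight is positive and
    -- the rescaled seed is again in `[0, 1)`.
    · rw [div_lt_one (hl2.trans_lt hl3)]; exact hl3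
    · rw [State.cmem_setI, hacc, ← hA, show S - k = (S - (k + 1)) + 1 by omega, total, add_assoc]

end Step

end MeanValue

namespace MeanValue

open Matrix

/-! ### Preparations -/

/-- Compute the parameters from the side lengths and the depth. -/
def scalarsCmd : Cmd :=
  .seq (iset 14 (iv 10 * iv 11 * iv 12)) (.seq (iset 15 (4 * iv 13 + 2))
    (.seq (iset 16 (iv 15 * iv 12)) (.seq (iset 17 (4 * iv 13 + 4))
      (.seq (iset 18 (iv 17 * iv 16)) (.seq (iset 20 (2 * iv 13 + 2))
        (.seq (iset 21 ((iv 10 * iv 11 + 4 * iv 13 + 2) * iv 20 * iv 16))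
          (.seq (iset 22 (iv 18 + 1)) (iset 23 (iv 13 * iv 14)))))))))

/-- Tabulate quotients and remainders. -/
def divCmd (m A B : ℕ) : Cmd :=
  .seq (forLoop 110 21 (.istore A (iv 110)
      (geE (iv m) (iv 110) * (.load A (iv 110 - iv m) + 1))))
    (forLoop 110 21 (.istore B (iv 110) (iv 110 - iv m * .load A (iv 110))))

/-- Tabulate powers of two. -/
def powCmd : Cmd :=
  .seq (forLoop 110 22 (.istore 54 (iv 110)
    (geE 1 (iv 110) * (2 * .load 54 (iv 110 - 1)) + (1 - iv 110)))) (iset 19 (.load 54 (iv 18)))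

/-- Compute the tables. -/
def tablesCmd : Cmd :=
  .seq (divCmd 12 40 41) (.seq (divCmd 11 42 43) (.seq (divCmd 15 44 45) (.seq (divCmd 17 46 47)
    (.seq (divCmd 16 48 49) (.seq (divCmd 20 50 51) (.seq (divCmd 14 52 53) powCmd))))))

/-- Tabulate the gates according to their first qubits. -/
def gateTableCmd : Cmd :=
  forLoop 110 23 (.ite (ltE (.load 53 (iv 110)) (.load 1 (.load 52 (iv 110))))
    (.istore 56 (.load 52 (iv 110) * iv 14 + .load 2 (2 * iv 110)) (iv 110 + 1)) .skip)

/-- Compute the number of samples. -/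
def countCmd : Cmd :=
  .seq (iset 24 1) (.loop (.not (.cle 4 (.cast (iv 24) * (cv 0 * cv 0)))) (iset 24 (iv 24 + 1)))

/-- Choose a random binary fraction. -/
def coinsCmd : Cmd :=
  .seq (iset 25 (2 * iv 14 * iv 24 + 4)) (.seq (cset 102 0) (.seq (cset 107 1)
    (.seq (forLoop 112 25 (.seq (.flip 113 0) (.seq (cset 102 (cv 102 + .cast (iv 113) * cv 107))
      (cset 107 (cv 107 + cv 107))))) (cset 102 (cv 102 / cv 107)))))

/-- The parameters. -/
structure Scalars (D : Dims) (s : State) : Prop where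
  a : s.imem 10 0 = D.a
  b : s.imem 11 0 = D.b
  c : s.imem 12 0 = D.c
  d : s.imem 13 0 = D.d
  n : s.imem 14 0 = D.n
  H : s.imem 15 0 = D.H
  L : s.imem 16 0 = D.L
  W : s.imem 17 0 = 4 * D.d + 4
  w : s.imem 18 0 = D.w
  F : s.imem 20 0 = D.F
  J : s.imem 21 0 = D.J
  w' : s.imem 22 0 = D.w + 1
  m : s.imem 23 0 = D.d * D.n

theorem Scalars.frame {D : Dims} {s s' : State} (h : Scalars D s) {A C : List ℕ}
    (hf : Frame A C s s') (hA : ∀ a ∈ A, a = 19 ∨ 23 < a) : Scalars D s' where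
  a := by rw [hf.imem _ fun ha => by have := hA _ ha; omega]; exact h.a
  b := by rw [hf.imem _ fun ha => by have := hA _ ha; omega]; exact h.b
  c := by rw [hf.imem _ fun ha => by have := hA _ ha; omega]; exact h.c
  d := by rw [hf.imem _ fun ha => by have := hA _ ha; omega]; exact h.d
  n := by rw [hf.imem _ fun ha => by have := hA _ ha; omega]; exact h.n
  H := by rw [hf.imem _ fun ha => by have := hA _ ha; omega]; exact h.H
  L := by rw [hf.imem _ fun ha => by have := hA _ ha; omega]; exact h.L
  W := by rw [hf.imem _ fun ha => by have := hA _ ha; omega]; exact h.W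
  w := by rw [hf.imem _ fun ha => by have := hA _ ha; omega]; exact h.w
  F := by rw [hf.imem _ fun ha => by have := hA _ ha; omega]; exact h.F
  J := by rw [hf.imem _ fun ha => by have := hA _ ha; omega]; exact h.J
  w' := by rw [hf.imem _ fun ha => by have := hA _ ha; omega]; exact h.w'
  m := by rw [hf.imem _ fun ha => by have := hA _ ha; omega]; exact h.m

/-- An assignment, described by its effect. -/
theorem Runs.iset {a T : ℕ} {e : IExp} {s : State} {Q : State → Prop} (hT : e.cost + 2 ≤ T)
    (h : ∀ s', Frame [a] [] s s' → s'.imem a 0 = e.eval s → Q s') : Runs (iset a e) s T Q := by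
  refine (Runs.istore (h _ ⟨fun b hb => State.setI_ne _ _ _ (by simpa using hb),
    fun _ _ => rfl⟩ ?_)).mono ?_ fun _ h => h
  · rw [State.setI_same]; simp
  · simp; omega

theorem scalarsCmd_runs {D : Dims} {s : State} (ha : s.imem 10 0 = D.a) (hb : s.imem 11 0 = D.b)
    (hc : s.imem 12 0 = D.c) (hd : s.imem 13 0 = D.d) :
    Runs scalarsCmd s 200 (Scalars D) := by
  refine (Runs.seq (T := 20) (T' := 180) ((Runs.istore ?_).mono (by simp) fun _ h => h)).mono
    (by omega) fun _ h => h
  refine (Runs.seq (T := 20) (T' := 160) ((Runs.istore ?_).mono (by simp) fun _ h => h)).mono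
    (by omega) fun _ h => h
  refine (Runs.seq (T := 20) (T' := 140) ((Runs.istore ?_).mono (by simp) fun _ h => h)).mono
    (by omega) fun _ h => h
  refine (Runs.seq (T := 20) (T' := 120) ((Runs.istore ?_).mono (by simp) fun _ h => h)).mono
    (by omega) fun _ h => h
  refine (Runs.seq (T := 20) (T' := 100) ((Runs.istore ?_).mono (by simp) fun _ h => h)).mono
    (by omega) fun _ h => h
  refine (Runs.seq (T := 20) (T' := 80) ((Runs.istore ?_).mono (by simp) fun _ h => h)).mono
    (by omega) fun _ h => h
  refine (Runs.seq (T := 30) (T' := 50) ((Runs.istore ?_).mono (by simp) fun _ h => h)).mono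
    (by omega) fun _ h => h
  refine (Runs.seq (T := 20) (T' := 30) ((Runs.istore ?_).mono (by simp) fun _ h => h)).mono
    (by omega) fun _ h => h
  refine (Runs.istore ?_).mono (by simp) fun _ h => h
  constructor <;> simp [State.imem_setI, ha, hb, hc, hd, Dims.n, Dims.H, Dims.L, Dims.w, Dims.F,
    Dims.J]

/-- The arrays `A` and `B` hold the quotients and the remainders modulo `m`. -/
def Tabulates (N m A B : ℕ) (s : State) : Prop :=
  ∀ i < N, s.imem A i = i / m ∧ s.imem B i = i % m

theorem Tabulates.frame {N m A B : ℕ} {s s' : State} (h : Tabulates N m A B s) {A' C' : List ℕ}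
    (hf : Frame A' C' s s') (hA : A ∉ A' ∧ B ∉ A') : Tabulates N m A B s' := by
  unfold Tabulates
  rw [hf.imem _ hA.1, hf.imem _ hA.2]
  exact h

/-- Division by repeated subtraction, in a form that fills a table with one lookup per entry. -/
theorem div_rec {m : ℕ} (hm : 0 < m) (k : ℕ) :
    k / m = (if m ≤ k then 1 else 0) * ((k - m) / m + 1) := by
  split_ifs with h
  · obtain ⟨j, rfl⟩ := Nat.exists_eq_add_of_le h
    rw [Nat.add_sub_cancel_left, Nat.add_div_left _ hm, one_mul]
  · rw [Nat.div_eq_of_lt (by omega), zero_mul]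

theorem divCmd_runs {m A B N M : ℕ} {s : State} (hN : s.imem 21 0 = N) (hM : s.imem m 0 = M)
    (hM0 : 0 < M) (hA : A ≠ B) (hA' : 23 < A ∧ A < 100) (hB' : 23 < B ∧ B < 100) (hm : m ≤ 23) :
    Runs (divCmd m A B) s (20 + N * 80) (Tabulates N M A B) := by
  refine (Runs.seq (T := 10 + N * 40) (T' := 10 + N * 30)
    ((Runs.fillI hN (by decide) (by omega) (by omega) (fun k => k / M) ?_).frame.mono
      (by simp; omega) ?_)).mono (by omega) fun _ h => h
  · intro k hk s' hf hi hI
    have hM' : s'.imem m 0 = M := by rw [hf.imem m (by simp; omega), hM]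
    rw [IExp.eval_mul, geE_eval, div_rec hM0]
    simp only [IExp.eval_load, IExp.eval_ofNat, IExp.eval_sub, IExp.eval_add, hi, hM']
    split_ifs with h
    · rw [hI (k - M) (by omega)]
    · simp
  · rintro s₁ ⟨h₁, hf, -⟩
    have hf₁ : Frame [110, A] [] s s₁ := hf.mono (by simp [Cmd.iw]) (by simp [Cmd.cw])
    refine (Runs.fillI (s₀ := s₁) (n := N) (by rw [hf₁.imem _ (by simp; omega), hN]) (by decide)
      (by omega) (by omega) (fun k => k % M) ?_).frame.mono (by simp; omega) ?_
    · intro k hk s' hf hi hI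
      have hM' : s'.imem m 0 = M := by
        rw [hf.imem m (by simp; omega), hf₁.imem m (by simp; omega), hM]
      simp only [IExp.eval_load, IExp.eval_ofNat, IExp.eval_sub, IExp.eval_mul, hi, hM']
      rw [hf.imem A (by simp [hA]; omega), h₁ k hk]
      have := Nat.div_add_mod k M
      omega
    · rintro s₂ ⟨h₂, hf₂, -⟩ i hi
      rw [hf₂.imem A (by simp [Cmd.iw, hA]; omega)]
      exact ⟨h₁ i hi, h₂ i hi⟩

theorem powCmd_runs {w : ℕ} {s : State} (hw : s.imem 18 0 = w) (hw' : s.imem 22 0 = w + 1) :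
    Runs powCmd s (100 + w * 50) fun s' => s'.imem 19 0 = 2 ^ w ∧ ∀ i < w, s'.imem 54 i = 2 ^ i := by
  -- The table has `w + 1` entries because `2 ^ w` itself, the length of the state vector, is read
  -- from it.
  refine (Runs.seq (T := 10 + (w + 1) * 50) (T' := 40)
    ((Runs.fillI hw' (by decide) (by decide) (by decide) (fun k => 2 ^ k) ?_).frame.mono
      (by simp) ?_)).mono (by omega) fun _ h => h
  · intro k hk s' hf hi hI
    rw [IExp.eval_add, IExp.eval_mul, geE_eval]
    simp only [IExp.eval_load, IExp.eval_ofNat, IExp.eval_sub, IExp.eval_mul, hi]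
    cases k with
    | zero => simp
    | succ k =>
      rw [if_pos (by omega), Nat.add_sub_cancel, hI k (by omega), pow_succ]
      omega
  · rintro s₁ ⟨h₁, hf, -⟩
    refine Runs.iset (by simp) fun s₂ hf₂ h₂ => ⟨?_, fun i hi => ?_⟩
    · have : s₁.imem 18 0 = w := by rw [hf.imem _ (by simp [Cmd.iw]), hw]
      rw [h₂]
      simp only [IExp.eval_load, IExp.eval_ofNat, this]
      exact h₁ w (by omega)
    · rw [hf₂.imem _ (by simp)]
      exact h₁ i (by omega)

/-- A fact that is established by the first program and not affected by the second. -/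
theorem Runs.seq_stable {p q : Cmd} {s : State} {T T' : ℕ} {P Q : State → Prop} (hp : Runs p s T P)
    (hP : ∀ s' s'', P s' → Frame q.iw q.cw s' s'' → P s'')
    (hq : ∀ s', Frame p.iw p.cw s s' → Runs q s' T' Q) :
    Runs (.seq p q) s (T + T') fun s' => P s' ∧ Q s' :=
  Runs.seq (hp.frame.mono le_rfl fun s' ⟨h, hf, _⟩ =>
    (hq s' hf).frame.mono le_rfl fun s'' ⟨h', hf', _⟩ => ⟨hP s' s'' h hf', h'⟩)

theorem tablesCmd_runs {D : Dims} {s : State} (h : Scalars D s) (hb : 0 < D.b) (hc : 0 < D.c)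
    (hn : 0 < D.n) : Runs tablesCmd s (300 + D.J * 560 + D.w * 50) fun s' =>
      Tables D s' ∧ Tabulates D.J D.n 52 53 s' := by
  have hL : 0 < D.L := Nat.mul_pos (by unfold Dims.H; omega) hc
  have key : Runs tablesCmd s ((20 + D.J * 80) + ((20 + D.J * 80) + ((20 + D.J * 80) +
      ((20 + D.J * 80) + ((20 + D.J * 80) + ((20 + D.J * 80) + ((20 + D.J * 80) +
        (100 + D.w * 50)))))))) fun s' =>
      Tabulates D.J D.c 40 41 s' ∧ Tabulates D.J D.b 42 43 s' ∧ Tabulates D.J D.H 44 45 s' ∧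
      Tabulates D.J (4 * D.d + 4) 46 47 s' ∧ Tabulates D.J D.L 48 49 s' ∧
      Tabulates D.J D.F 50 51 s' ∧ Tabulates D.J D.n 52 53 s' ∧
      (s'.imem 19 0 = 2 ^ D.w ∧ ∀ i < D.w, s'.imem 54 i = 2 ^ i) := by
    refine Runs.seq_stable (divCmd_runs h.J h.c hc (by decide) (by decide) (by decide) (by decide))
      (fun _ _ h hf => h.frame hf (by simp [divCmd, powCmd, Cmd.iw])) fun s hf => ?_
    replace h := h.frame hf (by simp [divCmd, Cmd.iw])
    refine Runs.seq_stable (divCmd_runs h.J h.b hb (by decide) (by decide) (by decide) (by decide))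
      (fun _ _ h hf => h.frame hf (by simp [divCmd, powCmd, Cmd.iw])) fun s hf => ?_
    replace h := h.frame hf (by simp [divCmd, Cmd.iw])
    refine Runs.seq_stable (divCmd_runs h.J h.H (by unfold Dims.H; omega) (by decide) (by decide)
      (by decide) (by decide))
      (fun _ _ h hf => h.frame hf (by simp [divCmd, powCmd, Cmd.iw])) fun s hf => ?_
    replace h := h.frame hf (by simp [divCmd, Cmd.iw])
    refine Runs.seq_stable (divCmd_runs h.J h.W (by omega) (by decide) (by decide) (by decide)
      (by decide))
      (fun _ _ h hf => h.frame hf (by simp [divCmd, powCmd, Cmd.iw])) fun s hf => ?_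
    replace h := h.frame hf (by simp [divCmd, Cmd.iw])
    refine Runs.seq_stable (divCmd_runs h.J h.L hL (by decide) (by decide) (by decide) (by decide))
      (fun _ _ h hf => h.frame hf (by simp [divCmd, powCmd, Cmd.iw])) fun s hf => ?_
    replace h := h.frame hf (by simp [divCmd, Cmd.iw])
    refine Runs.seq_stable (divCmd_runs h.J h.F (by unfold Dims.F; omega) (by decide) (by decide)
      (by decide) (by decide))
      (fun _ _ h hf => h.frame hf (by simp [divCmd, powCmd, Cmd.iw])) fun s hf => ?_
    replace h := h.frame hf (by simp [divCmd, Cmd.iw])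
    refine Runs.seq_stable (divCmd_runs h.J h.n hn (by decide) (by decide) (by decide) (by decide))
      (fun _ _ h hf => h.frame hf (by simp [powCmd, Cmd.iw])) fun s hf => ?_
    replace h := h.frame hf (by simp [divCmd, Cmd.iw])
    exact powCmd_runs h.w h.w'
  refine key.frame.mono (by omega) ?_
  rintro s' ⟨⟨h1, h2, h3, h4, h5, h6, h7, h8, h9⟩, hf, -⟩
  have h' := h.frame hf (by simp [tablesCmd, divCmd, powCmd, Cmd.iw])
  exact ⟨{ a := h'.a, b := h'.b, c := h'.c, d := h'.d, n := h'.n, H := h'.H, L := h'.L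
           size := h8, J := h'.J, div_c := fun i hi => (h1 i hi).1, mod_c := fun i hi => (h1 i hi).2
           div_b := fun i hi => (h2 i hi).1, mod_b := fun i hi => (h2 i hi).2
           div_H := fun i hi => (h3 i hi).1, mod_H := fun i hi => (h3 i hi).2
           mod_W := fun i hi => (h4 i hi).2
           div_L := fun i hi => (h5 i hi).1, mod_L := fun i hi => (h5 i hi).2
           div_F := fun i hi => (h6 i hi).1, mod_F := fun i hi => (h6 i hi).2, pw := h9 }, h7⟩

end MeanValue

namespace MeanValue

open Matrix

/-! ### Reading the input and indexing the gates by their first qubits. -/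

section Input

variable {V : Type} [Fintype V] [DecidableEq V] {G : SimpleGraph V}

theorem Layer.length_le {n : ℕ} (num : V ≃ Fin n) (l : Layer G) : l.gates.length ≤ n := by
  have h := l.nodup.length_le_card
  rwa [List.length_map, Fintype.card_congr num, Fintype.card_fin] at h

/-- Gates in one layer have distinct first qubits. Hence no entry of the gate table is written
twice. -/
theorem Circuit.slot_inj {n d : ℕ} {U : Circuit G d} {s s' : ℕ} {g g' : Gate G}
    (h : U.slot n s = some g) (h' : U.slot n s' = some g') (hd : s / n = s' / n)
    (hf : g.fst = g'.fst) : s = s' := by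
  unfold Circuit.slot at h h'
  split_ifs at h with h1
  split_ifs at h' with h2
  have e : (⟨s / n, h1⟩ : Fin d) = ⟨s' / n, h2⟩ := Fin.ext hd
  rw [← e] at h'
  obtain ⟨h3, h4⟩ := List.getElem?_eq_some_iff.1 h
  obtain ⟨h5, h6⟩ := List.getElem?_eq_some_iff.1 h'
  have h7 := (U ⟨s / n, h1⟩).nodup.getElem_inj_iff (i := s % n) (j := s' % n)
    (hi := by rwa [List.length_map]) (hj := by rwa [List.length_map])
  rw [List.getElem_map, List.getElem_map, h4, h6] at h7
  have h8 := h7.1 hf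
  rw [← Nat.div_add_mod s n, ← Nat.div_add_mod s' n, hd, h8]

theorem Circuit.slot_mul_add {n d : ℕ} (U : Circuit G d) (t : Fin d) {k : ℕ} (hk : k < n) :
    U.slot n (t * n + k) = (U t).gates[k]? := by
  have := Dims.mul_add_div_mod (a := (t : ℕ)) hk
  unfold Circuit.slot
  rw [this.1, this.2, dif_pos t.2]

/-- The memory contains the input. -/
structure Input {n d : ℕ} (num : V ≃ Fin n) (U : Circuit G d)
    (O : V → Matrix (Fin 2) (Fin 2) ℂ) (δ : ℝ) (s : State) : Prop where
  len : ∀ t : Fin d, s.imem 1 t = (U t).gates.length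
  fst : ∀ k g, U.slot n k = some g → s.imem 2 (2 * k) = num g.fst
  snd : ∀ k g, U.slot n k = some g → s.imem 2 (2 * k + 1) = num g.snd
  mat : ∀ k g, U.slot n k = some g → ∀ r r' c c' : Fin 2,
    s.cmem 2 (16 * k + 8 * r + 4 * r' + 2 * c + c') =
      (g.mat : Matrix (Fin 2 × Fin 2) (Fin 2 × Fin 2) ℂ) (r, r') (c, c')
  obs : ∀ (v : V) (r c : Fin 2), s.cmem 1 (4 * num v + 2 * r + c) = O v r c
  tol : s.cmem 0 0 = (δ : ℂ)

theorem Input.frame {n d : ℕ} {num : V ≃ Fin n} {U : Circuit G d}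
    {O : V → Matrix (Fin 2) (Fin 2) ℂ} {δ : ℝ} {s s' : State} (h : Input num U O δ s)
    {A C : List ℕ} (hf : Frame A C s s') (hA : ∀ a ∈ A, 2 < a) (hC : ∀ a ∈ C, 2 < a) :
    Input num U O δ s' where
  len := by rw [hf.imem _ fun ha => by have := hA _ ha; omega]; exact h.len
  fst := by rw [hf.imem _ fun ha => by have := hA _ ha; omega]; exact h.fst
  snd := by rw [hf.imem _ fun ha => by have := hA _ ha; omega]; exact h.snd
  mat := by rw [hf.cmem _ fun ha => by have := hC _ ha; omega]; exact h.mat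
  obs := by rw [hf.cmem _ fun ha => by have := hC _ ha; omega]; exact h.obs
  tol := by rw [hf.cmem _ fun ha => by have := hC _ ha; omega]; exact h.tol

theorem ofNat_two_eq {i : ℕ} {r : Fin 2} (h : i % 2 = r) : Fin.ofNat 2 i = r := Fin.ext h

theorem input_inputState {n d : ℕ} (num : V ≃ Fin n) (sides : List ℕ) (U : Circuit G d)
    (O : V → Matrix (Fin 2) (Fin 2) ℂ) (δ : ℝ) (ω : ℕ → Bool) :
    Input num U O δ (inputState num sides U O δ ω) where
  len t := by simp [inputState]
  fst k g h := by
    have e : 2 * k / 2 = k := by omega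
    simp only [inputState, e, h]
    rw [if_pos (by omega)]
  snd k g h := by
    have e : (2 * k + 1) / 2 = k := by omega
    simp only [inputState, e, h]
    rw [if_neg (by omega)]
  mat k g h r r' c c' := by
    have e : (16 * k + 8 * (r : ℕ) + 4 * r' + 2 * c + c') / 16 = k := by omega
    simp only [inputState, e, h]
    rw [ofNat_two_eq (r := r) (by omega), ofNat_two_eq (r := r') (by omega),
      ofNat_two_eq (r := c) (by omega), ofNat_two_eq (r := c') (by omega)]
  obs v r c := by
    have e : (4 * (num v : ℕ) + 2 * r + c) / 4 = num v := by omega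
    simp only [inputState, e]
    rw [dif_pos (num v).2]
    have e' : num.symm ⟨(num v : ℕ), (num v).2⟩ = v := by simp
    rw [e', ofNat_two_eq (r := r) (by omega), ofNat_two_eq (r := c) (by omega)]
  tol := by simp [inputState]

/-- The table of the gates. -/
theorem gateTableCmd_runs {D : Dims} {num : V ≃ Fin D.n} {U : Circuit G D.d}
    {O : V → Matrix (Fin 2) (Fin 2) ℂ} {δ : ℝ} {s : State} (h : Scalars D s)
    (hi : Input num U O δ s) (ht : Tabulates D.J D.n 52 53 s) (h56 : ∀ i, s.imem 56 i = 0)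
    (hJ : D.d * D.n ≤ D.J) :
    Runs gateTableCmd s (10 + D.d * D.n * 60) fun s' =>
      (∀ k < D.d * D.n, ∀ g, U.slot D.n k = some g →
        s'.imem 56 (k / D.n * D.n + num g.fst) = k + 1) ∧
      ∀ i, s'.imem 56 i ≠ 0 → ∃ k < D.d * D.n, ∃ g, U.slot D.n k = some g ∧
        i = k / D.n * D.n + num g.fst := by
  refine (Runs.forLoop (T := 40) h.m (by decide) (by simp [Cmd.iw]) (by simp [Cmd.iw])
    -- The invariant has two halves: every gate seen so far is recorded, and every nonzero entry
    -- comes from such a gate. The second half, which relies on the array being `0` at the start,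
    -- certifies the absence of gates.
    (fun K s' => (∀ k < K, ∀ g, U.slot D.n k = some g →
        s'.imem 56 (k / D.n * D.n + num g.fst) = k + 1) ∧
      ∀ i, s'.imem 56 i ≠ 0 → ∃ k < K, ∃ g, U.slot D.n k = some g ∧
        i = k / D.n * D.n + num g.fst) ?_ ?_).mono (by omega) fun _ h => h
  · refine ⟨fun k hk => absurd hk (Nat.not_lt_zero _), fun i hi => absurd ?_ hi⟩
    rw [State.setI_ne _ _ _ (by decide), h56]
  · rintro k hk s' hf hik ⟨hA, hB⟩
    have hf' : Frame [110, 56] [] s s' := hf.mono (by simp [Cmd.iw]) (by simp [Cmd.cw])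
    have hn : s'.imem 14 0 = D.n := by rw [hf'.imem _ (by simp), h.n]
    obtain ⟨ht1, ht2⟩ := ht.frame hf' (by simp) k (hk.trans_le hJ)
    have hi' := hi.frame hf' (by simp) (by simp)
    have hkd : k / D.n < D.d := Nat.div_lt_of_lt_mul (by rwa [mul_comm])
    have hlen := hi'.len ⟨_, hkd⟩
    dsimp only at hlen
    have hslot : U.slot D.n k = (U ⟨_, hkd⟩).gates[k % D.n]? := by
      unfold Circuit.slot; rw [dif_pos hkd]
    refine (Runs.ite (T := 20) (fun hb => ?_) fun hb => ?_).mono (by simp) fun _ h => h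
    · have hlt : k % D.n < (U ⟨_, hkd⟩).gates.length := by
        simpa [hik, ht1, ht2, hlen] using hb
      set g := (U ⟨_, hkd⟩).gates[k % D.n] with hg
      rw [List.getElem?_eq_getElem hlt, ← hg] at hslot
      have hfst := hi'.fst k g hslot
      refine (Runs.istore ?_).mono (by simp) fun _ h => h
      have e : (IExp.load 52 (iv 110) * iv 14 + .load 2 (2 * iv 110)).eval s' =
          k / D.n * D.n + num g.fst := by simp [hik, ht1, hn, hfst]
      have e' : (iv 110 + 1).eval s' = k + 1 := by simp [hik]
      rw [e, e', State.setI_ne _ _ _ (by decide), State.setI_same]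
      constructor
      · intro k' hk' g' hg'
        by_cases hkk : k' = k
        · subst hkk
          rw [hslot, Option.some_inj] at hg'
          rw [← hg', Function.update_self]
        · rw [Function.update_of_ne, hA k' (by omega) g' hg']
          intro he
          have q1 := Dims.mul_add_div_mod (a := k' / D.n) (num g'.fst).2
          have q2 := Dims.mul_add_div_mod (a := k / D.n) (num g.fst).2
          rw [he] at q1
          refine hkk (Circuit.slot_inj hg' hslot (q1.1.symm.trans q2.1) ?_)
          exact num.injective (Fin.ext (q1.2.symm.trans q2.2))
      · intro i hne
        by_cases hie : i = k / D.n * D.n + num g.fst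
        · exact ⟨k, by omega, g, hslot, hie⟩
        · rw [Function.update_of_ne hie] at hne
          obtain ⟨k', hk', h'⟩ := hB i hne
          exact ⟨k', by omega, h'⟩
    · have hnone : U.slot D.n k = none := by
        rw [hslot, List.getElem?_eq_none_iff]
        have : ¬ k % D.n < (U ⟨_, hkd⟩).gates.length := by
          simpa [hik, ht1, ht2, hlen] using hb
        omega
      refine (Runs.skip ?_).mono (by omega) fun _ h => h
      rw [State.setI_ne _ _ _ (by decide)]
      constructor
      · intro k' hk' g' hg'
        by_cases hkk : k' = k
        · subst hkk; rw [hnone] at hg'; cases hg'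
        · exact hA k' (by omega) g' hg'
      · intro i hne
        obtain ⟨k', hk', h'⟩ := hB i hne
        exact ⟨k', by omega, h'⟩

theorem describes_of_table {D : Dims} {num : V ≃ Fin D.n} {U : Circuit G D.d}
    {O : V → Matrix (Fin 2) (Fin 2) ℂ} {δ : ℝ} {s : State} (ht : Tables D s)
    (hi : Input num U O δ s)
    (hA : ∀ k < D.d * D.n, ∀ g, U.slot D.n k = some g →
      s.imem 56 (k / D.n * D.n + num g.fst) = k + 1)
    (hB : ∀ i, s.imem 56 i ≠ 0 → ∃ k < D.d * D.n, ∃ g, U.slot D.n k = some g ∧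
      i = k / D.n * D.n + num g.fst) : Describes D num U O s where
  toTables := ht
  gate_none t v h := by
    by_contra hne
    obtain ⟨k, -, g, hg, e⟩ := hB _ hne
    have q1 := Dims.mul_add_div_mod (a := (t : ℕ)) (num v).2
    have q2 := Dims.mul_add_div_mod (a := k / D.n) (num g.fst).2
    rw [e] at q1
    have hv : g.fst = v := num.injective (Fin.ext (q2.2.symm.trans q1.2))
    have hk : k / D.n = t := q2.1.symm.trans q1.1
    unfold Circuit.slot at hg
    rw [dif_pos (by rw [hk]; exact t.2)] at hg
    refine h g ?_ hv
    have := List.mem_of_getElem? hg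
    convert this
    exact hk.symm
  gate_some t g hg := by
    obtain ⟨k, hk, rfl⟩ := List.getElem_of_mem hg
    have hkn := hk.trans_le ((U t).length_le num)
    have hs : U.slot D.n (t * D.n + k) = some (U t).gates[k] := by
      rw [U.slot_mul_add t hkn, List.getElem?_eq_getElem hk]
    have hlt : t * D.n + k < D.d * D.n := by
      have : (t + 1 : ℕ) * D.n ≤ D.d * D.n := Nat.mul_le_mul_right _ t.2
      rw [add_mul] at this
      omega
    refine ⟨t * D.n + k, ?_, hi.snd _ _ hs, hi.mat _ _ hs⟩
    have := hA _ hlt _ hs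
    rwa [(Dims.mul_add_div_mod (a := (t : ℕ)) hkn).1] at this
  obs := hi.obs

end Input

/-! ### The number of samples and the random fraction. -/

theorem exists_count {δ : ℝ} (hδ : 0 < δ) : ∃ S : ℕ, 1 ≤ S ∧ 4 ≤ S * δ ^ 2 := by
  obtain ⟨S, hS⟩ := exists_nat_ge (4 / δ ^ 2)
  refine ⟨S + 1, by omega, ?_⟩
  have h2 : 0 < δ ^ 2 := by positivity
  rw [div_le_iff₀ h2] at hS
  push_cast
  nlinarith

open Classical in
/-- The number of samples. -/
noncomputable def sampleCount {δ : ℝ} (hδ : 0 < δ) : ℕ := Nat.find (exists_count hδ)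

section Count

variable {δ : ℝ} (hδ : 0 < δ)

theorem one_le_sampleCount : 1 ≤ sampleCount hδ := by
  classical exact (Nat.find_spec (exists_count hδ)).1

theorem le_sampleCount : 4 ≤ sampleCount hδ * δ ^ 2 := by
  classical exact (Nat.find_spec (exists_count hδ)).2

theorem lt_sampleCount {S : ℕ} (h : S < sampleCount hδ) (hS : 1 ≤ S) : ¬ 4 ≤ S * δ ^ 2 := by
  classical
  exact fun h' => Nat.find_min (exists_count hδ) h ⟨hS, h'⟩

/-- By minimality a count above `1` is less than `4 / δ ^ 2 + 1`. -/
theorem sampleCount_le : (sampleCount hδ : ℝ) ≤ 5 * max 1 (δ ^ (-2 : ℤ)) := by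
  have h1 := one_le_sampleCount hδ
  have h2 : 0 < δ ^ 2 := by positivity
  have e : δ ^ (-2 : ℤ) = (δ ^ 2)⁻¹ := by rw [_root_.zpow_neg]; rfl
  rw [e]
  rcases Nat.lt_or_ge 1 (sampleCount hδ) with h | h
  · have h3 := lt_sampleCount hδ (S := sampleCount hδ - 1) (by omega) (by omega)
    rw [not_le, ← lt_div_iff₀ h2, Nat.cast_sub h1, div_eq_mul_inv] at h3
    have h4 := le_max_left 1 (δ ^ 2)⁻¹
    have h5 := le_max_right 1 (δ ^ 2)⁻¹
    push_cast at h3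
    linarith
  · have : (sampleCount hδ : ℝ) = 1 := by
      have : sampleCount hδ = 1 := by omega
      exact_mod_cast this
    have h4 := le_max_left 1 (δ ^ 2)⁻¹
    rw [this]; linarith

theorem countCmd_runs {s : State} (hs : s.cmem 0 0 = (δ : ℂ)) :
    Runs countCmd s (30 + sampleCount hδ * 20) fun s' => s'.imem 24 0 = sampleCount hδ := by
  have main : ∀ m k s, 1 ≤ k → k + m = sampleCount hδ → s.cmem 0 0 = (δ : ℂ) → s.imem 24 0 = k →
      Runs (.loop (.not (.cle 4 (.cast (iv 24) * (cv 0 * cv 0)))) (iset 24 (iv 24 + 1))) s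
        (20 + m * 20) fun s' => s'.imem 24 0 = sampleCount hδ := by
    intro m
    induction m with
    | zero =>
      intro k s _ hk hδs h24
      refine ⟨s, _, .loop_done ?_, ?_, by dsimp only; rw [h24, ← hk]; rfl⟩
      · have h := le_sampleCount hδ
        rw [← hk, add_zero] at h
        have e : ((k : ℂ) * ((δ : ℂ) * δ)) = ((k * δ ^ 2 : ℝ) : ℂ) := by push_cast; ring
        simp only [BExp.eval_not, BExp.eval_cle, not_not, CExp.eval_mul, CExp.eval_load,
          CExp.eval_cast, IExp.eval_load, IExp.eval_ofNat, h24, hδs, CExp.eval_ofNat, e,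
          Complex.ofReal_re]
        simpa using h
      · simp
    | succ m ih =>
      intro k s h1 hk hδs h24
      obtain ⟨s', t, he, ht, hq⟩ := ih (k + 1) (s.setI 24 0 (k + 1)) (by omega) (by omega) hδs
        (by rw [State.setI_same]; simp)
      have hst := Exec.istore s 24 0 (iv 24 + 1)
      simp only [IExp.eval_ofNat, IExp.eval_add, IExp.eval_load, h24] at hst
      refine ⟨s', _, .loop_step ?_ hst he, ?_, hq⟩
      · have h := lt_sampleCount hδ (S := k) (by omega) h1
        have e : ((k : ℂ) * ((δ : ℂ) * δ)) = ((k * δ ^ 2 : ℝ) : ℂ) := by push_cast; ring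
        simp only [BExp.eval_not, BExp.eval_cle, CExp.eval_mul, CExp.eval_load,
          CExp.eval_cast, IExp.eval_load, IExp.eval_ofNat, h24, hδs, CExp.eval_ofNat, e,
          Complex.ofReal_re]
        simpa using h
      · simp; omega
  have h1 := one_le_sampleCount hδ
  refine (Runs.seq (T := 5) (T' := 20 + (sampleCount hδ - 1) * 20)
    (Runs.iset (a := 24) (e := 1) (by simp) fun s' hf h => ?_)).mono (by omega) fun _ h => h
  exact main _ 1 s' le_rfl (by omega) (by rw [hf.cmem _ (by simp), hs]) h

end Count

theorem coinsCmd_runs {s : State} {n S : ℕ} (hn : s.imem 14 0 = n) (hS : s.imem 24 0 = S) :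
    Runs coinsCmd s (50 + (2 * n * S + 4) * 40) fun s' => s'.cmem 102 0 =
      (((coinNat s.coins (2 * n * S + 4) : ℝ) / 2 ^ (2 * n * S + 4) : ℝ) : ℂ) := by
  set m := 2 * n * S + 4
  refine (Runs.seq (T := 15) (T' := 35 + m * 40) ((Runs.istore ?_).mono (by simp)
    fun _ h => h)).mono (by omega) fun _ h => h
  refine (Runs.seq (T := 5) (T' := 30 + m * 40) ((Runs.cstore ?_).mono (by simp)
    fun _ h => h)).mono (by omega) fun _ h => h
  refine (Runs.seq (T := 5) (T' := 25 + m * 40) ((Runs.cstore ?_).mono (by simp)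
    fun _ h => h)).mono (by omega) fun _ h => h
  set s₁ := ((s.setI 25 _ _).setC 102 _ _).setC 107 _ _ with hs₁
  have h25 : s₁.imem 25 0 = m := by simp [hs₁, State.setI_same, hn, hS, m]
  have hc : s₁.coins = s.coins := rfl
  refine (Runs.seq (T := 10 + m * 38) (T' := 15) ((Runs.forLoop (n := m) (T := 25) h25
    -- After `k` tosses the variable `102` holds the integer with these binary digits, lowest first,
    -- and `107` holds the next power of two. The final division makes a fraction of it.
    (by decide) (by simp [Cmd.iw]) (by simp [Cmd.iw]) (fun k s' =>
      s'.coins = (fun i => s.coins (k + i)) ∧ s'.cmem 102 0 = (coinNat s.coins k : ℂ) ∧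
        s'.cmem 107 0 = 2 ^ k) ?_ ?_).mono (by omega) ?_)).mono (by omega) fun _ h => h
  · refine ⟨?_, ?_, ?_⟩
    · simp [hc]
    · simp [hs₁, State.cmem_setC, coinNat]
    · simp [hs₁, State.cmem_setC]
  · rintro k hk s' - - ⟨h1, h2, h3⟩
    refine (Runs.seq (T := 3) (T' := 22) ((Runs.flip ?_).mono (by simp) fun _ h => h)).mono
      (by omega) fun _ h => h
    refine (Runs.seq (T := 12) (T' := 10) ((Runs.cstore ?_).mono (by simp) fun _ h => h)).mono
      (by omega) fun _ h => h
    refine (Runs.cstore ?_).mono (by simp) fun _ h => h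
    refine ⟨?_, ?_, ?_⟩
    · simp only [State.coins_setI, State.coins_setC]
      funext i
      change s'.coins (i + 1) = _
      rw [h1]
      exact congrArg s.coins (by omega)
    · simp [State.cmem_setC, State.setI_same, State.dropCoin, h1, h2, h3, coinNat]
    · have : s'.dropCoin.cmem = s'.cmem := rfl
      simp [State.cmem_setC, this, h3, pow_succ, mul_two]
  · rintro s₂ ⟨-, h2, h3⟩
    refine (Runs.cstore ?_).mono (by simp) fun _ h => h
    rw [State.cmem_setC, if_pos rfl]
    simp [h2, h3]

end MeanValue

namespace MeanValue

open Matrix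

/-! ### The estimator -/

/-- The estimator, once the side lengths and the depth are known. -/
def estimateCmd : Cmd :=
  .seq scalarsCmd (.seq tablesCmd (.seq gateTableCmd (.seq countCmd (.seq coinsCmd averageCmd))))

section Estimate

variable {V : Type} [Fintype V] [DecidableEq V] {G : SimpleGraph V} {D : Dims}
  {num : V ≃ Fin D.n} (hG : D.IsGrid G num) {U : Circuit G D.d}
  {O : V → Matrix (Fin 2) (Fin 2) ℂ} {δ : ℝ} (hδ : 0 < δ) {s : State}

theorem Dims.d_mul_n_le (D : Dims) : D.d * D.n ≤ D.J := by
  rw [Dims.count_eq]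
  calc D.d * D.n = D.a * D.b * D.d * D.c := by unfold Dims.n; ring
    _ ≤ _ := Nat.mul_le_mul_right _ (Nat.mul_le_mul (by omega) ?_)
  calc D.d ≤ 1 * D.d := by omega
    _ ≤ (2 * D.d + 2) * (4 * D.d + 2) := Nat.mul_le_mul (by omega) (by omega)

/-- The sampling loop dominates: parameters, tables, the search for the number of samples and the
coin tosses are all bounded by constant multiples of `K`, the number of samples times the number of
steps times the length of the vector. -/
theorem estimateCmd_runs (hn : 0 < D.n)
    (hO : ∀ v, ‖Matrix.toEuclideanCLM (n := Fin 2) (𝕜 := ℂ) (O v)‖ ≤ 1)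
    (hi : Input num U O δ s) (ha : s.imem 10 0 = D.a) (hb : s.imem 11 0 = D.b)
    (hc : s.imem 12 0 = D.c) (hd : s.imem 13 0 = D.d) (h56 : ∀ i, s.imem 56 i = 0) :
    Runs estimateCmd s (20000 * (sampleCount hδ * (D.J * 2 ^ D.w))) fun s' => s'.cmem 3 0 =
      total Node.N (Layout.value ((Dims.layout hG (2 * D.d + 1) le_rfl).amp U O))
        ((Dims.layout hG 0 (Nat.zero_le _)).leaves U (fun v => (O v)ᴴ)
          (Dims.layout hG 0 (Nat.zero_le _)).schedule Layout.root) (sampleCount hδ)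
        ((coinNat s.coins (2 * D.n * sampleCount hδ + 4) : ℝ) /
          2 ^ (2 * D.n * sampleCount hδ + 4)) / sampleCount hδ := by
  set S := sampleCount hδ with hSd
  have hS1 : 1 ≤ S := one_le_sampleCount hδ
  have hJ1 : 1 ≤ D.J := by have := Dims.le_J (D := D) hG.c_pos; omega
  have hN1 : 1 ≤ 2 ^ D.w := Nat.one_le_two_pow
  have hwN : D.w ≤ 2 ^ D.w := Nat.lt_two_pow_self.le
  have hdn := Dims.d_mul_n_le D
  have hnJ := Dims.n_le_J D
  set M := D.J * 2 ^ D.w with hM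
  have hJM : D.J ≤ M := Nat.le_mul_of_pos_right _ hN1
  have hNM : 2 ^ D.w ≤ M := Nat.le_mul_of_pos_left _ hJ1
  have hMS : M ≤ S * M := Nat.le_mul_of_pos_left _ hS1
  have hSS : S ≤ S * M := Nat.le_mul_of_pos_right _ (by omega)
  have hnS : D.n * S ≤ S * M := by
    rw [mul_comm]; exact Nat.mul_le_mul_left _ (hnJ.trans hJM)
  set K := S * M with hK
  have hK1 : 1 ≤ K := by omega
  refine (Runs.seq (T := 200) (T' := 19800 * K) ((scalarsCmd_runs ha hb hc hd).frame.mono le_rfl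
    ?_)).mono (by omega) fun _ h => h
  rintro s₁ ⟨hs₁, hf, hc₁⟩
  have hf₁ : Frame [14, 15, 16, 17, 18, 20, 21, 22, 23] [] s s₁ :=
    hf.mono (by simp [scalarsCmd, Cmd.iw]) (by simp [scalarsCmd, Cmd.cw])
  replace hi := hi.frame hf₁ (by simp) (by simp)
  replace h56 : ∀ i, s₁.imem 56 i = 0 := by rw [hf₁.imem _ (by simp)]; exact h56
  rw [← hc₁ rfl]
  clear hf hf₁ hc₁ ha hb hc hd
  refine (Runs.seq (T := 300 + D.J * 560 + D.w * 50) (T' := 18800 * K)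
    ((tablesCmd_runs hs₁ hG.b_pos hG.c_pos hn).frame.mono le_rfl ?_)).mono (by omega) fun _ h => h
  rintro s₂ ⟨⟨ht₂, ht⟩, hf, hc₂⟩
  have hA : ∀ a ∈ tablesCmd.iw, a = 19 ∨ 23 < a ∧ a ≠ 56 := by
    simp [tablesCmd, divCmd, powCmd, Cmd.iw]
  have hs₂ := hs₁.frame hf fun a ha => by have := hA a ha; omega
  replace hi := hi.frame hf (fun a ha => by have := hA a ha; omega)
    (by simp [tablesCmd, divCmd, powCmd, Cmd.cw])
  replace h56 : ∀ i, s₂.imem 56 i = 0 := by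
    rw [hf.imem _ fun ha => by have := hA _ ha; omega]; exact h56
  rw [← hc₂ (by simp [tablesCmd, divCmd, powCmd, Cmd.coinFree])]
  clear hf hc₂ hA hs₁
  refine (Runs.seq (T := 10 + D.d * D.n * 60) (T' := 18700 * K)
    ((gateTableCmd_runs hs₂ hi ht h56 hdn).frame.mono le_rfl ?_)).mono (by omega) fun _ h => h
  rintro s₃ ⟨⟨hA, hB⟩, hf, hc₃⟩
  have hf₃ : Frame [110, 56] [] s₂ s₃ :=
    hf.mono (by simp [gateTableCmd, Cmd.iw]) (by simp [gateTableCmd, Cmd.cw])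
  have hs₃ := hs₂.frame hf₃ (by simp)
  replace hi := hi.frame hf₃ (by simp) (by simp)
  have ht₃ := ht₂.frame hf₃ (by simp)
  rw [← hc₃ (by simp [gateTableCmd, Cmd.coinFree])]
  clear hf hf₃ hc₃ hs₂ h56 ht
  refine (Runs.seq (T := 30 + S * 20) (T' := 18600 * K)
    ((countCmd_runs hδ hi.tol).frame.mono le_rfl ?_)).mono (by omega) fun _ h => h
  rintro s₄ ⟨hS, hf, hc₄⟩
  have hf₄ : Frame [24] [] s₃ s₄ :=
    hf.mono (by simp [countCmd, Cmd.iw]) (by simp [countCmd, Cmd.cw])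
  have hs₄ := hs₃.frame hf₄ (by simp)
  have ht₄ := ht₃.frame hf₄ (by simp)
  replace hi := hi.frame hf₄ (by simp) (by simp)
  have h56₄ : s₄.imem 56 = s₃.imem 56 := hf₄.imem _ (by simp)
  rw [← hc₄ (by simp [countCmd, Cmd.coinFree])]
  clear hf hf₄ hc₄ hs₃
  refine (Runs.seq (T := 50 + (2 * D.n * S + 4) * 40) (T' := 18000 * K)
    ((coinsCmd_runs hs₄.n hS).frame.mono le_rfl ?_)).mono ?_ fun _ h => h
  swap
  · have : 2 * D.n * S = 2 * (D.n * S) := by ring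
    omega
  rintro s₅ ⟨hu, hf, -⟩
  have hf₅ : Frame [25, 112, 113] [102, 107] s₄ s₅ :=
    hf.mono (by simp [coinsCmd, Cmd.iw]) (by simp [coinsCmd, Cmd.cw])
  have h56₅ : s₅.imem 56 = s₃.imem 56 := by rw [hf₅.imem _ (by simp), h56₄]
  have hd₅ := describes_of_table (ht₄.frame hf₅ (by simp)) (hi.frame hf₅ (by simp) (by simp))
    (by rw [h56₅]; exact hA) (by rw [h56₅]; exact hB)
  have hS₅ : s₅.imem 24 0 = S := by rw [hf₅.imem _ (by simp)]; exact hS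
  refine (averageCmd_runs (hG := hG) hO hd₅ hu (by positivity) ?_ hS₅).mono ?_ fun _ h => h
  · rw [div_lt_one (by positivity)]
    exact_mod_cast coinNat_lt _ _
  · have : S * (10100 * (D.J * 2 ^ D.w)) = 10100 * K := by rw [hK, hM]; ring
    omega

end Estimate

end MeanValue

namespace MeanValue

open Matrix

instance : IsProbabilityMeasure coinMeasure := by
  unfold coinMeasure; infer_instance

/-! ### Correctness and running time for a general grid. -/

section Estimate

variable {V : Type} [Fintype V] [DecidableEq V] {G : SimpleGraph V} {D : Dims}

/-- Here the sampler meets the law of large numbers: the leaf weights form a probability vector, the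
expectation is the mean value because the cores are complementary, the second moment is at most `1`,
and there are at most `3 ^ n` leaves. -/
theorem leaves_concentrate {num : V ≃ Fin D.n} (hG : D.IsGrid G num) (U : Circuit G D.d)
    {O : V → Matrix (Fin 2) (Fin 2) ℂ}
    (hO : ∀ v, ‖Matrix.toEuclideanCLM (n := Fin 2) (𝕜 := ℂ) (O v)‖ ≤ 1) {δ : ℝ} (hδ : 0 < δ) :
    2 / 3 ≤ coinMeasure.real {ω | ‖total Node.N
      (Layout.value ((Dims.layout hG (2 * D.d + 1) le_rfl).amp U O))
        ((Dims.layout hG 0 (Nat.zero_le _)).leaves U (fun v => (O v)ᴴ)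
          (Dims.layout hG 0 (Nat.zero_le _)).schedule Layout.root) (sampleCount hδ)
        ((coinNat ω (2 * D.n * sampleCount hδ + 4) : ℝ) /
          2 ^ (2 * D.n * sampleCount hδ + 4)) / sampleCount hδ - meanValue U O‖ ≤ δ} := by
  have hO' : ∀ v, ‖Matrix.toEuclideanCLM (n := Fin 2) (𝕜 := ℂ) (O v)ᴴ‖ ≤ 1 := fun v => by
    rw [norm_toEuclideanCLM_conjTranspose]; exact hO v
  refine le_coinMeasure_total (fun a ha => ((Dims.layout hG 0 (Nat.zero_le _)).leaves_consistent U _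
    hO' _ Layout.root_consistent a ha).1) (Layout.leaves_sum _ U _ _ _) ?_ ?_ hδ
    (le_sampleCount hδ) ?_
  · rw [Layout.sum_weight_mul_value _ U _ hO']
    exact (meanValue_eq_sum U O _ _ (Dims.layout_core_compl hG)).symm
  · exact Layout.sum_weight_mul_normSq_value_le _ U _ hO' _ (Layout.sum_normSq_amp_le _ U O hO)
  · refine (Layout.length_leaves_le _ _ _ _ _).trans (Nat.pow_le_pow_right (by norm_num) ?_)
    refine (Layout.length_filter_schedule_le _).trans ?_
    rw [Fintype.card_congr num, Fintype.card_fin]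

theorem estimatesInTime {n : ℕ} (hDn : D.n = n) (hn : 0 < n) (num : V ≃ Fin n) (hb : 0 < D.b)
    (hc : 0 < D.c) (hrow : ∀ u v, G.Adj u v → D.row (num u) ≤ D.row (num v) + 1)
    (hcol : ∀ u v, G.Adj u v → D.col (num u) ≤ D.col (num v) + 1) (U : Circuit G D.d)
    {O : V → Matrix (Fin 2) (Fin 2) ℂ}
    (hO : ∀ v, ‖Matrix.toEuclideanCLM (n := Fin 2) (𝕜 := ℂ) (O v)‖ ≤ 1) {δ : ℝ} (hδ : 0 < δ)
    {hdr : Cmd} {sides : List ℕ}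
    (hh : ∀ ω, Runs hdr (inputState num sides U O δ ω) 50 fun s =>
      Frame [10, 11, 12, 13] [] (inputState num sides U O δ ω) s ∧ s.coins = ω ∧
        s.imem 10 0 = D.a ∧ s.imem 11 0 = D.b ∧ s.imem 12 0 = D.c ∧ s.imem 13 0 = D.d) {T : ℝ}
    (hT : 100250 * max 1 (δ ^ (-2 : ℤ)) * (D.J * 2 ^ D.w : ℕ) ≤ T) :
    EstimatesInTime (.seq hdr estimateCmd) (inputState num sides U O δ) (meanValue U O) δ T := by
  subst hDn
  have hG : D.IsGrid G num := ⟨hb, hc, hrow, hcol⟩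
  set tot : (ℕ → Bool) → ℂ := fun ω => total Node.N
      (Layout.value ((Dims.layout hG (2 * D.d + 1) le_rfl).amp U O))
        ((Dims.layout hG 0 (Nat.zero_le _)).leaves U (fun v => (O v)ᴴ)
          (Dims.layout hG 0 (Nat.zero_le _)).schedule Layout.root) (sampleCount hδ)
        ((coinNat ω (2 * D.n * sampleCount hδ + 4) : ℝ) /
          2 ^ (2 * D.n * sampleCount hδ + 4)) / sampleCount hδ with htot
  have key : ∀ ω, Runs (.seq hdr estimateCmd) (inputState num sides U O δ ω)
      (50 + 20000 * (sampleCount hδ * (D.J * 2 ^ D.w))) fun s => s.cmem 3 0 = tot ω := by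
    intro ω
    refine Runs.seq ((hh ω).mono le_rfl ?_)
    rintro s ⟨hf, hω, h1, h2, h3, h4⟩
    have := estimateCmd_runs hG hδ hn hO
      ((input_inputState num sides U O δ ω).frame hf (by simp) (by simp)) h1 h2 h3 h4
      (by rw [hf.imem _ (by simp)]; intro i; rfl)
    rwa [hω] at this
  constructor
  · intro ω
    obtain ⟨s, t, he, ht, -⟩ := key ω
    refine ⟨s, t, he, le_trans ?_ hT⟩
    have hS := sampleCount_le hδ
    have hX : 1 ≤ sampleCount hδ * (D.J * 2 ^ D.w) := Nat.mul_pos (one_le_sampleCount hδ)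
      (Nat.mul_pos (by have := Dims.le_J (D := D) hc; omega) (by positivity))
    -- The `50` steps of the header are absorbed, as the product is at least `1`. Multiplication by
    -- the `5` from `sampleCount_le` gives `100250`.
    have ht' : (t : ℝ) ≤ 20050 * (sampleCount hδ * (D.J * 2 ^ D.w : ℕ)) := by
      exact_mod_cast ht.trans (by omega)
    refine ht'.trans ?_
    have := mul_le_mul_of_nonneg_right hS (Nat.cast_nonneg (α := ℝ) (D.J * 2 ^ D.w))
    linarith
  · refine (leaves_concentrate hG U hO hδ).trans (measureReal_mono ?_)
    intro ω hω
    obtain ⟨s, t, he, -, hs⟩ := key ω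
    refine ⟨s, t, he, ?_⟩
    rw [hs]
    exact hω

end Estimate

/-! ### Grids of dimension two and three -/

/-- Read the side lengths and the depth in dimension two. -/
def planeCmd : Cmd :=
  .seq (iset 10 (.load 0 0)) (.seq (iset 11 (.load 0 1)) (.seq (iset 12 1) (iset 13 (.load 0 2))))

/-- Read the side lengths and the depth in dimension three. -/
def spaceCmd : Cmd :=
  .seq (iset 10 (.load 0 0)) (.seq (iset 11 (.load 0 1)) (.seq (iset 12 (.load 0 2))
    (iset 13 (.load 0 3))))

theorem planeCmd_runs (s : State) : Runs planeCmd s 50 fun s' => Frame [10, 11, 12, 13] [] s s' ∧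
    s'.coins = s.coins ∧ s'.imem 10 0 = s.imem 0 0 ∧ s'.imem 11 0 = s.imem 0 1 ∧
      s'.imem 12 0 = 1 ∧ s'.imem 13 0 = s.imem 0 2 := by
  have : Runs planeCmd s (5 + (5 + (5 + 5))) fun s' => s'.imem 10 0 = s.imem 0 0 ∧
      s'.imem 11 0 = s.imem 0 1 ∧ s'.imem 12 0 = 1 ∧ s'.imem 13 0 = s.imem 0 2 := by
    refine Runs.seq ((Runs.istore ?_).mono (by simp) fun _ h => h)
    refine Runs.seq ((Runs.istore ?_).mono (by simp) fun _ h => h)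
    refine Runs.seq ((Runs.istore ?_).mono (by simp) fun _ h => h)
    refine (Runs.istore ?_).mono (by simp) fun _ h => h
    simp [State.imem_setI]
  refine this.frame.mono (by norm_num) fun s' ⟨h, hf, hc⟩ => ⟨hf.mono ?_ ?_, hc rfl, h⟩
  · simp [planeCmd, Cmd.iw]
  · simp [planeCmd, Cmd.cw]

theorem spaceCmd_runs (s : State) : Runs spaceCmd s 50 fun s' => Frame [10, 11, 12, 13] [] s s' ∧
    s'.coins = s.coins ∧ s'.imem 10 0 = s.imem 0 0 ∧ s'.imem 11 0 = s.imem 0 1 ∧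
      s'.imem 12 0 = s.imem 0 2 ∧ s'.imem 13 0 = s.imem 0 3 := by
  have : Runs spaceCmd s (5 + (5 + (5 + 5))) fun s' => s'.imem 10 0 = s.imem 0 0 ∧
      s'.imem 11 0 = s.imem 0 1 ∧ s'.imem 12 0 = s.imem 0 2 ∧ s'.imem 13 0 = s.imem 0 3 := by
    refine Runs.seq ((Runs.istore ?_).mono (by simp) fun _ h => h)
    refine Runs.seq ((Runs.istore ?_).mono (by simp) fun _ h => h)
    refine Runs.seq ((Runs.istore ?_).mono (by simp) fun _ h => h)
    refine (Runs.istore ?_).mono (by simp) fun _ h => h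
    simp [State.imem_setI]
  refine this.frame.mono (by norm_num) fun s' ⟨h, hf, hc⟩ => ⟨hf.mono ?_ ?_, hc rfl, h⟩
  · simp [spaceCmd, Cmd.iw]
  · simp [spaceCmd, Cmd.cw]

theorem row_col_num2 (a b c d : ℕ) (v : Fin a × Fin b) {q : ℕ} (hq : q / c = num2 a b v) :
    Dims.row ⟨a, b, c, d⟩ q = v.1 ∧ Dims.col ⟨a, b, c, d⟩ q = v.2 := by
  have e : (num2 a b v : ℕ) = v.1 * b + v.2 := by
    simp [num2, finProdFinEquiv]; ring
  have := Dims.mul_add_div_mod (a := (v.1 : ℕ)) v.2.2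
  unfold Dims.row Dims.col
  dsimp only
  rw [hq, e]
  exact this

theorem pathGraph_le {n : ℕ} {i j : Fin n} (h : (SimpleGraph.pathGraph n).Adj i j) :
    (i : ℕ) ≤ j + 1 := by
  rw [SimpleGraph.pathGraph_adj] at h
  omega

theorem grid2_le {a b : ℕ} {u v : Fin a × Fin b} (h : (grid2 a b).Adj u v) :
    (u.1 : ℕ) ≤ v.1 + 1 ∧ (u.2 : ℕ) ≤ v.2 + 1 := by
  rw [grid2, SimpleGraph.boxProd_adj] at h
  rcases h with ⟨h, e⟩ | ⟨h, e⟩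
  · exact ⟨pathGraph_le h, by rw [e]; omega⟩
  · exact ⟨by rw [e]; omega, pathGraph_le h⟩

theorem num3_div (m : ℕ) (v : (Fin m × Fin m) × Fin m) : (num3 m v : ℕ) / m = num2 m m v.1 := by
  have e : (num3 m v : ℕ) = num2 m m v.1 * m + v.2 := by
    simp [num3, finProdFinEquiv]; ring
  rw [e]
  exact (Dims.mul_add_div_mod v.2.2).1

theorem steps_bound (d : ℕ) : (4 * d + 3) * ((2 * d + 2) * (4 * d + 2)) ≤ 2 ^ (3 * d + 5) := by
  have h : d + 1 ≤ 2 ^ d := Nat.lt_two_pow_self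
  calc (4 * d + 3) * ((2 * d + 2) * (4 * d + 2))
      ≤ (4 * 2 ^ d) * ((2 * 2 ^ d) * (4 * 2 ^ d)) :=
        Nat.mul_le_mul (by omega) (Nat.mul_le_mul (by omega) (by omega))
    _ = 2 ^ (3 * d + 5) := by rw [pow_add, pow_mul']; ring

/-- The memory has `16 d² + 24 d + 8 ≤ 40 d² + 8` bits, and the polynomial factors in `d` cost at
most `3 d + 5` further binary digits. The constant `13 = 8 + 5` in the exponent is split off as
`8192`, so that depth `0` is covered. -/
theorem plane_bound {a b : ℕ} (d : ℕ) (hn : 0 < a * b) : Dims.J ⟨a, b, 1, d⟩ *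
    2 ^ Dims.w ⟨a, b, 1, d⟩ ≤ a * b * (8192 * 2 ^ (43 * d ^ 2)) := by
  rw [Dims.count_eq]
  have h1 : a * b + 4 * d + 2 ≤ a * b * (4 * d + 3) := by nlinarith
  have hd : d ≤ d ^ 2 := Nat.le_self_pow (by norm_num) d
  have hw : Dims.w ⟨a, b, 1, d⟩ ≤ 40 * d ^ 2 + 8 := by
    have : Dims.w ⟨a, b, 1, d⟩ = 16 * d ^ 2 + 24 * d + 8 := by
      simp only [Dims.w, Dims.L, Dims.H]; ring
    omega
  calc (a * b + 4 * d + 2) * ((2 * d + 2) * (4 * d + 2)) * 1 * 2 ^ Dims.w ⟨a, b, 1, d⟩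
      ≤ (a * b * (4 * d + 3)) * ((2 * d + 2) * (4 * d + 2)) * 1 * 2 ^ (40 * d ^ 2 + 8) :=
        Nat.mul_le_mul (Nat.mul_le_mul_right _ (Nat.mul_le_mul_right _ h1))
          (Nat.pow_le_pow_right (by norm_num) hw)
    _ = a * b * (((4 * d + 3) * ((2 * d + 2) * (4 * d + 2))) * 2 ^ (40 * d ^ 2 + 8)) := by ring
    _ ≤ a * b * (2 ^ (3 * d + 5) * 2 ^ (40 * d ^ 2 + 8)) :=
        Nat.mul_le_mul_left _ (Nat.mul_le_mul_right _ (steps_bound d))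
    _ = a * b * 2 ^ (3 * d + 5 + (40 * d ^ 2 + 8)) := by rw [← pow_add]
    _ ≤ a * b * 2 ^ (13 + 43 * d ^ 2) :=
        Nat.mul_le_mul_left _ (Nat.pow_le_pow_right (by norm_num) (by omega))
    _ = a * b * (8192 * 2 ^ (43 * d ^ 2)) := by rw [pow_add]; norm_num

/-- Since `m` and `d` are positive, every term of the exponent is at most its coefficient times `d²
m`, and `76` is the sum `17 + 3 + 5 + 3 + 16 + 24 + 8`. The polynomial factor `m ^ 3` is absorbed as
well. -/
theorem space_bound {m d : ℕ} (hm : 0 < m) (hd : 0 < d) : 100250 * (Dims.J ⟨m, m, m, d⟩ *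
    2 ^ Dims.w ⟨m, m, m, d⟩) ≤ 2 ^ (76 * d ^ 2 * m) := by
  rw [Dims.count_eq]
  have h0 : 0 < m * m := Nat.mul_pos hm hm
  have h1 : m * m + 4 * d + 2 ≤ m * m * (4 * d + 3) := by nlinarith
  have h2 : m ≤ 2 ^ m := Nat.lt_two_pow_self.le
  have e1 : m ≤ d ^ 2 * m := Nat.le_mul_of_pos_left _ (by positivity)
  have e2 : d ≤ d ^ 2 * m := (Nat.le_self_pow (by norm_num) d).trans (Nat.le_mul_of_pos_right _ hm)
  have e3 : d * m ≤ d ^ 2 * m := Nat.mul_le_mul_right _ (Nat.le_self_pow (by norm_num) d)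
  have hw : Dims.w ⟨m, m, m, d⟩ = 16 * (d ^ 2 * m) + 24 * (d * m) + 8 * m := by
    simp only [Dims.w, Dims.L, Dims.H]; ring
  calc 100250 * ((m * m + 4 * d + 2) * ((2 * d + 2) * (4 * d + 2)) * m * 2 ^ Dims.w ⟨m, m, m, d⟩)
      ≤ 2 ^ 17 * ((m * m * (4 * d + 3)) * ((2 * d + 2) * (4 * d + 2)) * m *
          2 ^ Dims.w ⟨m, m, m, d⟩) :=
        Nat.mul_le_mul (by norm_num) (Nat.mul_le_mul_right _ (Nat.mul_le_mul_right _
          (Nat.mul_le_mul_right _ h1)))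
    _ = 2 ^ 17 * (((4 * d + 3) * ((2 * d + 2) * (4 * d + 2))) * (m * m * m) *
          2 ^ Dims.w ⟨m, m, m, d⟩) := by ring
    _ ≤ 2 ^ 17 * (2 ^ (3 * d + 5) * (2 ^ m * 2 ^ m * 2 ^ m) * 2 ^ Dims.w ⟨m, m, m, d⟩) :=
        Nat.mul_le_mul_left _ (Nat.mul_le_mul_right _ (Nat.mul_le_mul (steps_bound d)
          (Nat.mul_le_mul (Nat.mul_le_mul h2 h2) h2)))
    _ = 2 ^ (17 + (3 * d + 5 + (m + m + m) + Dims.w ⟨m, m, m, d⟩)) := by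
        simp only [pow_add]
    _ ≤ 2 ^ (76 * d ^ 2 * m) := by
        refine Nat.pow_le_pow_right (by norm_num) ?_
        rw [hw, mul_assoc 76]
        omega

end MeanValue
theorem mainTheorem5 :
    (∃ (p : MeanValue.Cmd) (C : ℕ), ∀ (a b d : ℕ), 0 < a → 0 < b →
      ∀ (U : MeanValue.Circuit (MeanValue.grid2 a b) d)
        (O : Fin a × Fin b → Matrix (Fin 2) (Fin 2) ℂ),
        (∀ v, ‖Matrix.toEuclideanCLM (n := Fin 2) (𝕜 := ℂ) (O v)‖ ≤ 1) →
        ∀ δ : ℝ, 0 < δ →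
          MeanValue.EstimatesInTime p
            (MeanValue.inputState (MeanValue.num2 a b) [a, b] U O δ)
            (MeanValue.meanValue U O) δ
            (C * ((a * b : ℕ) : ℝ) * max 1 (δ ^ (-2 : ℤ)) * 2 ^ (C * d ^ 2))) ∧
    (∃ (p : MeanValue.Cmd) (C : ℕ), ∀ (m d : ℕ), 0 < m → 0 < d →
      ∀ (U : MeanValue.Circuit (MeanValue.grid3 m) d)
        (O : (Fin m × Fin m) × Fin m → Matrix (Fin 2) (Fin 2) ℂ),
        (∀ v, ‖Matrix.toEuclideanCLM (n := Fin 2) (𝕜 := ℂ) (O v)‖ ≤ 1) →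
        ∀ δ : ℝ, 0 < δ →
          MeanValue.EstimatesInTime p
            (MeanValue.inputState (MeanValue.num3 m) [m, m, m] U O δ)
            (MeanValue.meanValue U O) δ
            (max 1 (δ ^ (-2 : ℤ)) * 2 ^ (C * d ^ 2 * m))) := by
  constructor
  -- The constant is dictated by the prefactor; in the exponent `43` would suffice.
  · refine ⟨.seq MeanValue.planeCmd MeanValue.estimateCmd, 100250 * 8192,
      fun a b d ha hb U O hO δ hδ => ?_⟩
    have hn : 0 < a * b := Nat.mul_pos ha hb
    have hrc := fun v => MeanValue.row_col_num2 a b 1 d v (Nat.div_one _)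
    refine MeanValue.estimatesInTime (D := ⟨a, b, 1, d⟩) (mul_one _) hn (MeanValue.num2 a b) hb
      one_pos (fun u v h => ?_) (fun u v h => ?_) U hO hδ
      (fun ω => MeanValue.planeCmd_runs _) ?_
    · rw [(hrc u).1, (hrc v).1]; exact (MeanValue.grid2_le h).1
    · rw [(hrc u).2, (hrc v).2]; exact (MeanValue.grid2_le h).2
    · have h1 : ((MeanValue.Dims.J ⟨a, b, 1, d⟩ * 2 ^ MeanValue.Dims.w ⟨a, b, 1, d⟩ : ℕ) : ℝ) ≤
          ((a * b : ℕ) : ℝ) * (8192 * 2 ^ (43 * d ^ 2)) := by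
        exact_mod_cast MeanValue.plane_bound d hn
      have h2 : (2 : ℝ) ^ (43 * d ^ 2) ≤ 2 ^ (100250 * 8192 * d ^ 2) :=
        pow_le_pow_right₀ one_le_two (Nat.mul_le_mul_right _ (by norm_num))
      have h3 : (0 : ℝ) ≤ max 1 (δ ^ (-2 : ℤ)) := zero_le_one.trans (le_max_left _ _)
      calc 100250 * max 1 (δ ^ (-2 : ℤ)) *
            ((MeanValue.Dims.J ⟨a, b, 1, d⟩ * 2 ^ MeanValue.Dims.w ⟨a, b, 1, d⟩ : ℕ) : ℝ)
          ≤ 100250 * max 1 (δ ^ (-2 : ℤ)) * (((a * b : ℕ) : ℝ) *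
              (8192 * 2 ^ (100250 * 8192 * d ^ 2))) :=
            mul_le_mul_of_nonneg_left (h1.trans (by gcongr)) (by positivity)
        _ = _ := by push_cast; ring
  · refine ⟨.seq MeanValue.spaceCmd MeanValue.estimateCmd, 76, fun m d hm hd U O hO δ hδ => ?_⟩
    -- The cube is treated as an `m × m` grid of columns of `m` qubits. Edges in the third direction
    -- change neither row nor column, so they impose no condition on the layout.
    have hrc := fun v => MeanValue.row_col_num2 m m m d v.1 (MeanValue.num3_div m v)
    have hle : ∀ u v, (MeanValue.grid3 m).Adj u v →
        (u.1.1 : ℕ) ≤ v.1.1 + 1 ∧ (u.1.2 : ℕ) ≤ v.1.2 + 1 := by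
      intro u v h
      rw [MeanValue.grid3, SimpleGraph.boxProd_adj] at h
      rcases h with ⟨h, -⟩ | ⟨-, e⟩
      · exact MeanValue.grid2_le h
      · rw [e]; omega
    refine MeanValue.estimatesInTime (D := ⟨m, m, m, d⟩) rfl (Nat.mul_pos (Nat.mul_pos hm hm) hm)
      (MeanValue.num3 m) hm hm (fun u v h => ?_) (fun u v h => ?_) U hO hδ
      (fun ω => MeanValue.spaceCmd_runs _) ?_
    · rw [(hrc u).1, (hrc v).1]; exact (hle u v h).1
    · rw [(hrc u).2, (hrc v).2]; exact (hle u v h).2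
    · have h1 : (100250 : ℝ) *
          ((MeanValue.Dims.J ⟨m, m, m, d⟩ * 2 ^ MeanValue.Dims.w ⟨m, m, m, d⟩ : ℕ) : ℝ) ≤
            2 ^ (76 * d ^ 2 * m) := by
        exact_mod_cast MeanValue.space_bound hm hd
      have h3 : (0 : ℝ) ≤ max 1 (δ ^ (-2 : ℤ)) := zero_le_one.trans (le_max_left _ _)
      calc 100250 * max 1 (δ ^ (-2 : ℤ)) *
            ((MeanValue.Dims.J ⟨m, m, m, d⟩ * 2 ^ MeanValue.Dims.w ⟨m, m, m, d⟩ : ℕ) : ℝ)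
          = max 1 (δ ^ (-2 : ℤ)) * (100250 *
            ((MeanValue.Dims.J ⟨m, m, m, d⟩ * 2 ^ MeanValue.Dims.w ⟨m, m, m, d⟩ : ℕ) : ℝ)) := by
            ring
        _ ≤ _ := mul_le_mul_of_nonneg_left h1 h3
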